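/- A (nondeterministic quantitative) automaton $\mathcal A=(\Sigma,Q,\iota,\delta)$ has a finite alphabet $\Sigma$, a finite nonempty state set $Q$, an initial state $\iota\in Q$ and a transition function $\delta$ assigning to each $(q,\sigma)\in Q\times\Sigma$ a finite nonempty set of pairs $(x,q')\in\mathbb Q\times Q$ (transitions $q\xrightarrow{\sigma:x}q'$). A run on $w\in\Sigma^\omega$ is an infinite sequence of consecutive transitions that starts in $\iota$ and reads $w$. For a value function $\mathsf{Val}$, the $\mathsf{Val}$-automaton $\mathcal A$ expresses the function $\mathcal A(w)=\sup\{\mathsf{Val}(x_0x_1\ldots)\}$, the supremum ranging over the weight sequences $x_0x_1\ldots$ of the runs of $\mathcal A$ on $w$. Its top value is $\sup_{w\in\Sigma^\omega}\mathcal A(w)$, and $\mathcal A^q$ is $\mathcal A$ with initial state $q$. Here $\mathsf{Inf}(v)=\inf_n v_n$, $\mathsf{Sup}(v)=\sup_n v_n$, $\mathsf{LimInf}(v)=\liminf_n v_n$, $\mathsf{LimSup}(v)=\limsup_n v_n$, and $\mathsf{LimInfAvg}(v)$, $\mathsf{LimSupAvg}(v)$ are the limit inferior and the limit superior of $\frac1n\sum_{i<n}v_i$.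 The safety closure of $\Phi:\Sigma^\omega\to[-\infty,\infty]$ is $w\mapsto\inf_{u\prec w}\sup_{w'\in\Sigma^\omega}\Phi(uw')$, with $u$ ranging over the finite prefixes of $w$. The size of an automaton is the maximum of the sizes of its alphabet, state space and transition space, with weights written in binary. **Theorem.** Let $\mathsf{Val}\in\{\mathsf{Sup},\mathsf{LimInf},\mathsf{LimSup},\mathsf{LimInfAvg},\mathsf{LimSupAvg}\}$. There is an algorithm that, given a $\mathsf{Val}$-automaton $\mathcal A=(\Sigma,Q,\iota,\delta)$, constructs in time polynomial in the size of $\mathcal A$ an $\mathsf{Inf}$-automaton $\mathcal A'$ that expresses the safety closure of $\mathcal A$. Moreover: - If $\mathsf{Val}\neq\mathsf{Sup}$, then $\mathcal A'=(\Sigma,Q,\iota,\delta')$ with $\delta'(p,\sigma)=\{(\theta_q,q) : \exists x\in\mathbb Q,\ (x,q)\in\delta(p,\sigma)\}$, where $\theta_q\in\mathbb Q$ is the top value of the $\mathsf{Val}$-automaton $\mathcal A^q$. - If $\mathsf{Val}=\mathsf{Sup}$, then $\mathcal A'$ is obtained by the same reweighting from a $\mathsf{LimInf}$-automaton that is equivalent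 to $\mathcal A$ (that is, expresses the same function on $\Sigma^\omega$). -/

import Mathlib

open Filter

namespace QuantAut

/-! ### Quantitative properties -/

/-- The infinite word that agrees with `w` on its first `n` letters and continues with `w'`. -/
def splice {S : Type} (w : ℕ → S) (n : ℕ) (w' : ℕ → S) : ℕ → S :=
  fun i => if i < n then w i else w' (i - n)

/-- The safety closure of a property `Φ`: the infimum, over the finite prefixes `u` of `w`, of the
supremum over all infinite words `w'` of `Φ (u w')`. -/
def safetyClosure {S D : Type} [CompleteLattice D] (Φ : (ℕ → S) → D) (w : ℕ → S) : D :=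
  ⨅ n : ℕ, ⨆ w' : ℕ → S, Φ (splice w n w')

/-! ### Value functions -/

/-- Names of the value functions. -/
inductive ValFun : Type
  | inf
  | sup
  | limInf
  | limSup
  | limInfAvg
  | limSupAvg

/-- The average of the first `n` entries of `v`. -/
def avg (v : ℕ → ℚ) (n : ℕ) : ℚ := (∑ i ∈ Finset.range n, v i) / n

/-- A rational number as an extended real. -/
noncomputable def toE (x : ℚ) : EReal := ((x : ℝ) : EReal)

/-- The value functions on sequences of rationals. The values are taken in the complete lattice of
extended reals; on bounded sequences (such as the weight sequences of the runs of an automaton)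
they are real numbers. -/
noncomputable def ValFun.eval : ValFun → (ℕ → ℚ) → EReal
  | .inf, v => ⨅ n, toE (v n)
  | .sup, v => ⨆ n, toE (v n)
  | .limInf, v => liminf (fun n => toE (v n)) atTop
  | .limSup, v => limsup (fun n => toE (v n)) atTop
  | .limInfAvg, v => liminf (fun n => toE (avg v n)) atTop
  | .limSupAvg, v => limsup (fun n => toE (avg v n)) atTop

/-! ### Quantitative automata -/

/-- A total nondeterministic quantitative automaton with alphabet `S` and state set `Q`. -/
structure Automaton (S Q : Type) where
  /-- the initial state -/
  init : Q
  /-- the transition function, with values finite sets of weight-state pairs -/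
  δ : Q → S → Finset (ℚ × Q)
  total : ∀ q a, (δ q a).Nonempty

namespace Automaton

variable {S Q : Type}

/-- The automaton with the initial state replaced by `q`. -/
def startAt (A : Automaton S Q) (q : Q) : Automaton S Q := { A with init := q }

/-- The states `r 0, r 1, …` and the weights `x 0, x 1, …` form a run of `A` on `w`. -/
def IsRun (A : Automaton S Q) (w : ℕ → S) (r : ℕ → Q) (x : ℕ → ℚ) : Prop :=
  r 0 = A.init ∧ ∀ i, (x i, r (i + 1)) ∈ A.δ (r i) (w i)

/-- The value of the `V`-automaton `A` on `w`: the supremum of the values of the runs on `w`. -/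
noncomputable def value (V : ValFun) (A : Automaton S Q) (w : ℕ → S) : EReal :=
  ⨆ (r : ℕ → Q) (x : ℕ → ℚ) (_ : A.IsRun w r x), V.eval x

/-- The top value of the `V`-automaton `A`. -/
noncomputable def topValue (V : ValFun) (A : Automaton S Q) : EReal :=
  ⨆ w : ℕ → S, A.value V w

/-- `B` is `A` with each transition reweighted by the top value of the `V`-automaton `A` started
at the target of the transition. -/
def IsTopReweighting [DecidableEq Q] (V : ValFun) (A B : Automaton S Q) : Prop :=
  ∃ θ : Q → ℚ,
    (∀ p a, ∀ t ∈ A.δ p a, toE (θ t.2) = (A.startAt t.2).topValue V) ∧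
    B.init = A.init ∧
    ∀ p a, B.δ p a = (A.δ p a).image (fun t => (θ t.2, t.2))

end Automaton

/-! ### Random access machines with logarithmic cost

Programs are while-programs over finitely many arrays of integers, with arithmetic and with array
access at computed indices. Every operation is charged the binary lengths of its operands and of
its result (in particular, array access is charged the lengths of the index and of the content),
so that running times are polynomially related to those of Turing machines. -/

/-- The length of an integer in binary, including one bit for the sign. -/
def bits (z : ℤ) : ℕ := z.natAbs.size + 1

/-- A store: entry `i` of array `a` is `s a i`. -/
abbrev Store : Type := ℕ → ℤ → ℤ

/-- Integer expressions. -/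
inductive Exp : Type
  | lit (z : ℤ)
  | get (a : ℕ) (i : Exp)
  | add (e f : Exp)
  | sub (e f : Exp)
  | mul (e f : Exp)
  | div (e f : Exp)

/-- The value of an expression; `div` is integer division. -/
def Exp.val (s : Store) : Exp → ℤ
  | .lit z => z
  | .get a i => s a (i.val s)
  | .add e f => e.val s + f.val s
  | .sub e f => e.val s - f.val s
  | .mul e f => e.val s * f.val s
  | .div e f => e.val s / f.val s

/-- The cost of evaluating an expression: the total length of the values of all its
subexpressions. -/
def Exp.cost (s : Store) : Exp → ℕ
  | .lit z => bits z
  | .get a i => i.cost s + bits ((Exp.get a i).val s)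
  | .add e f => e.cost s + f.cost s + bits ((Exp.add e f).val s)
  | .sub e f => e.cost s + f.cost s + bits ((Exp.sub e f).val s)
  | .mul e f => e.cost s + f.cost s + bits ((Exp.mul e f).val s)
  | .div e f => e.cost s + f.cost s + bits ((Exp.div e f).val s)

/-- Programs. Tests ask whether the value of an expression is positive. -/
inductive Prog : Type
  | skip
  | set (a : ℕ) (i e : Exp)
  | seq (P R : Prog)
  | ite (e : Exp) (P R : Prog)
  | loop (e : Exp) (P : Prog)

/-- The store `s` with entry `i` of array `a` replaced by `z`. -/
def Store.write (s : Store) (a : ℕ) (i z : ℤ) : Store :=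
  fun b j => if b = a ∧ j = i then z else s b j

/-- `Exec P s s' t`: started in the store `s`, the program `P` halts in the store `s'` after
time `t`. -/
inductive Exec : Prog → Store → Store → ℕ → Prop
  | skip (s : Store) : Exec .skip s s 1
  | set (a : ℕ) (i e : Exp) (s : Store) :
      Exec (.set a i e) s (s.write a (i.val s) (e.val s)) (i.cost s + e.cost s)
  | seq {P R : Prog} {s s' s'' : Store} {t t' : ℕ} :
      Exec P s s' t → Exec R s' s'' t' → Exec (.seq P R) s s'' (t + t')
  | ite_pos {e : Exp} {P R : Prog} {s s' : Store} {t : ℕ} :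
      0 < e.val s → Exec P s s' t → Exec (.ite e P R) s s' (e.cost s + t)
  | ite_neg {e : Exp} {P R : Prog} {s s' : Store} {t : ℕ} :
      ¬ 0 < e.val s → Exec R s s' t → Exec (.ite e P R) s s' (e.cost s + t)
  | loop_pos {e : Exp} {P : Prog} {s s' s'' : Store} {t t' : ℕ} :
      0 < e.val s → Exec P s s' t → Exec (.loop e P) s' s'' t' →
        Exec (.loop e P) s s'' (e.cost s + t + t')
  | loop_neg {e : Exp} {P : Prog} {s : Store} :
      ¬ 0 < e.val s → Exec (.loop e P) s s (e.cost s)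

/-- The initial store for the input `l`: array `0` holds `l`, everything else is `0`. -/
def inputStore (l : List ℤ) : Store :=
  fun a i => if a = 0 ∧ 0 ≤ i then l.getD i.toNat 0 else 0

/-- On input `l` the program `P` halts within time `T` with the output `l'` in array `1`. -/
def Prog.Computes (P : Prog) (l l' : List ℤ) (T : ℕ) : Prop :=
  ∃ (s : Store) (t : ℕ), Exec P (inputStore l) s t ∧ t ≤ T ∧
    ∀ j : ℕ, j < l'.length → s 1 j = l'.getD j 0

/-! ### Automata as inputs and outputs of programs -/

/-- `l` is a code of `A`: it consists of the numbers of letters and of states, the initial state,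
the number of transitions, and, for each transition in some order and without repetition, its
source, its letter, the numerator and the denominator of its weight, and its target. -/
def Automaton.IsCode {k n : ℕ} (A : Automaton (Fin k) (Fin n)) (l : List ℤ) : Prop :=
  ∃ ts : List (Fin n × Fin k × ℚ × Fin n), ts.Nodup ∧
    (∀ p a x q, (p, a, x, q) ∈ ts ↔ (x, q) ∈ A.δ p a) ∧
    l = [(k : ℤ), (n : ℤ), ((A.init : ℕ) : ℤ), (ts.length : ℤ)] ++
      ts.flatMap (fun t =>
        [((t.1 : ℕ) : ℤ), ((t.2.1 : ℕ) : ℤ), t.2.2.1.num, (t.2.2.1.den : ℤ), ((t.2.2.2 : ℕ) : ℤ)])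

/-- The size of an automaton: the maximum of the sizes of its alphabet, of its state space and of
its transition space, with weights in binary. -/
def Automaton.size {k n : ℕ} (A : Automaton (Fin k) (Fin n)) : ℕ :=
  max k (max n (∑ p, ∑ a, ∑ t ∈ A.δ p a, (bits t.1.num + bits t.1.den)))

end QuantAut

/-! For the four value functions other than `sup`, removing finitely many weights from a run does
not change its value, because weights are bounded (`ValFun.Tail.eval_add`). Hence the supremum over
all continuations of a prefix is the greatest top value of a state to which the prefix leads, and
top values never increase along a transition. So the infimum of a run that is reweighted by the top
values of its targets stays below the safety closure. Conversely, if the closure at a word is `c`,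
every prefix leads to a state of top value at least `c`, and König's lemma merges these finite runs
into one infinite run that stays above `c` (`Automaton.exists_run_of_forall_le`,
`Automaton.IsTopReweighting.value_inf`).

The top value from `q` is the greatest value (minimum, maximum or mean of the weights) of a cycle of
length at most `n`, the number of states, that is reachable from `q` (`Automaton.topValue_eq`). Such
a cycle can be repeated forever. No run does better, by the pigeonhole principle and, for averages,
by cutting cycles out of its prefixes (`Automaton.Path.exists_simple`).

These maxima are found by dynamic programming. Weights are multiplied by the product of their
denominators and by `n!`, so that path values and cycle means are integers. A table holds the best
value of the paths of each length between any two states, its diagonal yields the best cycles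
through each state, and `n` rounds of propagation along transitions carry these values to all states
from which the cycles are reachable (`SP.mainP_spec`).

For `sup`, the automaton `Automaton.commitAut` simulates `A`, at some point chooses the transition
just taken, and repeats its weight forever. Its limit inferior therefore reaches every weight of the
run and exceeds none of their suprema (`Automaton.Commits.value_eq`). The program above is then
applied to this automaton.

Time bounds come from a language whose loops are counted by the number of states or of transitions,
and in whose products the right factor is short. Each operation then lengthens entries by an amount
that depends on the input only, instead of doubling them, and so lengths and times stay polynomial
(`SP.exec_compile`). -/

namespace QuantAut

/-! ### A structured language of programs with counted loops -/

/-- A size of an expression that also bounds the growth of values. -/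
def Exp.sz : Exp → ℕ
  | .lit z => bits z
  | .get _ i => i.sz + 1
  | .add e f => e.sz + f.sz + 1
  | .sub e f => e.sz + f.sz + 1
  | .mul e f => e.sz + f.sz + 1
  | .div e f => e.sz + f.sz + 1

/-- Expressions built by addition from literals, entries of the read-only array `σ` and loop
counters. -/
def Exp.Small (σ : ℕ) : Exp → Prop
  | .lit _ => True
  | .get a _ => a = σ ∨ a = 2
  | .add e f => e.Small σ ∧ f.Small σ
  | _ => False

/-- Expressions in which the right factor of every product is small. -/
def Exp.Ok (σ : ℕ) : Exp → Prop
  | .lit _ => True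
  | .get _ i => i.Ok σ
  | .add e f => e.Ok σ ∧ f.Ok σ
  | .sub e f => e.Ok σ ∧ f.Ok σ
  | .mul e f => e.Ok σ ∧ f.Ok σ ∧ f.Small σ
  | .div e f => e.Ok σ ∧ f.Ok σ

/-- Structured programs. `rep c j P` runs `P` as often as entry `j` of the read-only array says,
with entry `c` of array `2` as loop counter; `gcd` replaces the first two entries of array `4` by
their greatest common divisor and `0`. -/
inductive SP : Type
  | skip
  | set (a : ℕ) (i e : Exp)
  | seq (P R : SP)
  | ite (e : Exp) (P R : SP)
  | rep (c j : ℕ) (P : SP)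
  | gcd

namespace SP

/-- The loop of Euclid's algorithm. -/
def gcdLoop : Prog :=
  .loop (.get 4 (.lit 1))
    (.seq (.set 4 (.lit 2) (.sub (.get 4 (.lit 0))
        (.mul (.div (.get 4 (.lit 0)) (.get 4 (.lit 1))) (.get 4 (.lit 1)))))
      (.seq (.set 4 (.lit 0) (.get 4 (.lit 1))) (.set 4 (.lit 1) (.get 4 (.lit 2)))))

/-- The test of a counted loop. -/
def repTest (σ c j : ℕ) : Exp := .sub (.get σ (.lit j)) (.get 2 (.lit c))

/-- The increment of a loop counter. -/
def repIncr (c : ℕ) : Prog := .set 2 (.lit c) (.add (.get 2 (.lit c)) (.lit 1))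

/-- The program described by a structured program. -/
def compile (σ : ℕ) : SP → Prog
  | skip => .skip
  | set a i e => .set a i e
  | seq P R => .seq (P.compile σ) (R.compile σ)
  | ite e P R => .ite e (P.compile σ) (R.compile σ)
  | rep c j P => .seq (.set 2 (.lit c) (.lit 0))
      (.loop (repTest σ c j) (.seq (P.compile σ) (repIncr c)))
  | gcd => gcdLoop

/-- The store after a number of rounds of a counted loop with body `f`. -/
def rounds (f : Store → Store) (c : ℕ) (s : Store) : ℕ → Store
  | 0 => s.write 2 c 0
  | i + 1 => (f (rounds f c s i)).write 2 c ((i : ℤ) + 1)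

/-- The store computed by a structured program. -/
def eval (σ : ℕ) : SP → Store → Store
  | skip, s => s
  | set a i e, s => s.write a (i.val s) (e.val s)
  | seq P R, s => R.eval σ (P.eval σ s)
  | ite e P R, s => if 0 < e.val s then P.eval σ s else R.eval σ s
  | rep c j P, s => rounds (P.eval σ) c s (s σ j).toNat
  | gcd, s => if 0 < s 4 1 then
      ((s.write 4 2 0).write 4 0 (Int.gcd (s 4 0) (s 4 1) : ℕ)).write 4 1 0 else s

/-- The arrays written by a structured program. -/
def writes : SP → List ℕ
  | skip => []
  | set a _ _ => [a]
  | seq P R => P.writes ++ R.writes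
  | ite _ P R => P.writes ++ R.writes
  | rep _ _ P => 2 :: P.writes
  | gcd => [4]

/-- The loop counters of a structured program. -/
def counters : SP → List ℕ
  | skip => []
  | set _ _ _ => []
  | seq P R => P.counters ++ R.counters
  | ite _ P R => P.counters ++ R.counters
  | rep c _ P => c :: P.counters
  | gcd => []

/-- Well-formedness: the arrays of inputs and counters are not assigned to, counters of nested
loops differ, and expressions are well-formed. -/
def Wf (σ : ℕ) : SP → Prop
  | skip => True
  | set a i e => a ≠ σ ∧ a ≠ 2 ∧ i.Ok σ ∧ e.Ok σ
  | seq P R => P.Wf σ ∧ R.Wf σ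
  | ite e P R => e.Ok σ ∧ P.Wf σ ∧ R.Wf σ
  | rep c j P => c ∉ P.counters ∧ (j = 1 ∨ j = 3) ∧ P.Wf σ
  | gcd => True

end SP

/-! ### Stores, frame rules and the invariant rule for counted loops. -/

theorem Store.write_same (s : Store) (a : ℕ) (i z : ℤ) : s.write a i z a i = z := by
  simp [Store.write]

theorem Store.write_apply (s : Store) (a : ℕ) (i z : ℤ) (b : ℕ) (j : ℤ) :
    s.write a i z b j = if b = a ∧ j = i then z else s b j := rfl

theorem Store.write_of_ne (s : Store) {a b : ℕ} (h : b ≠ a) (i z : ℤ) : s.write a i z b = s b := by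
  funext j; simp [Store.write, h]

theorem Store.write_self (s : Store) (a : ℕ) (i z j : ℤ) :
    s.write a i z a j = if j = i then z else s a j := by
  simp [Store.write]

namespace SP

theorem rounds_apply_of_ne {f : Store → Store} {a : ℕ} (ha : a ≠ 2) (h : ∀ s, f s a = s a) (c : ℕ)
    (s : Store) (i : ℕ) : rounds f c s i a = s a := by
  induction i with
  | zero => exact Store.write_of_ne _ ha _ _
  | succ i ih => rw [rounds, Store.write_of_ne _ ha, h, ih]

theorem eval_frame (σ : ℕ) {a : ℕ} : ∀ (P : SP), a ∉ P.writes → ∀ s, P.eval σ s a = s a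
  | skip, _, s => rfl
  | set b i e, h, s => Store.write_of_ne _ (by simpa [writes] using h) _ _
  | seq P R, h, s => by
      simp only [writes, List.mem_append, not_or] at h
      rw [eval, eval_frame σ R h.2, eval_frame σ P h.1]
  | ite e P R, h, s => by
      simp only [writes, List.mem_append, not_or] at h
      rw [eval]
      split_ifs
      · exact eval_frame σ P h.1 s
      · exact eval_frame σ R h.2 s
  | rep c j P, h, s => by
      simp only [writes, List.mem_cons, not_or] at h
      exact rounds_apply_of_ne h.1 (eval_frame σ P h.2) c s _
  | gcd, h, s => by
      have h : a ≠ 4 := by simpa [writes] using h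
      rw [eval]
      split_ifs
      · rw [Store.write_of_ne _ h, Store.write_of_ne _ h, Store.write_of_ne _ h]
      · rfl

theorem Wf.notMem_writes {σ : ℕ} (h2 : σ ≠ 2) (h4 : σ ≠ 4) : ∀ {P : SP}, P.Wf σ → σ ∉ P.writes
  | skip, _ => by simp [writes]
  | set b i e, h => by simpa [writes] using h.1.symm
  | seq P R, h => by
      simpa [writes] using ⟨h.1.notMem_writes h2 h4, h.2.notMem_writes h2 h4⟩
  | ite e P R, h => by
      simpa [writes] using ⟨h.2.1.notMem_writes h2 h4, h.2.2.notMem_writes h2 h4⟩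
  | rep c j P, h => by simpa [writes] using ⟨h2, h.2.2.notMem_writes h2 h4⟩
  | gcd, _ => by simpa [writes] using h4

/-- Assignments to array `2` are ill-formed, so only a loop with counter `c` inside `P` could touch
this entry. This guarantees that the body of a loop leaves its own counter alone, so that the
compiled loop makes exactly the rounds counted by `rounds`. -/
theorem eval_counter {σ : ℕ} {c : ℕ} : ∀ {P : SP}, P.Wf σ → c ∉ P.counters →
    ∀ s, P.eval σ s 2 c = s 2 c
  | skip, _, _, s => rfl
  | set b i e, h, _, s => by rw [eval, Store.write_of_ne _ h.2.1.symm]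
  | seq P R, h, hc, s => by
      simp only [counters, List.mem_append, not_or] at hc
      rw [eval, eval_counter h.2 hc.2, eval_counter h.1 hc.1]
  | ite e P R, h, hc, s => by
      simp only [counters, List.mem_append, not_or] at hc
      rw [eval]
      split_ifs
      · exact eval_counter h.2.1 hc.1 s
      · exact eval_counter h.2.2 hc.2 s
  | rep d j P, h, hc, s => by
      simp only [counters, List.mem_cons, not_or] at hc
      have hne : (c : ℤ) ≠ d := by exact_mod_cast hc.1
      rw [eval]
      induction (s σ j).toNat with
      | zero => simp [rounds, Store.write_apply, hne]
      | succ i ih => simp [rounds, Store.write_apply, hne, eval_counter h.2.2 hc.2, ih]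
  | gcd, _, _, s => by
      rw [eval]; split_ifs <;> simp [Store.write_apply]

theorem rounds_counter (f : Store → Store) (c : ℕ) (s : Store) (i : ℕ) :
    rounds f c s i 2 c = i := by
  cases i <;> simp [rounds, Store.write_apply]

/-- The invariant rule for counted loops. -/
theorem eval_rep {σ c j : ℕ} {P : SP} {s : Store} (Inv : ℕ → Store → Prop)
    (h0 : Inv 0 (s.write 2 c 0))
    (hs : ∀ i : ℕ, i < (s σ j).toNat → ∀ s' : Store, s' 2 c = (i : ℤ) → Inv i s' →
      Inv (i + 1) ((P.eval σ s').write 2 c ((i : ℤ) + 1))) :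
    Inv (s σ j).toNat ((rep c j P).eval σ s) := by
  rw [eval]
  suffices ∀ i ≤ (s σ j).toNat, Inv i (rounds (P.eval σ) c s i) from this _ le_rfl
  intro i hi
  induction i with
  | zero => exact h0
  | succ i ih =>
    exact hs i hi _ (rounds_counter _ _ _ _) (ih (by omega))

/-! ### Running times of structured programs -/

/-- All entries have less than `B` bits, inputs and counters have less than `y` bits, and loop
bounds are at most `y`. -/
structure Bounded (σ y B : ℕ) (s : Store) : Prop where
  pos : 1 ≤ y
  le : y ≤ B
  all : ∀ a i, (s a i).natAbs < 2 ^ B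
  inp : ∀ i, (s σ i).natAbs < 2 ^ y
  ctr : ∀ i, (s 2 i).natAbs < 2 ^ y
  one : s σ 1 ≤ y
  three : s σ 3 ≤ y

theorem Bounded.mono {σ y B B' : ℕ} {s : Store} (h : Bounded σ y B s) (hB : B ≤ B') :
    Bounded σ y B' s :=
  { h with
    le := h.le.trans hB
    all := fun a i => (h.all a i).trans_le (Nat.pow_le_pow_right (by norm_num) hB) }

end SP

theorem Exp.sz_pos (e : Exp) : 1 ≤ e.sz := by
  cases e <;> simp [Exp.sz, bits]

theorem natAbs_lt_of_bits (z : ℤ) {y : ℕ} (hy : 1 ≤ y) : z.natAbs < 2 ^ (y * bits z) :=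
  (Nat.lt_size_self _).trans_le (Nat.pow_le_pow_right (by norm_num)
    ((Nat.le_succ _).trans (Nat.le_mul_of_pos_left _ hy)))

theorem add_lt_two_pow {a b y B m n : ℕ} (hy : 1 ≤ y) (ha : a < 2 ^ (B + y * m))
    (hb : b < 2 ^ (B + y * n)) : a + b < 2 ^ (B + y * (m + n + 1)) := by
  have h1 : 2 ^ (B + y * m) ≤ 2 ^ (B + y * (m + n)) :=
    Nat.pow_le_pow_right (by norm_num) (by nlinarith)
  have h2 : 2 ^ (B + y * n) ≤ 2 ^ (B + y * (m + n)) :=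
    Nat.pow_le_pow_right (by norm_num) (by nlinarith)
  have h3 : 2 ^ (B + y * (m + n) + 1) ≤ 2 ^ (B + y * (m + n + 1)) :=
    Nat.pow_le_pow_right (by norm_num) (by nlinarith)
  rw [pow_succ] at h3
  omega

theorem Exp.Small.natAbs_val_lt {σ y B : ℕ} {s : Store} (hs : SP.Bounded σ y B s) :
    ∀ {e : Exp}, e.Small σ → (e.val s).natAbs < 2 ^ (y * e.sz)
  | .lit z, _ => natAbs_lt_of_bits z hs.pos
  | .get a i, h => by
      have : 2 ^ y ≤ 2 ^ (y * (i.sz + 1)) := Nat.pow_le_pow_right (by norm_num) (by nlinarith)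
      rcases h with rfl | rfl
      · exact (hs.inp _).trans_le this
      · exact (hs.ctr _).trans_le this
  | .add e f, h => by
      have := add_lt_two_pow (B := 0) hs.pos (by simpa using h.1.natAbs_val_lt hs)
        (by simpa using h.2.natAbs_val_lt hs)
      rw [Nat.zero_add] at this
      exact (Int.natAbs_add_le _ _).trans_lt this

/-- The length of the right factor of a product is at most `y * f.sz`, independently of `B`. A
product thus adds a multiple of `y` to the length of its left factor instead of doubling it. -/
theorem Exp.Ok.natAbs_val_lt {σ y B : ℕ} {s : Store} (hs : SP.Bounded σ y B s) :
    ∀ {e : Exp}, e.Ok σ → (e.val s).natAbs < 2 ^ (B + y * e.sz)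
  | .lit z, _ => (natAbs_lt_of_bits z hs.pos).trans_le
      (Nat.pow_le_pow_right (by norm_num) (by simp [Exp.sz]))
  | .get a i, _ => (hs.all _ _).trans_le (Nat.pow_le_pow_right (by norm_num) (by simp))
  | .add e f, h => (Int.natAbs_add_le _ _).trans_lt
      (add_lt_two_pow hs.pos (h.1.natAbs_val_lt hs) (h.2.natAbs_val_lt hs))
  | .sub e f, h => (Int.natAbs_sub_le _ _).trans_lt
      (add_lt_two_pow hs.pos (h.1.natAbs_val_lt hs) (h.2.natAbs_val_lt hs))
  | .mul e f, h => by
      rw [Exp.val, Int.natAbs_mul]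
      calc _ < 2 ^ (B + y * e.sz) * 2 ^ (y * f.sz) :=
            Nat.mul_lt_mul'' (h.1.natAbs_val_lt hs) (h.2.2.natAbs_val_lt hs)
        _ = 2 ^ (B + y * e.sz + y * f.sz) := (pow_add _ _ _).symm
        _ ≤ _ := Nat.pow_le_pow_right (by norm_num) (by simp only [Exp.sz]; nlinarith)
  | .div e f, h => by
      refine (Int.natAbs_ediv_le_natAbs _ _).trans_lt ((h.1.natAbs_val_lt hs).trans_le ?_)
      exact Nat.pow_le_pow_right (by norm_num) (by simp only [Exp.sz]; nlinarith)

theorem bits_le_of_natAbs_lt {z : ℤ} {B : ℕ} (h : z.natAbs < 2 ^ B) : bits z ≤ B + 1 :=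
  Nat.succ_le_succ (Nat.size_le.2 h)

theorem Exp.Ok.cost_le {σ y B : ℕ} {s : Store} (hs : SP.Bounded σ y B s) :
    ∀ {e : Exp}, e.Ok σ → e.cost s ≤ e.sz * (B + y * e.sz + 1)
  | .lit z, _ => by
      simp only [Exp.cost, Exp.sz]
      exact Nat.le_mul_of_pos_right _ (by omega)
  | .get a i, h => by
      have h1 := Exp.Ok.cost_le hs (e := i) h
      have h2 := bits_le_of_natAbs_lt (Exp.Ok.natAbs_val_lt hs (e := .get a i) h)
      simp only [Exp.cost, Exp.sz] at *
      nlinarith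
  | .add e f, h => by
      have h1 := h.1.cost_le hs
      have h3 := h.2.cost_le hs
      have h2 := bits_le_of_natAbs_lt (Exp.Ok.natAbs_val_lt hs (e := .add e f) h)
      simp only [Exp.cost, Exp.sz] at *
      nlinarith [Nat.zero_le (y * e.sz * f.sz), Nat.zero_le (y * e.sz), Nat.zero_le (y * f.sz)]
  | .sub e f, h => by
      have h1 := h.1.cost_le hs
      have h3 := h.2.cost_le hs
      have h2 := bits_le_of_natAbs_lt (Exp.Ok.natAbs_val_lt hs (e := .sub e f) h)
      simp only [Exp.cost, Exp.sz] at *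
      nlinarith [Nat.zero_le (y * e.sz * f.sz), Nat.zero_le (y * e.sz), Nat.zero_le (y * f.sz)]
  | .mul e f, h => by
      have h1 := h.1.cost_le hs
      have h3 := h.2.1.cost_le hs
      have h2 := bits_le_of_natAbs_lt (Exp.Ok.natAbs_val_lt hs (e := .mul e f) h)
      simp only [Exp.cost, Exp.sz] at *
      nlinarith [Nat.zero_le (y * e.sz * f.sz), Nat.zero_le (y * e.sz), Nat.zero_le (y * f.sz)]
  | .div e f, h => by
      have h1 := h.1.cost_le hs
      have h3 := h.2.cost_le hs
      have h2 := bits_le_of_natAbs_lt (Exp.Ok.natAbs_val_lt hs (e := .div e f) h)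
      simp only [Exp.cost, Exp.sz] at *
      nlinarith [Nat.zero_le (y * e.sz * f.sz), Nat.zero_le (y * e.sz), Nat.zero_le (y * f.sz)]

/-! ### Euclid's algorithm and the time bound for structured programs. -/

namespace SP

/-- Since `a % b < b` and `a % b + b ≤ a`, the remainder is less than half of `a` and loses a bit.
-/
theorem size_mod_lt {a b : ℕ} (hb : 0 < b) (h : b < a) : (a % b).size + 1 ≤ a.size := by
  obtain ⟨m, hm⟩ : ∃ m, a.size = m + 1 := ⟨a.size - 1, by have := Nat.size_pos.2 (hb.trans h); omega⟩
  have h1 : a < 2 ^ (m + 1) := hm ▸ Nat.lt_size_self a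
  have h2 : a % b < b := Nat.mod_lt _ hb
  have h3 : a % b + b ≤ a := by
    have := Nat.mod_add_div a b
    have : 1 ≤ a / b := (Nat.one_le_div_iff hb).2 h.le
    nlinarith
  rw [hm]
  refine Nat.succ_le_succ (Nat.size_le.2 ?_)
  rw [pow_succ] at h1
  omega

/-- A round replaces `(x, y)` by `(y, x % y)`. The lengths of `y` and `x % y` become those of `x %
y` and `y % (x % y)`, and the latter is shorter than `y` by `size_mod_lt`. Their sum drops in every
round, so the number of rounds is linear in the length. The last round leaves the remainder `0` in
entry `2`, which is why `eval` writes it there. -/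
theorem exec_gcdLoop (B : ℕ) : ∀ (y : ℕ) (x : ℤ) (s : Store), s 4 0 = x → s 4 1 = y →
    x.natAbs < 2 ^ B → y < 2 ^ B →
    ∃ t ≤ (if y = 0 then 1 else y.size + (x % y).natAbs.size + 2) * (60 * (B + 3)),
      Exec gcdLoop s (SP.gcd.eval 0 s) t := by
  intro y
  induction y using Nat.strong_induction_on with
  | _ y ih =>
    intro x s hx hy hxB hyB
    have b0 : bits 0 = 1 := by simp [bits]
    have b1 : bits 1 = 2 := by simp [bits]
    have b2 : bits 2 ≤ 3 := bits_le_of_natAbs_lt (B := 2) (by norm_num)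
    have hyb : bits (y : ℤ) ≤ B + 1 := bits_le_of_natAbs_lt (by simpa using hyB)
    have hxb : bits x ≤ B + 1 := bits_le_of_natAbs_lt hxB
    by_cases hy0 : y = 0
    · subst hy0
      have hn : ¬ 0 < (Exp.get 4 (.lit 1)).val s := by simp [Exp.val, hy]
      have hs : SP.gcd.eval 0 s = s := by simp [eval, hy]
      rw [hs]
      refine ⟨(Exp.get 4 (.lit 1)).cost s, ?_, Exec.loop_neg hn⟩
      · simp only [Exp.cost, Exp.val, hy, b1]
        simp only [Nat.cast_zero] at hyb
        simp only [if_true, Nat.cast_zero]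
        omega
    · have hypos : 0 < y := Nat.pos_of_ne_zero hy0
      have hyposZ : (0 : ℤ) < y := by exact_mod_cast hypos
      have hp : 0 < (Exp.get 4 (.lit 1)).val s := by simpa [Exp.val, hy] using hypos
      obtain ⟨r, hr⟩ : ∃ r : ℕ, x % y = r := ⟨(x % y).toNat, by
        rw [Int.toNat_of_nonneg (Int.emod_nonneg _ hyposZ.ne')]⟩
      have hry : r < y := by
        have := Int.emod_lt_of_pos x hyposZ
        omega
      have hsub : x - x / y * y = r := by
        have := Int.emod_add_mul_ediv x y
        rw [← hr]; linarith
      set s1 := s.write 4 2 r with hs1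
      set s2 := s1.write 4 0 y with hs2
      set s3 := s2.write 4 1 r with hs3
      have e1 := Exec.set 4 (.lit 2) (.sub (.get 4 (.lit 0))
          (.mul (.div (.get 4 (.lit 0)) (.get 4 (.lit 1))) (.get 4 (.lit 1)))) s
      simp only [Exp.val, hx, hy, hsub, ← hs1] at e1
      have hv1 : s1 4 1 = y := by simp [hs1, Store.write_apply, hy]
      have e2 := Exec.set 4 (.lit 0) (.get 4 (.lit 1)) s1
      simp only [Exp.val, hv1, ← hs2] at e2
      have hv2 : s2 4 2 = r := by simp [hs2, hs1, Store.write_apply]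
      have e3 := Exec.set 4 (.lit 1) (.get 4 (.lit 2)) s2
      simp only [Exp.val, hv2, ← hs3] at e3
      obtain ⟨t, ht, hE⟩ := ih r hry y s3 (by simp [hs3, hs2, Store.write_apply])
        (by simp [hs3, Store.write_apply]) (by simpa using hyB) (hry.trans hyB)
      have hev : SP.gcd.eval 0 s = SP.gcd.eval 0 s3 := by
        have hgcd : Int.gcd x y = Int.gcd y r := by
          rw [← hsub, Int.gcd_sub_mul_right_right, Int.gcd_comm]
        have h31 : s3 4 1 = r := by simp [hs3, Store.write_apply]
        have h30 : s3 4 0 = y := by simp [hs3, hs2, Store.write_apply]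
        rw [eval, eval, if_pos (by rw [hy]; exact hyposZ), h31, h30, hx, hy, hgcd]
        funext a i
        by_cases hr0 : r = 0
        · subst hr0
          simp only [Nat.cast_zero, lt_irrefl, if_false, hs3, hs2, hs1, Store.write_apply,
            Int.gcd_zero_right, Int.natAbs_natCast]
        · rw [if_pos (by exact_mod_cast Nat.pos_of_ne_zero hr0)]
          simp only [hs3, hs2, hs1, Store.write_apply]
          split_ifs <;> rfl
      rw [hev]
      refine ⟨_, ?_, Exec.loop_pos hp (Exec.seq e1 (Exec.seq e2 e3)) hE⟩
      · have hq : bits (x / y) ≤ B + 1 :=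
          bits_le_of_natAbs_lt ((Int.natAbs_ediv_le_natAbs _ _).trans_lt hxB)
        have hrb : bits (r : ℤ) ≤ B + 1 :=
          bits_le_of_natAbs_lt (by simpa using hry.trans hyB)
        have hm : bits (x / y * y) ≤ B + 2 := by
          refine bits_le_of_natAbs_lt ?_
          have : x / y * y = x - r := by linarith
          rw [this, pow_succ]
          have := Int.natAbs_sub_le x r
          simp only [Int.natAbs_natCast] at this
          omega
        have hv1 : s1 4 1 = y := by simp [hs1, Store.write_apply, hy]
        have hv2 : s2 4 2 = r := by simp [hs2, hs1, Store.write_apply]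
        have hmeas : (if r = 0 then 1 else r.size + ((y : ℤ) % r).natAbs.size + 2) + 1 ≤
            y.size + (x % y).natAbs.size + 2 := by
          rw [hr]
          have : ((y : ℤ) % r).natAbs = y % r := by
            rw [← Int.natCast_mod, Int.natAbs_natCast]
          rw [this, Int.natAbs_natCast]
          by_cases hr0 : r = 0
          · subst hr0
            rw [if_pos rfl]
            omega
          · rw [if_neg hr0]
            have := size_mod_lt (Nat.pos_of_ne_zero hr0) hry
            omega
        rw [if_neg hy0]
        simp only [Exp.cost, Exp.val, hx, hy, hsub, hv1, hv2, b0, b1]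
        nlinarith [Nat.mul_le_mul_right (60 * (B + 3)) hmeas]

/-- The polynomial that governs the running time and the growth of the entries. -/
noncomputable def poly (σ : ℕ) : SP → Polynomial ℕ
  | skip => 1
  | set _ i e => .C (i.sz + e.sz) * (.X + 1)
  | seq P R => P.poly σ + R.poly σ
  | ite e P R => .C e.sz * (.X + 1) + P.poly σ + R.poly σ
  | rep c j P => (.X + 1) * (2 * (.C ((repTest σ c j).sz + 2 * bits c + 6) * (.X + 1)) + P.poly σ)
  | gcd => 200

theorem Bounded.write {σ y B : ℕ} {s : Store} (h : Bounded σ y B s) {a : ℕ} (ha : a ≠ σ)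
    (i z : ℤ) (hz : z.natAbs < 2 ^ B)
    (hz2 : a = 2 → z.natAbs < 2 ^ y) : Bounded σ y B (s.write a i z) where
  pos := h.pos
  le := h.le
  all b j := by
    rw [Store.write_apply]
    split_ifs
    · exact hz
    · exact h.all _ _
  inp j := by rw [Store.write_of_ne _ ha.symm]; exact h.inp j
  ctr j := by
    rw [Store.write_apply]
    split_ifs with hh
    · exact hz2 hh.1.symm
    · exact h.ctr _
  one := by rw [Store.write_of_ne _ ha.symm]; exact h.one
  three := by rw [Store.write_of_ne _ ha.symm]; exact h.three

theorem Exp.Ok.cost_le' {σ y B m : ℕ} {s : Store} (hs : Bounded σ y B s) {e : Exp} (he : e.Ok σ)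
    (hm : e.sz ≤ m) : e.cost s ≤ m * (y + 1) * (B + m * (y + 1)) ^ 2 := by
  have h1 := he.cost_le hs
  have h0 := e.sz_pos
  have h2 : e.sz * (B + y * e.sz + 1) ≤ m * (B + m * (y + 1)) :=
    Nat.mul_le_mul hm (by nlinarith [hs.pos])
  have h3 : 1 ≤ B + m * (y + 1) := by nlinarith [hs.pos, hs.le]
  calc _ ≤ m * (B + m * (y + 1)) := h1.trans h2
    _ ≤ m * (y + 1) * (B + m * (y + 1)) := by nlinarith [Nat.zero_le (m * y * (B + m * (y + 1)))]
    _ ≤ _ := Nat.mul_le_mul_left _ (by nlinarith)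


theorem loop_bound {q g B F : ℕ} (h : B + q + g ≤ F) (t1 t2 t3 d : ℕ)
    (h1 : t1 ≤ q * (B + q) ^ 2) (h2 : t2 ≤ g * (B + g) ^ 2) (h3 : t3 ≤ q * (B + g + q) ^ 2)
    (t : ℕ) (ht : t ≤ (d * (2 * q + g) + q) * F ^ 2) :
    t1 + (t2 + t3) + t ≤ ((d + 1) * (2 * q + g) + q) * F ^ 2 := by
  have e1 : q * (B + q) ^ 2 ≤ q * F ^ 2 := Nat.mul_le_mul_left _ (Nat.pow_le_pow_left (by omega) _)
  have e2 : g * (B + g) ^ 2 ≤ g * F ^ 2 := Nat.mul_le_mul_left _ (Nat.pow_le_pow_left (by omega) _)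
  have e3 : q * (B + g + q) ^ 2 ≤ q * F ^ 2 :=
    Nat.mul_le_mul_left _ (Nat.pow_le_pow_left (by omega) _)
  nlinarith

theorem loop_total {b q g N y t F : ℕ} (hb : b + 1 ≤ q) (hF : 1 ≤ F) (hN : N ≤ y)
    (ht : t ≤ (N * (2 * q + g) + q) * F ^ 2) : b + 1 + t ≤ (y + 1) * (2 * q + g) * F ^ 2 := by
  have h5 : b + 1 ≤ q * F ^ 2 := hb.trans (Nat.le_mul_of_pos_right _ (Nat.one_le_pow _ _ hF))
  have h6 : N * (2 * q + g) ≤ y * (2 * q + g) := Nat.mul_le_mul_right _ hN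
  calc _ ≤ q * F ^ 2 + (N * (2 * q + g) + q) * F ^ 2 := add_le_add h5 ht
    _ = (N * (2 * q + g) + q + q) * F ^ 2 := by ring
    _ ≤ _ := Nat.mul_le_mul_right _ (by nlinarith)

-- The polynomial of the body is evaluated at `y`, which bounds inputs and counters and stays fixed,
-- and not at the growing length `B`. Every round therefore adds the same amount `q + g` to the
-- length, where `q` pays for test and increment and `g` for the body, and there are at most `y`
-- rounds.
set_option maxHeartbeats 1000000 in
theorem exec_rep {σ c j : ℕ} (h2 : σ ≠ 2) (h4 : σ ≠ 4) {P : SP} (hwf : (rep c j P).Wf σ)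
    (ih : ∀ {y B : ℕ} {s : Store},
      Bounded σ y B s → Bounded σ y (B + (P.poly σ).eval y) (P.eval σ s) ∧
        ∃ t ≤ (P.poly σ).eval y * (B + (P.poly σ).eval y) ^ 2,
          Exec (P.compile σ) s (P.eval σ s) t)
    {y B : ℕ} {s : Store} (hs : Bounded σ y B s) :
    Bounded σ y (B + ((rep c j P).poly σ).eval y) ((rep c j P).eval σ s) ∧
      ∃ t ≤ ((rep c j P).poly σ).eval y * (B + ((rep c j P).poly σ).eval y) ^ 2,
        Exec ((rep c j P).compile σ) s ((rep c j P).eval σ s) t := by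
  obtain ⟨hc, hj, hP⟩ := hwf
  rw [eval]
  simp only [poly, Polynomial.eval_add, Polynomial.eval_mul, Polynomial.eval_C, Polynomial.eval_X,
    Polynomial.eval_one, Polynomial.eval_ofNat]
  set m := (repTest σ c j).sz + 2 * bits c + 6 with hm
  set q := m * (y + 1) with hq
  set g := (P.poly σ).eval y with hg
  set N := (s σ j).toNat with hN
  have hNy : N ≤ y := by
    have h1 := hs.one
    have h3 := hs.three
    rcases hj with rfl | rfl
    · simp only [Nat.cast_one] at hN; omega
    · simp only [Nat.cast_ofNat] at hN; omega
  have hyy : y < 2 ^ y := Nat.lt_two_pow_self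
  set S := rounds (P.eval σ) c s with hS
  have hSσ : ∀ i, S i σ = s σ :=
    rounds_apply_of_ne h2 (eval_frame σ P (hP.notMem_writes h2 h4)) c s
  have hcast : ∀ i, i ≤ N → ((i : ℤ)).natAbs < 2 ^ y := fun i hi => by
    rw [Int.natAbs_natCast]; omega
  have hq1 : 1 ≤ q := by
    have : 1 * 1 ≤ m * (y + 1) := Nat.mul_le_mul (by omega) (by omega)
    omega
  have hSb : ∀ i ≤ N, Bounded σ y (B + q + i * (q + g)) (S i) := by
    intro i
    induction i with
    | zero =>
      intro _
      refine (hs.mono (by omega)).write h2.symm _ _ ?_ ?_ <;> simp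
    | succ i ihi =>
      intro hi
      refine ((ih (ihi (by omega))).1.mono ?_).write h2.symm _ _ ?_ ?_
      · rw [add_mul]; omega
      · refine (hcast _ hi).trans_le (Nat.pow_le_pow_right (by norm_num) ?_)
        have := hs.le
        omega
      · exact fun _ => hcast _ hi
  have hF : ∀ i ≤ N, B + q + i * (q + g) ≤ B + q + N * (q + g) := fun i hi => by gcongr
  set F := B + (y + 1) * (2 * q + g) with hFdef
  have hNF : B + q + N * (q + g) ≤ F := by nlinarith
  have hrunP : ∀ i < N, ∃ t ≤ g * (B + q + i * (q + g) + g) ^ 2,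
      Exec (P.compile σ) (S i) (P.eval σ (S i)) t := fun i hi => (ih (hSb i hi.le)).2
  have hinc : ∀ i < N, ∃ t ≤ q * (B + q + i * (q + g) + g + q) ^ 2,
      Exec (repIncr c) (P.eval σ (S i)) (S (i + 1)) t := by
    intro i hi
    have hb := (ih (hSb i hi.le)).1
    have hv : P.eval σ (S i) 2 c = i := by
      rw [eval_counter hP hc, hS, rounds_counter]
    have hE := Exec.set 2 (.lit c) (.add (.get 2 (.lit c)) (.lit 1)) (P.eval σ (S i))
    simp only [Exp.val, hv] at hE
    refine ⟨_, ?_, hE⟩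
    have h1 : (Exp.lit c).Ok σ := trivial
    have h2 : (Exp.add (.get 2 (.lit c)) (.lit 1)).Ok σ := ⟨trivial, trivial⟩
    have hb0 : bits 1 = 2 := by simp [bits]
    have c1 := h1.cost_le hb
    have c2 := h2.cost_le hb
    simp only [Exp.sz, hb0] at c1 c2
    set D := B + q + i * (q + g) + g
    have hp := hs.pos
    calc _ ≤ bits c * (D + q) + (bits c + 4) * (D + q) := by
          refine add_le_add (c1.trans (Nat.mul_le_mul_left _ ?_))
            (c2.trans (Nat.mul_le_mul (by omega) ?_))
          · rw [hq, hm]; nlinarith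
          · rw [hq, hm]; nlinarith
      _ = (2 * bits c + 4) * (D + q) := by ring
      _ ≤ q * (D + q) ^ 2 := by
          refine Nat.mul_le_mul ?_ (by nlinarith)
          rw [hq, hm]; nlinarith
  have htest : ∀ i ≤ N, (repTest σ c j).cost (S i) ≤ q * (B + q + i * (q + g) + q) ^ 2 :=
    fun i hi => Exp.Ok.cost_le' (hSb i hi) (show (repTest σ c j).Ok σ from ⟨trivial, trivial⟩)
      (by omega)
  have hval : ∀ i, (repTest σ c j).val (S i) = s σ j - i := fun i => by
    change S i σ j - S i 2 c = _
    rw [hSσ, hS, rounds_counter]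
  have hloop : ∀ d i, i + d = N → ∃ t ≤ (d * (2 * q + g) + q) * F ^ 2,
      Exec (.loop (repTest σ c j) (.seq (P.compile σ) (repIncr c))) (S i) (S N) t := by
    intro d
    induction d with
    | zero =>
      rintro i hi
      obtain rfl : i = N := by omega
      refine ⟨_, ?_, Exec.loop_neg ?_⟩
      · refine (htest _ le_rfl).trans ?_
        rw [zero_mul, zero_add]
        exact Nat.mul_le_mul_left _ (Nat.pow_le_pow_left (by nlinarith) _)
      · rw [hval, hN]; omega
    | succ d ihd =>
      intro i hi
      obtain ⟨t, ht, hE⟩ := ihd (i + 1) (by omega)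
      obtain ⟨t2, ht2, hE2⟩ := hrunP i (by omega)
      obtain ⟨t3, ht3, hE3⟩ := hinc i (by omega)
      refine ⟨_, ?_, Exec.loop_pos ?_ (Exec.seq hE2 hE3) hE⟩
      · have hiN : B + q + i * (q + g) + (q + g) ≤ F := by
          have : (i + 1) * (q + g) ≤ N * (q + g) := Nat.mul_le_mul_right _ (by omega)
          rw [add_mul] at this
          omega
        exact loop_bound (by omega) _ _ _ _ (htest i (by omega)) ht2 ht3 t ht
      · rw [hval]; omega
  obtain ⟨t, ht, hE⟩ := hloop N 0 (by omega)
  have hE0 := Exec.set 2 (.lit c) (.lit 0) s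
  refine ⟨?_, _, ?_, Exec.seq hE0 hE⟩
  · exact (hSb N le_rfl).mono hNF
  · have hb0 : bits 0 = 1 := by simp [bits]
    simp only [Exp.cost, hb0]
    have hm1 : bits c + 1 ≤ q := by rw [hq, hm]; nlinarith
    have hF1 : 1 ≤ F := by nlinarith
    exact loop_total hm1 hF1 hNy ht

/-- Structured programs run in polynomial time and produce entries of polynomial length. -/
theorem exec_compile {σ : ℕ} (h2 : σ ≠ 2) (h4 : σ ≠ 4) (P : SP) : P.Wf σ → ∀ {y B : ℕ} {s : Store},
    Bounded σ y B s → Bounded σ y (B + (P.poly σ).eval y) (P.eval σ s) ∧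
      ∃ t ≤ (P.poly σ).eval y * (B + (P.poly σ).eval y) ^ 2, Exec (P.compile σ) s (P.eval σ s) t := by
  induction P with
  | skip =>
    intro _ y B s hs
    simp only [poly, Polynomial.eval_one]
    exact ⟨hs.mono (Nat.le_succ _), 1, by nlinarith [Nat.one_le_pow 2 (B + 1) (Nat.succ_pos _)], Exec.skip s⟩
  | set a i e =>
    intro hwf y B s hs
    obtain ⟨ha, ha2, hi, he⟩ := hwf
    simp only [poly, Polynomial.eval_mul, Polynomial.eval_C, Polynomial.eval_add, Polynomial.eval_X,
      Polynomial.eval_one]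
    refine ⟨?_, _, ?_, Exec.set a i e s⟩
    · refine (hs.mono (Nat.le_add_right _ _)).write ha _ _ ?_ (fun h => absurd h ha2)
      exact (he.natAbs_val_lt hs).trans_le (Nat.pow_le_pow_right (by norm_num) (by nlinarith))
    · have h1 := hi.cost_le hs
      have h2 := he.cost_le hs
      have h0 : 1 ≤ B + (i.sz + e.sz) * (y + 1) := by nlinarith [hs.pos, hs.le]
      calc _ ≤ i.sz * (B + (i.sz + e.sz) * (y + 1)) + e.sz * (B + (i.sz + e.sz) * (y + 1)) := by
            refine add_le_add (h1.trans (Nat.mul_le_mul_left _ ?_))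
              (h2.trans (Nat.mul_le_mul_left _ ?_)) <;>
            nlinarith [i.sz_pos, e.sz_pos]
        _ = (i.sz + e.sz) * 1 * (B + (i.sz + e.sz) * (y + 1)) := by ring
        _ ≤ (i.sz + e.sz) * (y + 1) * (B + (i.sz + e.sz) * (y + 1)) ^ 2 := by
            refine Nat.mul_le_mul (Nat.mul_le_mul_left _ (by omega)) (by nlinarith)
  | seq P R ihP ihR =>
    intro hwf y B s hs
    obtain ⟨hb1, t1, ht1, hE1⟩ := ihP hwf.1 hs
    obtain ⟨hb2, t2, ht2, hE2⟩ := ihR hwf.2 hb1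
    simp only [poly, Polynomial.eval_add]
    refine ⟨by rw [← add_assoc]; exact hb2, _, ?_, Exec.seq hE1 hE2⟩
    set p := (P.poly σ).eval y
    set r := (R.poly σ).eval y
    calc _ ≤ p * (B + (p + r)) ^ 2 + r * (B + (p + r)) ^ 2 := by
          refine add_le_add (ht1.trans (Nat.mul_le_mul_left _ (Nat.pow_le_pow_left (by omega) _)))
            (ht2.trans (Nat.mul_le_mul_left _ (Nat.pow_le_pow_left (by omega) _)))
      _ = _ := by ring
  | ite e P R ihP ihR =>
    intro hwf y B s hs
    have hc := Exp.Ok.cost_le' hs hwf.1 le_rfl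
    simp only [poly, Polynomial.eval_add, Polynomial.eval_mul, Polynomial.eval_C, Polynomial.eval_X,
      Polynomial.eval_one]
    set p := (P.poly σ).eval y
    set r := (R.poly σ).eval y
    set q := e.sz * (y + 1)
    have hq : q * (B + q) ^ 2 ≤ q * (B + (q + p + r)) ^ 2 :=
      Nat.mul_le_mul_left _ (Nat.pow_le_pow_left (by omega) _)
    rw [eval]
    split_ifs with h
    · obtain ⟨hb1, t1, ht1, hE1⟩ := ihP hwf.2.1 hs
      refine ⟨hb1.mono (by omega), _, ?_, Exec.ite_pos h hE1⟩
      have : p * (B + p) ^ 2 ≤ p * (B + (q + p + r)) ^ 2 :=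
        Nat.mul_le_mul_left _ (Nat.pow_le_pow_left (by omega) _)
      nlinarith
    · obtain ⟨hb1, t1, ht1, hE1⟩ := ihR hwf.2.2 hs
      refine ⟨hb1.mono (by omega), _, ?_, Exec.ite_neg h hE1⟩
      have : r * (B + r) ^ 2 ≤ r * (B + (q + p + r)) ^ 2 :=
        Nat.mul_le_mul_left _ (Nat.pow_le_pow_left (by omega) _)
      nlinarith
  | rep c j P ih =>
    intro hwf y B s hs
    exact exec_rep h2 h4 hwf (ih hwf.2.2) hs
  | gcd =>
    intro _ y B s hs
    simp only [poly, Polynomial.eval_ofNat]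
    obtain ⟨K, hK⟩ : ∃ K, K = 200 := ⟨_, rfl⟩
    rw [← hK]
    have hB := hs.mono (Nat.le_add_right B K)
    have hb : Bounded σ y (B + K) (SP.gcd.eval σ s) := by
      rw [eval]
      split_ifs with h
      · refine ((hB.write h4.symm _ _ (by simp) (by simp)).write h4.symm _ _ ?_ (by simp)).write
          h4.symm _ _ (by simp) (by simp)
        rw [Int.natAbs_natCast]
        refine lt_of_le_of_lt (Nat.le_of_dvd (by omega) ?_) (hB.all 4 1)
        exact Int.gcd_dvd_natAbs_right _ _
      · exact hB
    refine ⟨hb, ?_⟩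
    clear hb hB
    have hev : SP.gcd.eval σ s = SP.gcd.eval 0 s := rfl
    rw [hev]
    by_cases h : 0 < s 4 1
    · have h1 := hs.all 4 1
      obtain ⟨t, ht, hE⟩ := exec_gcdLoop B (s 4 1).natAbs (s 4 0) s rfl (by omega) (hs.all 4 0)
        (hs.all 4 1)
      rw [if_neg (by omega)] at ht
      refine ⟨t, ht.trans ?_, hE⟩
      have e1 : (s 4 1).natAbs.size ≤ B := Nat.size_le.2 h1
      have e2 : (s 4 0 % (s 4 1).natAbs).natAbs.size ≤ B := by
        refine Nat.size_le.2 ?_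
        have h3 := Int.emod_lt_of_pos (s 4 0) (b := (s 4 1).natAbs) (by omega)
        have h5 := Int.emod_nonneg (s 4 0) (b := (s 4 1).natAbs) (by omega)
        omega
      -- The measure of `exec_gcdLoop` is at most `2 B + 2`, and each unit of it pays for `60 (B +
      -- 3)`.
      calc _ ≤ (B + B + 2) * (60 * (B + 3)) := by gcongr
        _ = (120 * (B + 1)) * (B + 3) := by ring
        _ ≤ (200 * (B + 3)) * (B + 3) := Nat.mul_le_mul_right _ (by omega)
        _ = 200 * (B + 3) ^ 2 := by ring
        _ ≤ _ := Nat.mul_le_mul hK.ge (Nat.pow_le_pow_left (by omega) _)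
    · have : SP.gcd.eval 0 s = s := by rw [eval, if_neg h]
      rw [this]
      refine ⟨_, ?_, Exec.loop_neg (by simpa [Exp.val] using h)⟩
      have b1 : bits 1 = 2 := by simp [bits]
      have := bits_le_of_natAbs_lt (hs.all 4 1)
      simp only [Exp.cost, Exp.val, b1]
      calc _ ≤ 200 * (B + 3) := by omega
        _ ≤ 200 * (B + 3) ^ 2 := Nat.mul_le_mul_left _ (Nat.le_self_pow (by norm_num) _)
        _ ≤ _ := Nat.mul_le_mul hK.ge (Nat.pow_le_pow_left (by omega) _)

end SP
/-! ### Limits of averages -/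

theorem toE_le_toE {a b : ℚ} : toE a ≤ toE b ↔ a ≤ b := by
  simp [toE]

theorem toE_lt_toE {a b : ℚ} : toE a < toE b ↔ a < b := by
  simp [toE]

theorem tendsto_toE {u : ℕ → ℚ} {a : ℚ} (h : Tendsto (fun n => (u n : ℝ)) atTop (nhds (a : ℝ))) :
    Tendsto (fun n => toE (u n)) atTop (nhds (toE a)) :=
  (continuous_coe_real_ereal.tendsto _).comp h

theorem tendsto_add_div (θ C : ℚ) :
    Tendsto (fun n : ℕ => toE (θ + C / n)) atTop (nhds (toE θ)) := by
  refine tendsto_toE ?_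
  have := (tendsto_const_div_atTop_nhds_zero_nat (C : ℝ)).const_add (θ : ℝ)
  simpa using this

/-- A constant error in the partial sums becomes `C / N` in the averages and vanishes. -/
theorem limsup_avg_le {x : ℕ → ℚ} {θ C : ℚ}
    (h : ∀ N : ℕ, ∑ i ∈ Finset.range N, x i ≤ θ * N + C) :
    limsup (fun n => toE (avg x n)) atTop ≤ toE θ := by
  rw [← (tendsto_add_div θ C).limsup_eq]
  refine limsup_le_limsup ?_
  filter_upwards [eventually_gt_atTop 0] with n hn
  have hn' : (0 : ℚ) < n := by exact_mod_cast hn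
  rw [toE_le_toE, avg, div_le_iff₀ hn', add_mul, div_mul_cancel₀ _ hn'.ne']
  exact h n

theorem le_liminf_avg {x : ℕ → ℚ} {θ C : ℚ}
    (h : ∀ N : ℕ, θ * N + C ≤ ∑ i ∈ Finset.range N, x i) :
    toE θ ≤ liminf (fun n => toE (avg x n)) atTop := by
  rw [← (tendsto_add_div θ C).liminf_eq]
  refine liminf_le_liminf ?_
  filter_upwards [eventually_gt_atTop 0] with n hn
  have hn' : (0 : ℚ) < n := by exact_mod_cast hn
  rw [toE_le_toE, avg, le_div_iff₀ hn', add_mul, div_mul_cancel₀ _ hn'.ne']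
  exact h n

theorem liminf_toE_le {u v : ℕ → ℚ}
    (h : Tendsto (fun n => toE (v n - u n)) atTop (nhds 0)) :
    liminf (fun n => toE (u n)) atTop ≤ liminf (fun n => toE (v n)) atTop := by
  have := EReal.le_liminf_add (f := atTop) (u := fun n => toE (u n))
    (v := fun n => toE (v n - u n)) 
  rw [h.liminf_eq, add_zero] at this
  refine this.trans_eq (congrArg (fun f => liminf f atTop) (funext fun n => ?_))
  simp only [toE, Pi.add_apply]
  rw [← EReal.coe_add]; congr 1; push_cast; ring

theorem limsup_toE_le {u v : ℕ → ℚ}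
    (h : Tendsto (fun n => toE (v n - u n)) atTop (nhds 0)) :
    limsup (fun n => toE (v n)) atTop ≤ limsup (fun n => toE (u n)) atTop := by
  have := EReal.limsup_add_le (f := atTop) (u := fun n => toE (u n))
    (v := fun n => toE (v n - u n)) (by rw [h.limsup_eq]; simp) (by rw [h.limsup_eq]; simp)
  rw [h.limsup_eq, add_zero] at this
  refine Eq.trans_le (congrArg (fun f => limsup f atTop) (funext fun n => ?_)) this
  simp only [toE, Pi.add_apply]
  rw [← EReal.coe_add]; congr 1; push_cast; ring

/-- Dropping the first weight changes the average by the difference of this weight and the average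
of the others, divided by the length. Boundedness makes this at most `2 W / (n + 1)`. -/
theorem tendsto_avg_succ_sub {x : ℕ → ℚ} {W : ℚ} (hW : ∀ i, |x i| ≤ W) :
    Tendsto (fun n => toE (avg x (n + 1) - avg (fun i => x (i + 1)) n)) atTop (nhds 0) := by
  have h0 : (0 : EReal) = toE 0 := by simp [toE]
  rw [h0]
  refine tendsto_toE ?_
  have hlim : Tendsto (fun n : ℕ => ((2 * W : ℚ) : ℝ) / ((n : ℝ) + 1)) atTop (nhds 0) :=
    (tendsto_add_atTop_iff_nat (f := fun n : ℕ => ((2 * W : ℚ) : ℝ) / (n : ℝ)) 1).2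
      (tendsto_const_div_atTop_nhds_zero_nat _) |>.congr (by intro n; push_cast; rfl)
  rw [Rat.cast_zero]
  refine squeeze_zero_norm (fun n => ?_) hlim
  rw [Real.norm_eq_abs]
  have hWn : 0 ≤ W := (abs_nonneg _).trans (hW 0)
  suffices |avg x (n + 1) - avg (fun i => x (i + 1)) n| ≤ 2 * W / (n + 1) by
    exact_mod_cast this
  rw [avg, avg, Finset.sum_range_succ']
  set T := ∑ i ∈ Finset.range n, x (i + 1) with hT
  have hTb : |T| ≤ n * W := by
    refine (Finset.abs_sum_le_sum_abs _ _).trans ?_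
    simpa using Finset.sum_le_card_nsmul (Finset.range n) (fun i => |x (i + 1)|) W (fun i _ => hW _)
  have hn1 : (0 : ℚ) < n + 1 := by positivity
  -- This also holds for `n = 0`, where the sum `T` is empty and `T / 0 = 0`.
  have key : (T + x 0) / ((n + 1 : ℕ) : ℚ) - T / n = (x 0 - T / n) / (n + 1) := by
    by_cases hn : n = 0
    · subst hn; simp [hT]
    · have hn0 : (n : ℚ) ≠ 0 := by exact_mod_cast hn
      push_cast
      field_simp
      ring
  rw [key, abs_div, abs_of_pos hn1]
  refine div_le_div_of_nonneg_right ?_ hn1.le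
  have h1 : |T / n| ≤ W := by
    rw [abs_div, Nat.abs_cast]
    exact div_le_of_le_mul₀ (by positivity) hWn (by linarith)
  calc |x 0 - T / n| ≤ |x 0| + |T / n| := abs_sub _ _
    _ ≤ 2 * W := by linarith [hW 0]

/-- The value functions that ignore finite prefixes of bounded sequences. -/
def ValFun.Tail (V : ValFun) : Prop := V = .limInf ∨ V = .limSup ∨ V = .limInfAvg ∨ V = .limSupAvg

theorem ValFun.Tail.eval_succ {V : ValFun} (hV : V.Tail) {x : ℕ → ℚ} {W : ℚ} (hW : ∀ i, |x i| ≤ W) :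
    V.eval (fun i => x (i + 1)) = V.eval x := by
  have h1 := tendsto_avg_succ_sub hW
  have h2 : Tendsto (fun n => toE (avg (fun i => x (i + 1)) n - avg x (n + 1))) atTop (nhds 0) := by
    have := (continuous_neg (G := EReal)).tendsto 0 |>.comp h1
    rw [neg_zero] at this
    refine this.congr fun n => ?_
    simp only [Function.comp, toE]
    rw [← EReal.coe_neg]; congr 1; push_cast; ring
  rcases hV with rfl | rfl | rfl | rfl
  · exact liminf_nat_add (fun n => toE (x n)) 1
  · exact limsup_nat_add (fun n => toE (x n)) 1
  · exact (le_antisymm (liminf_toE_le h1) (liminf_toE_le h2)).trans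
      (liminf_nat_add (fun n => toE (avg x n)) 1)
  · exact (le_antisymm (limsup_toE_le h2) (limsup_toE_le h1)).trans
      (limsup_nat_add (fun n => toE (avg x n)) 1)

theorem ValFun.Tail.eval_add {V : ValFun} (hV : V.Tail) {x : ℕ → ℚ} {W : ℚ} (hW : ∀ i, |x i| ≤ W)
    (m : ℕ) : V.eval (fun i => x (i + m)) = V.eval x := by
  induction m with
  | zero => rfl
  | succ m ih =>
    rw [← ih, ← hV.eval_succ (x := fun i => x (i + m)) (fun i => hW _)]
    simp only [add_right_comm _ 1 m, add_assoc]

/-! ### Runs -/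

theorem splice_add {T : Type} (w : ℕ → T) (n : ℕ) (w' : ℕ → T) (i : ℕ) :
    splice w n w' (i + n) = w' i := by
  simp [splice]

theorem splice_of_lt {T : Type} (w : ℕ → T) {n : ℕ} (w' : ℕ → T) {i : ℕ} (h : i < n) :
    splice w n w' i = w i := by
  simp [splice, h]

theorem splice_shift {T : Type} (w v : ℕ → T) (n : ℕ) (h : ∀ i < n, v i = w i) :
    splice w n (fun i => v (i + n)) = v := by
  funext i
  by_cases hi : i < n
  · rw [splice_of_lt _ _ hi, h i hi]
  · simp [splice, hi, Nat.sub_add_cancel (not_lt.1 hi)]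

namespace Automaton

variable {S Q : Type}

/-- There is a transition from `p` to `q` with weight `x`. -/
def Edge (A : Automaton S Q) (p : Q) (x : ℚ) (q : Q) : Prop := ∃ a, (x, q) ∈ A.δ p a

/-- A finite path; the weights are listed from the last to the first. -/
inductive Path (A : Automaton S Q) (u : Q) : List ℚ → Q → Prop
  | nil : Path A u [] u
  | snoc {xs : List ℚ} {p q : Q} {x : ℚ} : Path A u xs p → A.Edge p x q → Path A u (x :: xs) q

/-- Reachability. -/
def Reach (A : Automaton S Q) (u v : Q) : Prop := ∃ xs, A.Path u xs v

theorem Path.append {A : Automaton S Q} {u v z : Q} {xs ys : List ℚ} (h : A.Path u xs v)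
    (h' : A.Path v ys z) : A.Path u (ys ++ xs) z := by
  induction h' with
  | nil => exact h
  | snoc _ e ih => exact ih.snoc e

theorem exists_weight_bound [Finite S] [Finite Q] (A : Automaton S Q) :
    ∃ W : ℚ, ∀ p x q, A.Edge p x q → |x| ≤ W := by
  cases nonempty_fintype S
  cases nonempty_fintype Q
  classical
  let F : Finset ℚ := Finset.univ.biUnion fun p => Finset.univ.biUnion fun a =>
    (A.δ p a).image fun t => |t.1|
  obtain ⟨W, hW⟩ := F.exists_le
  refine ⟨W, fun p x q ⟨a, ha⟩ => hW _ ?_⟩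
  simp only [F, Finset.mem_biUnion, Finset.mem_univ, true_and, Finset.mem_image]
  exact ⟨p, a, _, ha, rfl⟩

theorem exists_run (A : Automaton S Q) (w : ℕ → S) : ∃ r x, A.IsRun w r x := by
  choose f hf using A.total
  let r : ℕ → Q := fun i => Nat.rec A.init (fun i q => (f q (w i)).2) i
  exact ⟨r, fun i => (f (r i) (w i)).1, rfl, fun i => hf _ _⟩

theorem isRun_splice {A : Automaton S Q} {w w' : ℕ → S} {r r' : ℕ → Q} {x x' : ℕ → ℚ} {m : ℕ}
    (h0 : r 0 = A.init) (h : ∀ i < m, (x i, r (i + 1)) ∈ A.δ (r i) (w i))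
    (h' : (A.startAt (r m)).IsRun w' r' x') :
    A.IsRun (splice w m w') (splice r m r') (splice x m x') := by
  have hr0 : r' 0 = r m := h'.1
  have hle : ∀ i ≤ m, splice r m r' i = r i := by
    intro i hi
    rcases hi.lt_or_eq with hi | rfl
    · exact splice_of_lt _ _ hi
    · simp [splice, hr0]
  refine ⟨by rw [hle 0 (Nat.zero_le _), h0], fun i => ?_⟩
  by_cases hi : i < m
  · rw [hle _ hi.le, hle _ hi, splice_of_lt w _ hi, splice_of_lt x _ hi]
    exact h i hi
  · obtain ⟨j, rfl⟩ : ∃ j, i = j + m := ⟨i - m, by omega⟩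
    rw [splice_add, splice_add, splice_add, add_right_comm, splice_add]
    exact h'.2 j

theorem IsRun.edge {A : Automaton S Q} {w : ℕ → S} {r : ℕ → Q} {x : ℕ → ℚ} (h : A.IsRun w r x)
    (i : ℕ) : A.Edge (r i) (x i) (r (i + 1)) := ⟨_, h.2 i⟩

theorem IsRun.shift {A : Automaton S Q} {w : ℕ → S} {r : ℕ → Q} {x : ℕ → ℚ} (h : A.IsRun w r x)
    (n : ℕ) : (A.startAt (r n)).IsRun (fun i => w (i + n)) (fun i => r (i + n))
      (fun i => x (i + n)) := by
  refine ⟨by simp [startAt], fun i => ?_⟩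
  have := h.2 (i + n)
  rwa [add_right_comm] at this

theorem IsRun.eval_le_topValue {A : Automaton S Q} {w : ℕ → S} {r : ℕ → Q} {x : ℕ → ℚ}
    (h : A.IsRun w r x) (V : ValFun) : V.eval x ≤ A.topValue V :=
  le_iSup_of_le w (le_iSup_of_le r (le_iSup_of_le x (le_iSup_of_le h le_rfl)))

theorem IsRun.eval_le_value {A : Automaton S Q} {w : ℕ → S} {r : ℕ → Q} {x : ℕ → ℚ}
    (h : A.IsRun w r x) (V : ValFun) : V.eval x ≤ A.value V w :=
  le_iSup_of_le r (le_iSup_of_le x (le_iSup_of_le h le_rfl))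

section Tail

variable [Finite S] [Finite Q] {V : ValFun}

theorem IsRun.eval_shift (hV : V.Tail) {A : Automaton S Q} {w : ℕ → S} {r : ℕ → Q} {x : ℕ → ℚ}
    (h : A.IsRun w r x) (n : ℕ) : V.eval (fun i => x (i + n)) = V.eval x := by
  obtain ⟨W, hW⟩ := A.exists_weight_bound
  exact hV.eval_add (fun i => hW _ _ _ (h.edge i)) n

/-- Any run from `r m` can be glued to the given finite run, and the finite part does not influence
the value. -/
theorem topValue_splice_le (hV : V.Tail) (A : Automaton S Q) {w : ℕ → S} {r : ℕ → Q} {x : ℕ → ℚ}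
    {m : ℕ} (h0 : r 0 = A.init) (h : ∀ i < m, (x i, r (i + 1)) ∈ A.δ (r i) (w i)) :
    (A.startAt (r m)).topValue V ≤ ⨆ w', A.value V (splice w m w') := by
  refine iSup_le fun w' => iSup_le fun r' => iSup_le fun x' => iSup_le fun h' => ?_
  have hrun := isRun_splice h0 h h'
  refine le_iSup_of_le w' ?_
  refine le_trans (le_of_eq ?_) (hrun.eval_le_value V)
  rw [← hrun.eval_shift hV m]
  simp only [splice_add]

theorem Edge.topValue_le (hV : V.Tail) {A : Automaton S Q} {p q : Q} {x : ℚ} (h : A.Edge p x q) :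
    (A.startAt q).topValue V ≤ (A.startAt p).topValue V := by
  obtain ⟨a, ha⟩ := h
  refine (topValue_splice_le hV (A.startAt p) (w := fun _ => a) (m := 1)
    (r := fun i => if i = 0 then p else q) (x := fun _ => x) rfl ?_).trans ?_
  · intro i hi
    obtain rfl : i = 0 := by omega
    exact ha
  · exact iSup_le fun w' => le_iSup_of_le _ le_rfl

theorem Reach.topValue_le (hV : V.Tail) {A : Automaton S Q} {p q : Q} (h : A.Reach p q) :
    (A.startAt q).topValue V ≤ (A.startAt p).topValue V := by
  obtain ⟨xs, h⟩ := h
  induction h with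
  | nil => exact le_rfl
  | snoc _ e ih => exact (e.topValue_le hV).trans ih

/-! ### Reweighting by top values -/

/-- König's lemma. The predicate `G i q` says that from `q` at time `i` one can follow `w` up to any
later time `N` and end in a state of top value at least `c`. Finite branching passes this on to some
successor, and following such successors gives the run. -/
theorem exists_run_of_forall_le (hV : V.Tail) (A : Automaton S Q) (w : ℕ → S) (c : EReal)
    (hc : ∀ N, ∃ r : ℕ → Q, r 0 = A.init ∧ (∀ j < N, ∃ x, (x, r (j + 1)) ∈ A.δ (r j) (w j)) ∧
      c ≤ (A.startAt (r N)).topValue V) :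
    ∃ r x, A.IsRun w r x ∧ ∀ i, c ≤ (A.startAt (r i)).topValue V := by
  classical
  let G : ℕ → Q → Prop := fun i q => ∀ N, i ≤ N → ∃ r : ℕ → Q, r i = q ∧
    (∀ j, i ≤ j → j < N → ∃ x, (x, r (j + 1)) ∈ A.δ (r j) (w j)) ∧
    c ≤ (A.startAt (r N)).topValue V
  have hG : ∀ i q, G i q → ∃ t ∈ A.δ q (w i), G (i + 1) t.2 := by
    intro i q hq
    by_contra! hcon
    have hbad : ∀ t : ℚ × Q, ∃ N, i + 1 ≤ N ∧ (t ∈ A.δ q (w i) → ¬ ∃ r : ℕ → Q, r (i + 1) = t.2 ∧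
        (∀ j, i + 1 ≤ j → j < N → ∃ x, (x, r (j + 1)) ∈ A.δ (r j) (w j)) ∧
        c ≤ (A.startAt (r N)).topValue V) := by
      intro t
      by_cases ht : t ∈ A.δ q (w i)
      · have := hcon t ht
        simp only [G, not_forall] at this
        obtain ⟨N, hN, h⟩ := this
        exact ⟨N, hN, fun _ => h⟩
      · exact ⟨i + 1, le_rfl, fun h => absurd h ht⟩
    choose N hN hbad using hbad
    -- Only finitely many transitions are available, so one horizon lies beyond the times at which
    -- their targets fail.
    set M := (A.δ q (w i)).sup N + (i + 1) with hM
    obtain ⟨r, hr, hstep, htop⟩ := hq M (by omega)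
    obtain ⟨x, hx⟩ := hstep i le_rfl (by omega)
    rw [hr] at hx
    have hle : N (x, r (i + 1)) ≤ M := (Finset.le_sup hx).trans (Nat.le_add_right _ _)
    refine hbad _ hx ⟨r, rfl, fun j hj hjN => hstep j (by omega) (by omega), ?_⟩
    -- The lower bound `c` moves from the horizon back to the failure time, since a state has at
    -- least the top value of its successor.
    refine Nat.decreasingInduction' (P := fun k => c ≤ (A.startAt (r k)).topValue V)
      (fun k hk hk' ih => ?_) hle htop
    obtain ⟨y, hy⟩ := hstep k ((Nat.le_succ i).trans ((hN _).trans hk')) hk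
    exact ih.trans (Edge.topValue_le hV ⟨_, hy⟩)
  have hG0 : G 0 A.init := by
    intro N _
    obtain ⟨r, h0, h1, h2⟩ := hc N
    exact ⟨r, h0, fun j _ hj => h1 j hj, h2⟩
  choose! f hf hf' using hG
  let r : ℕ → Q := fun i => Nat.rec A.init (fun i q => (f i q).2) i
  have hr : ∀ i, G i (r i) := by
    intro i
    induction i with
    | zero => exact hG0
    | succ i ih => exact hf' _ _ ih
  refine ⟨r, fun i => (f i (r i)).1, ⟨rfl, fun i => hf _ _ (hr i)⟩, fun i => ?_⟩
  obtain ⟨r', h0, -, h2⟩ := hr i i le_rfl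
  rwa [h0] at h2

/-- Reweighting by top values yields the safety closure. -/
theorem IsTopReweighting.value_inf [DecidableEq Q] (hV : V.Tail) {A B : Automaton S Q}
    (h : A.IsTopReweighting V B) (w : ℕ → S) :
    B.value .inf w = safetyClosure (A.value V) w := by
  obtain ⟨θ, hθ, hinit, hδ⟩ := h
  refine le_antisymm ?_ ?_
  · refine iSup_le fun r => iSup_le fun y => iSup_le fun hrun => le_iInf fun n => ?_
    have hA : ∀ i, ∃ x, (x, r (i + 1)) ∈ A.δ (r i) (w i) ∧ y i = θ (r (i + 1)) := by
      intro i
      have := hrun.2 i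
      rw [hδ, Finset.mem_image] at this
      obtain ⟨t, ht, he⟩ := this
      rw [Prod.mk.injEq] at he
      exact ⟨t.1, by rw [← he.2]; exact ht, by rw [← he.1, he.2]⟩
    choose x hx hy using hA
    refine (iInf_le _ n).trans ?_
    rw [hy n, hθ _ _ _ (hx n)]
    -- The weight at step `n` is the top value of the target `r (n + 1)`, which is reached after `n
    -- + 1` letters. Continuations of this longer prefix are also continuations of the prefix of
    -- length `n`.
    refine (topValue_splice_le hV A (w := w) (m := n + 1) (hrun.1.trans hinit)
      (fun i _ => hx i)).trans (iSup_le fun w' => ?_)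
    refine le_iSup_of_le (fun i => splice w (n + 1) w' (i + n)) (le_of_eq ?_)
    rw [splice_shift _ _ _ fun i hi => splice_of_lt _ _ (Nat.lt_succ_of_lt hi)]
  · set c := safetyClosure (A.value V) w with hcdef
    -- The strict comparison of a finite supremum with `c` below needs `⊥ < c`.
    by_cases hc : c = ⊥
    · rw [hc]; exact bot_le
    obtain ⟨r, x, hrun, hr⟩ := exists_run_of_forall_le hV A w c (fun N => by
      by_contra! hcon
      cases nonempty_fintype Q
      classical
      -- The states to which the first `N` letters lead. There are finitely many, so if all their
      -- top values were below `c`, their supremum would be so too, although it bounds all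
      -- continuations.
      let R : Finset Q := Finset.univ.filter fun q => ∃ r : ℕ → Q, r 0 = A.init ∧
        (∀ j < N, ∃ x, (x, r (j + 1)) ∈ A.δ (r j) (w j)) ∧ r N = q
      have h1 : c ≤ R.sup fun q => (A.startAt q).topValue V := by
        refine (iInf_le _ N).trans (iSup_le fun w' => ?_)
        refine iSup_le fun r => iSup_le fun x => iSup_le fun hrun => ?_
        rw [← hrun.eval_shift hV N]
        refine ((hrun.shift N).eval_le_topValue V).trans
          (Finset.le_sup (f := fun q => (A.startAt q).topValue V) ?_)
        refine Finset.mem_filter.2 ⟨Finset.mem_univ _, r, hrun.1, fun j hj => ⟨x j, ?_⟩, rfl⟩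
        have := hrun.2 j
        rwa [splice_of_lt _ _ hj] at this
      refine absurd h1 (not_le.2 ((Finset.sup_lt_iff (bot_lt_iff_ne_bot.2 hc)).2 fun q hq => ?_))
      obtain ⟨-, r, h0, hs, rfl⟩ := Finset.mem_filter.1 hq
      exact hcon r h0 hs)
    have hB : B.IsRun w r (fun i => θ (r (i + 1))) := by
      refine ⟨hrun.1.trans hinit.symm, fun i => ?_⟩
      rw [hδ]
      exact Finset.mem_image.2 ⟨_, hrun.2 i, rfl⟩
    refine le_trans ?_ (hB.eval_le_value .inf)
    refine le_iInf fun i => ?_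
    have := hθ _ _ _ (hrun.2 i)
    simp only at this
    rw [this]
    exact hr _

end Tail

end Automaton
/-! ### Top values and cycles -/

/-- The value of a path of length `k + 1`, from the value of its prefix of length `k` and the last
weight. -/
def ValFun.comb : ValFun → ℕ → ℚ → ℚ → ℚ
  | .limInf, k, d, w => if k = 0 then w else min d w
  | .limSup, k, d, w => if k = 0 then w else max d w
  | _, _, d, w => d + w

/-- The value of a path. -/
def ValFun.agg (V : ValFun) : List ℚ → ℚ
  | [] => 0
  | x :: xs => V.comb xs.length (V.agg xs) x

/-- The value of repeating a cycle of length `k` and path value `d`. -/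
def ValFun.cand : ValFun → ℕ → ℚ → ℚ
  | .limInf, _, d => d
  | .limSup, _, d => d
  | _, k, d => d / k

/-- The value `0` of the empty path never enters, because `comb` discards it at length `0`. The
minimum is thus attained at one of the weights. -/
theorem agg_limInf_mem : ∀ {xs : List ℚ}, xs ≠ [] → ValFun.limInf.agg xs ∈ xs
  | [x], _ => by simp [ValFun.agg, ValFun.comb]
  | x :: y :: xs, _ => by
      have ih := agg_limInf_mem (xs := y :: xs) (by simp)
      rw [ValFun.agg, ValFun.comb, if_neg (by simp)]
      rcases min_choice (ValFun.limInf.agg (y :: xs)) x with h | h <;> rw [h]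
      · exact List.mem_cons_of_mem _ ih
      · exact List.mem_cons_self

theorem agg_limSup_mem : ∀ {xs : List ℚ}, xs ≠ [] → ValFun.limSup.agg xs ∈ xs
  | [x], _ => by simp [ValFun.agg, ValFun.comb]
  | x :: y :: xs, _ => by
      have ih := agg_limSup_mem (xs := y :: xs) (by simp)
      rw [ValFun.agg, ValFun.comb, if_neg (by simp)]
      rcases max_choice (ValFun.limSup.agg (y :: xs)) x with h | h <;> rw [h]
      · exact List.mem_cons_of_mem _ ih
      · exact List.mem_cons_self

theorem agg_limInf_le : ∀ {xs : List ℚ} {y : ℚ}, y ∈ xs → ValFun.limInf.agg xs ≤ y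
  | x :: xs, y, h => by
      rw [ValFun.agg, ValFun.comb]
      rcases List.mem_cons.1 h with rfl | h
      · split_ifs
        · exact le_rfl
        · exact min_le_right _ _
      · rw [if_neg (List.length_pos_of_mem h).ne']
        exact (min_le_left _ _).trans (agg_limInf_le h)

theorem le_agg_limSup : ∀ {xs : List ℚ} {y : ℚ}, y ∈ xs → y ≤ ValFun.limSup.agg xs
  | x :: xs, y, h => by
      rw [ValFun.agg, ValFun.comb]
      rcases List.mem_cons.1 h with rfl | h
      · split_ifs
        · exact le_rfl
        · exact le_max_right _ _
      · rw [if_neg (List.length_pos_of_mem h).ne']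
        exact (le_agg_limSup h).trans (le_max_left _ _)

theorem agg_avg {V : ValFun} (hV : V = .limInfAvg ∨ V = .limSupAvg) :
    ∀ xs : List ℚ, V.agg xs = xs.sum
  | [] => rfl
  | x :: xs => by
      rw [ValFun.agg, agg_avg hV xs, List.sum_cons, add_comm]
      rcases hV with rfl | rfl <;> rfl

/-- The weights `x i, …, x (i + k - 1)`, from the last to the first. -/
def seg (x : ℕ → ℚ) (i : ℕ) : ℕ → List ℚ
  | 0 => []
  | k + 1 => x (i + k) :: seg x i k

theorem length_seg (x : ℕ → ℚ) (i k : ℕ) : (seg x i k).length = k := by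
  induction k with
  | zero => rfl
  | succ k ih => simp [seg, ih]

theorem mem_seg {x : ℕ → ℚ} {i k : ℕ} {y : ℚ} : y ∈ seg x i k ↔ ∃ j < k, x (i + j) = y := by
  induction k with
  | zero => simp [seg]
  | succ k ih =>
    rw [seg, List.mem_cons, ih]
    constructor
    · rintro (rfl | ⟨j, hj, h⟩)
      · exact ⟨k, by omega, rfl⟩
      · exact ⟨j, by omega, h⟩
    · rintro ⟨j, hj, h⟩
      rcases (Nat.lt_succ_iff.1 hj).lt_or_eq with h' | rfl
      · exact Or.inr ⟨j, h', h⟩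
      · exact Or.inl h.symm

theorem sum_seg (x : ℕ → ℚ) (k : ℕ) : (seg x 0 k).sum = ∑ i ∈ Finset.range k, x i := by
  induction k with
  | zero => rfl
  | succ k ih => rw [seg, List.sum_cons, ih, Finset.sum_range_succ, add_comm, zero_add]

namespace Automaton

variable {S Q : Type}

theorem path_seg {A : Automaton S Q} {r : ℕ → Q} {x : ℕ → ℚ}
    (h : ∀ i, A.Edge (r i) (x i) (r (i + 1))) (i k : ℕ) : A.Path (r i) (seg x i k) (r (i + k)) := by
  induction k with
  | zero => exact .nil
  | succ k ih => exact ih.snoc (h (i + k))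

theorem Reach.trans {A : Automaton S Q} {u v z : Q} (h : A.Reach u v) (h' : A.Reach v z) :
    A.Reach u z :=
  let ⟨_, h⟩ := h; let ⟨_, h'⟩ := h'; ⟨_, h.append h'⟩

/-- Paths with their lists of visited states. -/
inductive VPath (A : Automaton S Q) (u : Q) : List ℚ → List Q → Q → Prop
  | nil : VPath A u [] [u] u
  | snoc {xs : List ℚ} {vs : List Q} {p q : Q} {x : ℚ} :
      VPath A u xs vs p → A.Edge p x q → VPath A u (x :: xs) (q :: vs) q

theorem VPath.path {A : Automaton S Q} {u v : Q} {xs : List ℚ} {vs : List Q}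
    (h : A.VPath u xs vs v) : A.Path u xs v := by
  induction h with
  | nil => exact .nil
  | snoc _ e ih => exact ih.snoc e

theorem VPath.length {A : Automaton S Q} {u v : Q} {xs : List ℚ} {vs : List Q}
    (h : A.VPath u xs vs v) : vs.length = xs.length + 1 := by
  induction h with
  | nil => rfl
  | snoc _ _ ih => simp [ih]

theorem VPath.split {A : Automaton S Q} {u v z : Q} {xs : List ℚ} {vs : List Q}
    (h : A.VPath u xs vs v) (hz : z ∈ vs) : ∃ cs ds vs', xs = cs ++ ds ∧ A.VPath u ds vs' z ∧
      A.Path z cs v ∧ vs' <:+ vs := by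
  induction h with
  | nil =>
    obtain rfl := List.mem_singleton.1 hz
    exact ⟨[], [], _, rfl, .nil, .nil, List.suffix_rfl⟩
  | @snoc xs vs p q x h e ih =>
    by_cases hzq : z = q
    · subst hzq
      exact ⟨[], _, _, rfl, h.snoc e, .nil, List.suffix_rfl⟩
    · obtain ⟨cs, ds, vs', rfl, h1, h2, h3⟩ := ih ((List.mem_cons.1 hz).resolve_left hzq)
      exact ⟨x :: cs, ds, vs', rfl, h1, h2.snoc e, h3.trans (List.suffix_cons _ _)⟩

/-- Cutting cycles out of a path leaves a simple path; if no short cycle has mean above `θ`, then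
the deviation of the sum from `θ` times the length does not decrease. -/
theorem Path.exists_simple [Fintype Q] {A : Automaton S Q} {u v : Q} {xs : List ℚ}
    (h : A.Path u xs v) : ∃ ys vs, A.VPath u ys vs v ∧ vs.Nodup ∧ ∀ θ : ℚ,
      (∀ z zs, A.Reach u z → A.Path z zs z → zs ≠ [] → zs.length ≤ Fintype.card Q →
        zs.sum ≤ θ * zs.length) →
      xs.sum - θ * xs.length ≤ ys.sum - θ * ys.length := by
  induction h with
  | nil => exact ⟨[], [u], .nil, List.nodup_singleton _, fun θ _ => le_rfl⟩
  | @snoc xs p q x h e ih =>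
    obtain ⟨ys, vs, hv, hnd, hle⟩ := ih
    by_cases hq : q ∈ vs
    · obtain ⟨cs, ds, vs', rfl, h1, h2, h3⟩ := hv.split hq
      refine ⟨ds, vs', h1, hnd.sublist h3.sublist, fun θ hθ => ?_⟩
      have hc := hθ q (x :: cs) ⟨_, h1.path⟩ (h2.snoc e) (by simp) (by
        have := hnd.length_le_card
        have := hv.length
        simp only [List.length_append, List.length_cons] at *
        omega)
      have := hle θ hθ
      simp only [List.sum_cons, List.length_cons, List.sum_append, List.length_append] at *
      push_cast at *
      linarith
    · refine ⟨x :: ys, q :: vs, hv.snoc e, List.nodup_cons.2 ⟨hq, hnd⟩, fun θ hθ => ?_⟩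
      have := hle θ hθ
      simp only [List.sum_cons, List.length_cons]
      push_cast
      linarith

theorem Reach.exists_short [Fintype Q] {A : Automaton S Q} {u v : Q} (h : A.Reach u v) :
    ∃ xs, A.Path u xs v ∧ xs.length + 1 ≤ Fintype.card Q := by
  obtain ⟨xs, h⟩ := h
  obtain ⟨ys, vs, hv, hnd, -⟩ := h.exists_simple
  exact ⟨ys, hv.path, hv.length ▸ hnd.length_le_card⟩

/-- The values of the cycles of length at most the number of states that are reachable from `q`. -/
def cycleValues [Fintype Q] (V : ValFun) (A : Automaton S Q) (q : Q) : Set ℚ :=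
  {c | ∃ u xs, A.Reach q u ∧ A.Path u xs u ∧ xs ≠ [] ∧ xs.length ≤ Fintype.card Q ∧
    c = V.cand xs.length (V.agg xs)}

/-- Pigeonhole on the `card Q + 1` positions from `m` on. That the cycle lies after an arbitrary `m`
is needed for limits inferior. -/
theorem exists_cycle [Fintype Q] {A : Automaton S Q} {r : ℕ → Q} {x : ℕ → ℚ}
    (h : ∀ i, A.Edge (r i) (x i) (r (i + 1))) (m : ℕ) :
    ∃ i k, m ≤ i ∧ 0 < k ∧ k ≤ Fintype.card Q ∧ A.Path (r i) (seg x i k) (r i) := by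
  obtain ⟨a, b, hab, he⟩ : ∃ a b : Fin (Fintype.card Q + 1), a ≠ b ∧ r (m + a) = r (m + b) :=
    Fintype.exists_ne_map_eq_of_card_lt (fun a : Fin (Fintype.card Q + 1) => r (m + a)) (by simp)
  wlog hlt : a < b generalizing a b
  · exact this b a hab.symm he.symm (lt_of_le_of_ne (not_lt.1 hlt) hab.symm)
  have hlt' : (a : ℕ) < b := hlt
  refine ⟨m + a, b - a, by omega, by omega, by omega, ?_⟩
  have := path_seg h (m + a) (b - a)
  rwa [show m + (a : ℕ) + (b - a) = m + b by omega, ← he] at this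

theorem cycleValues_nonempty [Fintype Q] [Nonempty S] (V : ValFun) (A : Automaton S Q) (q : Q) :
    (A.cycleValues V q).Nonempty := by
  obtain ⟨r, x, h⟩ := (A.startAt q).exists_run fun _ => Classical.arbitrary S
  have he : ∀ i, A.Edge (r i) (x i) (r (i + 1)) := h.edge
  obtain ⟨i, k, -, hk, hkn, hp⟩ := exists_cycle he 0
  have hr := path_seg he 0 i
  rw [zero_add, show r 0 = q from h.1] at hr
  refine ⟨_, r i, _, ⟨_, hr⟩, hp, ?_, by rwa [length_seg], rfl⟩
  exact List.ne_nil_of_length_pos (by rwa [length_seg])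

/-- For averages, cutting cycles of mean at most `θ` out of a prefix bounds its excess over `θ`
times its length by that of a simple path, hence by a constant. If a limit inferior exceeded `θ`,
all late weights would, and so would the minimum of a late short cycle. If a limit superior exceeded
`θ`, some transition of weight above `θ` would lie on a short cycle. -/
theorem eval_le_of_upperBound [Fintype Q] [Finite S] {V : ValFun} (hV : V.Tail)
    {A : Automaton S Q} {q : Q} {θ : ℚ} (hθ : θ ∈ upperBounds (A.cycleValues V q)) {r : ℕ → Q}
    {x : ℕ → ℚ} (h0 : r 0 = q) (he : ∀ i, A.Edge (r i) (x i) (r (i + 1))) :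
    V.eval x ≤ toE θ := by
  have hreach : ∀ i, A.Reach q (r i) := fun i => by
    have := path_seg he 0 i
    rw [zero_add, h0] at this
    exact ⟨_, this⟩
  have havg : (V = .limInfAvg ∨ V = .limSupAvg) →
      limsup (fun n => toE (avg x n)) atTop ≤ toE θ := by
    intro hV'
    obtain ⟨W, hW⟩ := A.exists_weight_bound
    have hW0 : 0 ≤ W := (abs_nonneg _).trans (hW _ _ _ (he 0))
    -- A simple path has fewer than `card Q` transitions, each of which contributes at most `W +
    -- |θ|` to the excess.
    refine limsup_avg_le (C := Fintype.card Q * (W + |θ|)) fun N => ?_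
    have hp := path_seg he 0 N
    rw [h0] at hp
    obtain ⟨ys, vs, hv, hnd, hle⟩ := hp.exists_simple
    have h1 := hle θ (fun z zs hz hzs hne hlen => by
      have := hθ ⟨z, zs, hz, hzs, hne, hlen, rfl⟩
      rw [agg_avg hV'] at this
      have hpos : (0 : ℚ) < zs.length := by exact_mod_cast List.length_pos_iff.2 hne
      rcases hV' with rfl | rfl <;> exact (div_le_iff₀ hpos).1 this)
    rw [length_seg, sum_seg] at h1
    have h2 : ∀ {ys v}, A.Path q ys v → |ys.sum| ≤ ys.length * W := by
      intro ys v hp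
      induction hp with
      | nil => simp
      | snoc _ e ih =>
        rw [List.sum_cons, List.length_cons]
        push_cast
        have := hW _ _ _ e
        refine (abs_add_le _ _).trans ?_
        linarith
    have h3 := h2 hv.path
    have h4 : (ys.length : ℚ) ≤ Fintype.card Q := by
      have := hnd.length_le_card
      have := hv.length
      exact_mod_cast (by omega : ys.length ≤ Fintype.card Q)
    have h5 := le_abs_self ys.sum
    have h6 := neg_abs_le θ
    have h7 : (0 : ℚ) ≤ ys.length := by positivity
    nlinarith [mul_le_mul_of_nonneg_right h4 (add_nonneg hW0 (abs_nonneg θ)),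
      mul_nonneg h7 (by linarith : 0 ≤ θ + |θ|)]
  rcases hV with rfl | rfl | rfl | rfl
  · refine not_lt.1 fun hlt => ?_
    obtain ⟨m, hm⟩ := eventually_atTop.1 (eventually_lt_of_lt_liminf hlt)
    obtain ⟨i, k, hi, hk, hkn, hp⟩ := exists_cycle he m
    have hne : seg x i k ≠ [] := List.ne_nil_of_length_pos (by rwa [length_seg])
    have := hθ ⟨r i, _, hreach i, hp, hne, by rwa [length_seg], rfl⟩
    obtain ⟨j, hj, hx⟩ := mem_seg.1 (agg_limInf_mem hne)
    have h2 := toE_lt_toE.1 (hm (i + j) (by omega))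
    rw [hx] at h2
    exact absurd this (not_le.2 h2)
  · refine not_lt.1 fun hlt => ?_
    have hfreq := frequently_lt_of_lt_limsup (by isBoundedDefault) hlt
    have hinf : {i | toE θ < toE (x i)}.Infinite := Nat.frequently_atTop_iff_infinite.1 hfreq
    -- Two heavy transitions leave the same state, so the run returns to the source of the first
    -- one. Replacing the way back by a simple path makes the cycle short and keeps the heavy
    -- transition on it.
    obtain ⟨i, hi, j, hj, hij, hr⟩ := hinf.exists_ne_map_eq_of_mapsTo (f := r)
      (fun _ _ => Set.mem_univ _) Set.finite_univ
    wlog hlt' : i < j generalizing i j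
    · exact this j hj i hi hij.symm hr.symm (lt_of_le_of_ne (not_lt.1 hlt') hij.symm)
    have hback : A.Reach (r (i + 1)) (r i) := by
      have := path_seg he (i + 1) (j - (i + 1))
      rw [show i + 1 + (j - (i + 1)) = j by omega, ← hr] at this
      exact ⟨_, this⟩
    obtain ⟨ys, hys, hlen⟩ := hback.exists_short
    have := hθ ⟨r (i + 1), x i :: ys, hreach _, hys.snoc (he i), by simp, by simpa using hlen, rfl⟩
    have h2 := toE_lt_toE.1 hi
    exact absurd (le_agg_limSup List.mem_cons_self) (not_le.2 (this.trans_lt h2))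
  · exact le_trans liminf_le_limsup (havg (Or.inl rfl))
  · exact havg (Or.inr rfl)

theorem Path.exists_seq {A : Automaton S Q} {u v : Q} {xs : List ℚ} (h : A.Path u xs v)
    [Nonempty S] : ∃ (w : ℕ → S) (r : ℕ → Q) (x : ℕ → ℚ), r 0 = u ∧ r xs.length = v ∧
      seg x 0 xs.length = xs ∧ ∀ i < xs.length, (x i, r (i + 1)) ∈ A.δ (r i) (w i) := by
  induction h with
  | nil => exact ⟨fun _ => Classical.arbitrary S, fun _ => u, fun _ => 0, rfl, rfl, rfl, by simp⟩
  | @snoc xs p q y h e ih =>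
    obtain ⟨w, r, x, h0, h1, h2, h3⟩ := ih
    obtain ⟨a, ha⟩ := e
    have hseg : ∀ k ≤ xs.length, seg (Function.update x xs.length y) 0 k = seg x 0 k := by
      intro k hk
      induction k with
      | zero => rfl
      | succ k ih =>
        rw [seg, seg, ih (by omega), Function.update_of_ne (by omega)]
    refine ⟨Function.update w xs.length a, Function.update r (xs.length + 1) q,
      Function.update x xs.length y, ?_, ?_, ?_, ?_⟩
    · rw [Function.update_of_ne (by omega), h0]
    · simp
    · rw [List.length_cons, seg, hseg _ le_rfl, h2, zero_add, Function.update_self]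
    · intro i hi
      rw [List.length_cons, Nat.lt_succ_iff] at hi
      rw [Function.update_of_ne (a := i) (by omega) _ r]
      rcases hi.lt_or_eq with hi | rfl
      · rw [Function.update_of_ne (by omega), Function.update_of_ne (by omega),
          Function.update_of_ne (by omega)]
        exact h3 i hi
      · rw [Function.update_self, Function.update_self, Function.update_self, h1]
        exact ha

/-- The witness is the run that goes around the cycle forever. Its weights are periodic, so its
minimum recurs as a lower bound, its maximum occurs infinitely often, and its averages tend to the
mean. -/
theorem Path.cand_le_topValue {V : ValFun} (hV : V.Tail) {A : Automaton S Q} {u : Q} {xs : List ℚ}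
    (h : A.Path u xs u) (hne : xs ≠ []) :
    toE (V.cand xs.length (V.agg xs)) ≤ (A.startAt u).topValue V := by
  have hS : Nonempty S := by
    cases h with
    | nil => exact absurd rfl hne
    | snoc _ e => exact ⟨e.choose⟩
  obtain ⟨w, r, x, h0, h1, h2, h3⟩ := h.exists_seq
  set k := xs.length with hk
  have hkpos : 0 < k := List.length_pos_iff.2 hne
  let x' : ℕ → ℚ := fun i => x (i % k)
  have hrun : (A.startAt u).IsRun (fun i => w (i % k)) (fun i => r (i % k)) x' := by
    refine ⟨by simpa [startAt] using h0, fun i => ?_⟩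
    have := h3 (i % k) (Nat.mod_lt _ hkpos)
    have he : r ((i + 1) % k) = r (i % k + 1) := by
      rw [← Nat.mod_add_mod]
      rcases lt_or_eq_of_le (Nat.succ_le_of_lt (Nat.mod_lt i hkpos)) with h | h
      · exact congrArg r (Nat.mod_eq_of_lt h)
      · rw [Nat.succ_eq_add_one] at h
        rw [h, Nat.mod_self, h0, h1]
    simp only [he]
    exact this
  refine le_trans ?_ (hrun.eval_le_topValue V)
  have hmem : ∀ i, x' i ∈ xs := fun i => by
    rw [← h2]
    exact mem_seg.2 ⟨i % k, Nat.mod_lt _ hkpos, by rw [zero_add]⟩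
  have havg : toE (xs.sum / k) ≤ liminf (fun n => toE (avg x' n)) atTop := by
    have hkQ : (0 : ℚ) < k := by exact_mod_cast hkpos
    set θ := xs.sum / k with hθ
    have hper : ∀ M, ∑ i ∈ Finset.range (k + M), x' i = θ * k + ∑ i ∈ Finset.range M, x' i := by
      intro M
      rw [Finset.sum_range_add]
      congr 1
      · rw [hθ, div_mul_cancel₀ _ hkQ.ne', ← h2, sum_seg]
        exact Finset.sum_congr rfl fun i hi => by
          simp only [x', Nat.mod_eq_of_lt (Finset.mem_range.1 hi)]
      · exact Finset.sum_congr rfl fun i _ => by simp only [x', Nat.add_mod_left]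
    -- Full periods contribute exactly `θ * k`. The constant bounds the deficit of an incomplete
    -- period.
    obtain ⟨C, hC⟩ := ((Finset.range k).image fun N : ℕ =>
      θ * N - ∑ i ∈ Finset.range N, x' i).exists_le
    refine le_liminf_avg (C := -C) fun N => ?_
    induction N using Nat.strong_induction_on with
    | _ N ih =>
      by_cases hN : N < k
      · have := hC _ (Finset.mem_image.2 ⟨N, Finset.mem_range.2 hN, rfl⟩)
        linarith
      · obtain ⟨M, rfl⟩ : ∃ M, N = k + M := ⟨N - k, by omega⟩
        have := ih M (by omega)
        rw [hper]
        push_cast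
        linarith
  rcases hV with rfl | rfl | rfl | rfl
  · refine le_liminf_of_le (by isBoundedDefault) (Eventually.of_forall fun i => ?_)
    exact toE_le_toE.2 (agg_limInf_le (hmem i))
  · obtain ⟨j, hj, hx⟩ := mem_seg.1 (h2.symm ▸ agg_limSup_mem hne)
    refine le_limsup_of_frequently_le (frequently_atTop.2 fun m => ⟨j + m * k, ?_, ?_⟩)
    · nlinarith
    · rw [zero_add, h2] at hx
      simp only [x', Nat.add_mul_mod_self_right, Nat.mod_eq_of_lt hj, hx]
      exact le_rfl
  · rw [agg_avg (Or.inl rfl)]; exact havg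
  · rw [agg_avg (Or.inr rfl)]; exact le_trans havg liminf_le_limsup

/-- The top value is the greatest value of a reachable short cycle. -/
theorem topValue_eq [Fintype Q] [Finite S] {V : ValFun} (hV : V.Tail) {A : Automaton S Q} {q : Q}
    {θ : ℚ} (hθ : IsGreatest (A.cycleValues V q) θ) : (A.startAt q).topValue V = toE θ := by
  refine le_antisymm ?_ ?_
  · refine iSup_le fun w => iSup_le fun r => iSup_le fun x => iSup_le fun h => ?_
    exact eval_le_of_upperBound hV hθ.2 h.1 h.edge
  · obtain ⟨u, xs, hr, hp, hne, -, rfl⟩ := hθ.1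
    exact (hp.cand_le_topValue hV hne).trans (hr.topValue_le hV)

end Automaton
/-! ### Suprema as limits inferior -/

/-- `C` simulates `A` and commits itself at some point to the weight of the current transition.
A state `s` of `C` stands for the state `π s` of `A`; it is committed to the weight of the
transition `tr (J s)` if `J s < T`, and uncommitted if `J s = T`. -/
structure Automaton.Commits {S Q Q' : Type} (A : Automaton S Q) (C : Automaton S Q')
    (T : ℕ) (tr : ℕ → Q × S × ℚ × Q) (J : Q' → ℕ) (π : Q' → Q) : Prop where
  tr_mem : ∀ p a x q, (x, q) ∈ A.δ p a → ∃ j < T, tr j = (p, a, x, q)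
  surj : ∀ j ≤ T, ∀ q, ∃ s, J s = j ∧ π s = q
  le : ∀ s, J s ≤ T
  J_init : J C.init = T
  π_init : π C.init = A.init
  δ_iff : ∀ s a x t, (x, t) ∈ C.δ s a ↔ ∃ x', (x', π t) ∈ A.δ (π s) a ∧
    ((J s < T ∧ J t = J s ∧ x = (tr (J s)).2.2.1) ∨
      (J s = T ∧ x = x' ∧ (J t = T ∨ J t < T ∧ tr (J t) = (π s, a, x, π t))))

/-- A commitment is only ever made to the transition being taken, so each weight of a run of `C`
occurs on the simulated run and the limit inferior is at most the supremum. For the converse, each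
position `i` of a run of `A` gives a run of `C` that commits there and has the weight `x i` from
then on. -/
theorem Automaton.Commits.value_eq {S Q Q' : Type} {A : Automaton S Q} {C : Automaton S Q'}
    {T : ℕ} {tr : ℕ → Q × S × ℚ × Q} {J : Q' → ℕ} {π : Q' → Q} (h : A.Commits C T tr J π)
    (w : ℕ → S) : C.value .limInf w = A.value .sup w := by
  refine le_antisymm ?_ ?_
  · refine iSup_le fun r => iSup_le fun y => iSup_le fun hrun => ?_
    have hstep := fun i => (h.δ_iff _ _ _ _).1 (hrun.2 i)
    choose x hx hcase using hstep
    have hA : A.IsRun w (fun i => π (r i)) x :=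
      ⟨(congrArg π hrun.1).trans h.π_init, hx⟩
    have hinv : ∀ n, J (r n) = T ∨ J (r n) < T ∧ ∃ i, (tr (J (r n))).2.2.1 = x i := by
      intro n
      induction n with
      | zero => exact Or.inl (by rw [hrun.1, h.J_init])
      | succ n ih =>
        rcases hcase n with ⟨h1, h2, -⟩ | ⟨-, hy, h2 | ⟨h2, h3⟩⟩
        · rw [h2]; exact ih
        · exact Or.inl h2
        · exact Or.inr ⟨h2, n, by rw [h3, hy]⟩
    have hy : ∀ n, ∃ i, y n = x i := by
      intro n
      rcases hcase n with ⟨h1, -, hy⟩ | ⟨-, hy, -⟩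
      · obtain ⟨i, hi⟩ := ((hinv n).resolve_left h1.ne).2
        exact ⟨i, hy.trans hi⟩
      · exact ⟨n, hy⟩
    refine le_trans ?_ (hA.eval_le_value .sup)
    refine le_trans (liminf_le_liminf (v := fun _ : ℕ => ⨆ n, toE (x n))
      (Eventually.of_forall fun n => ?_)) (le_of_eq (liminf_const _))
    obtain ⟨i, hi⟩ := hy n
    rw [hi]
    exact le_iSup (fun n => toE (x n)) i
  · refine iSup_le fun r => iSup_le fun x => iSup_le fun hrun => iSup_le fun i => ?_
    obtain ⟨j, hj, htr⟩ := h.tr_mem _ _ _ _ (hrun.2 i)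
    have : Nonempty Q' := ⟨C.init⟩
    choose! e heJ heπ using h.surj
    -- The run is uncommitted up to position `i` and committed to `j` from position `i + 1` on.
    -- Position `0` is treated apart because `e T` need not return the initial state of `C` itself.
    have hrunC : C.IsRun w (fun n => if n = 0 then C.init else if n ≤ i then e T (r n) else e j (r n))
        (fun n => if n ≤ i then x n else x i) := by
      have hT : ∀ n ≤ i, J (if n = 0 then C.init else if n ≤ i then e T (r n) else e j (r n)) = T := by
        intro n hn
        rw [if_pos hn]
        split_ifs
        · exact h.J_init
        · exact heJ _ le_rfl _
      have hπ : ∀ n, π (if n = 0 then C.init else if n ≤ i then e T (r n) else e j (r n)) = r n := by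
        intro n
        split_ifs with h1 h2
        · rw [h1, h.π_init, hrun.1]
        · exact heπ _ le_rfl _
        · exact heπ _ hj.le _
      have hJ : ∀ n, i < n →
          J (if n = 0 then C.init else if n ≤ i then e T (r n) else e j (r n)) = j := by
        intro n hn
        rw [if_neg (by omega), if_neg (by omega)]
        exact heJ _ hj.le _
      refine ⟨rfl, fun n => (h.δ_iff _ _ _ _).2 ⟨x n, ?_, ?_⟩⟩
      · rw [hπ, hπ]; exact hrun.2 n
      · rcases lt_trichotomy n i with hn | rfl | hn
        · exact Or.inr ⟨hT n hn.le, if_pos hn.le, Or.inl (hT (n + 1) hn)⟩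
        · refine Or.inr ⟨hT n le_rfl, if_pos le_rfl, Or.inr ?_⟩
          beta_reduce
          rw [hJ _ (Nat.lt_succ_self n), hπ, hπ, if_pos le_rfl]
          exact ⟨hj, htr⟩
        · refine Or.inl ?_
          beta_reduce
          rw [hJ _ hn, hJ _ (by omega), if_neg (by omega), htr]
          exact ⟨hj, rfl, rfl⟩
    refine le_trans ?_ (hrunC.eval_le_value .limInf)
    refine le_liminf_of_le (by isBoundedDefault) ?_
    filter_upwards [eventually_gt_atTop i] with n hn
    rw [if_neg (by omega)]

/-! ### Codes of automata in stores -/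

/-- A list of transitions. -/
abbrev Trans (k n : ℕ) : Type := List (Fin n × Fin k × ℚ × Fin n)

/-- The five entries that encode a transition. -/
def encT {k n : ℕ} (t : Fin n × Fin k × ℚ × Fin n) : List ℤ :=
  [((t.1 : ℕ) : ℤ), ((t.2.1 : ℕ) : ℤ), t.2.2.1.num, (t.2.2.1.den : ℤ), ((t.2.2.2 : ℕ) : ℤ)]

/-- The code with the initial state `q` and the transitions `ts`. -/
def codeOf {k n : ℕ} (q : Fin n) (ts : Trans k n) : List ℤ :=
  [(k : ℤ), (n : ℤ), ((q : ℕ) : ℤ), (ts.length : ℤ)] ++ ts.flatMap encT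

/-- The array `f` starts with `codeOf q ts`. -/
structure Holds {k n : ℕ} (f : ℤ → ℤ) (q : Fin n) (ts : Trans k n) : Prop where
  alph : f 0 = k
  states : f 1 = n
  init : f 2 = (q : ℕ)
  len : f 3 = ts.length
  src : ∀ t (h : t < ts.length), f (t * 5 + 4) = (ts[t].1 : ℕ)
  lab : ∀ t (h : t < ts.length), f (t * 5 + 5) = (ts[t].2.1 : ℕ)
  num : ∀ t (h : t < ts.length), f (t * 5 + 6) = ts[t].2.2.1.num
  den : ∀ t (h : t < ts.length), f (t * 5 + 7) = ts[t].2.2.1.den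
  dst : ∀ t (h : t < ts.length), f (t * 5 + 8) = (ts[t].2.2.2 : ℕ)

theorem length_flatMap_encT {k n : ℕ} (ts : Trans k n) :
    (ts.flatMap encT).length = ts.length * 5 := by
  induction ts with
  | nil => rfl
  | cons t ts ih => rw [List.flatMap_cons, List.length_append, ih, List.length_cons, encT]; simp; ring

theorem getD_flatMap_encT {k n : ℕ} : ∀ (ts : Trans k n) (t : ℕ) (h : t < ts.length) (i : ℕ),
    i < 5 → (ts.flatMap encT).getD (t * 5 + i) 0 = (encT ts[t]).getD i 0
  | a :: ts, 0, _, i, hi => by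
      rw [List.flatMap_cons, List.getD_append _ _ _ _ (by simpa [encT] using hi)]
      simp
  | a :: ts, t + 1, h, i, hi => by
      rw [List.flatMap_cons, List.getD_append_right _ _ _ _ (by simp [encT]; omega)]
      have : (t + 1) * 5 + i - (encT a).length = t * 5 + i := by simp [encT]; omega
      rw [this, getD_flatMap_encT ts t (by simpa using h) i hi]
      simp

theorem length_codeOf {k n : ℕ} (q : Fin n) (ts : Trans k n) :
    (codeOf q ts).length = 4 + ts.length * 5 := by
  rw [codeOf, List.length_append, length_flatMap_encT]; rfl

theorem getD_codeOf {k n : ℕ} (q : Fin n) (ts : Trans k n) {t : ℕ} (h : t < ts.length) {i : ℕ}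
    (hi : i < 5) : (codeOf q ts).getD (4 + (t * 5 + i)) 0 = (encT ts[t]).getD i 0 := by
  rw [codeOf, List.getD_append_right _ _ _ _ (by simp), ← getD_flatMap_encT ts t h i hi]
  congr 1
  simp

theorem Holds.getD {k n : ℕ} {f : ℤ → ℤ} {q : Fin n} {ts : Trans k n} (h : Holds f q ts) (j : ℕ)
    (hj : j < (codeOf q ts).length) : f j = (codeOf q ts).getD j 0 := by
  rw [length_codeOf] at hj
  by_cases h4 : j < 4
  · interval_cases j
    · exact h.alph
    · exact h.states
    · exact h.init
    · exact h.len
  · obtain ⟨t, i, hi, rfl⟩ : ∃ t i, i < 5 ∧ j = 4 + (t * 5 + i) :=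
      ⟨(j - 4) / 5, (j - 4) % 5, Nat.mod_lt _ (by norm_num), by omega⟩
    have ht : t < ts.length := by omega
    rw [getD_codeOf q ts ht hi]
    have e : ∀ m : ℤ, ((4 + (t * 5 + i) : ℕ) : ℤ) = t * 5 + (4 + i) := fun _ => by push_cast; ring
    rw [e 0]
    interval_cases i
    · exact h.src t ht
    · exact h.lab t ht
    · exact h.num t ht
    · exact h.den t ht
    · exact h.dst t ht

theorem holds_of_getD {k n : ℕ} {f : ℤ → ℤ} {q : Fin n} {ts : Trans k n}
    (h : ∀ j : ℕ, j < (codeOf q ts).length → f j = (codeOf q ts).getD j 0) : Holds f q ts := by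
  have key : ∀ t (ht : t < ts.length) (i : ℕ), i < 5 →
      f (t * 5 + (4 + i : ℕ)) = (encT ts[t]).getD i 0 := by
    intro t ht i hi
    rw [← getD_codeOf q ts ht hi, ← h _ (by rw [length_codeOf]; omega)]
    congr 1; push_cast; ring
  have hl := length_codeOf q ts
  exact ⟨h 0 (by omega), h 1 (by omega), h 2 (by omega), h 3 (by omega),
    fun t ht => key t ht 0 (by norm_num), fun t ht => key t ht 1 (by norm_num),
    fun t ht => key t ht 2 (by norm_num), fun t ht => key t ht 3 (by norm_num),
    fun t ht => key t ht 4 (by norm_num)⟩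

/-! ### Rules for structured programs -/

namespace SP

/-- This adds a frame to `eval_rep`: unwritten arrays and the counters of other loops keep their
values, so invariants need only mention what the body changes. -/
theorem rep_induction {σ c j : ℕ} {P : SP} {s : Store} (hwf : P.Wf σ) (Inv : ℕ → Store → Prop)
    (h0 : Inv 0 (s.write 2 c 0))
    (hs : ∀ i : ℕ, i < (s σ j).toNat → ∀ s' : Store,
      (∀ a, a ≠ 2 → a ∉ P.writes → s' a = s a) →
      (∀ d : ℕ, d ≠ c → d ∉ P.counters → s' 2 d = s 2 d) →
      s' 2 c = (i : ℤ) → Inv i s' → Inv (i + 1) ((P.eval σ s').write 2 c ((i : ℤ) + 1))) :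
    Inv (s σ j).toNat ((rep c j P).eval σ s) := by
  refine (eval_rep (fun i s' => (∀ a, a ≠ 2 → a ∉ P.writes → s' a = s a) ∧
      (∀ d : ℕ, d ≠ c → d ∉ P.counters → s' 2 d = s 2 d) ∧ Inv i s') ?_ ?_).2.2
  · refine ⟨fun a ha _ => Store.write_of_ne _ ha _ _, fun d hd _ => ?_, h0⟩
    rw [Store.write_apply, if_neg]
    exact fun h => hd (by exact_mod_cast h.2)
  · rintro i hi s' hc ⟨h1, h2, h3⟩
    refine ⟨fun a ha ha' => ?_, fun d hd hd' => ?_, hs i hi s' h1 h2 hc h3⟩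
    · rw [Store.write_of_ne _ ha, eval_frame σ P ha', h1 a ha ha']
    · rw [Store.write_apply, if_neg (fun h => hd (by exact_mod_cast h.2)), eval_counter hwf hd',
        h2 d hd hd']

theorem eval_seq (σ : ℕ) (P R : SP) (s : Store) : (seq P R).eval σ s = R.eval σ (P.eval σ s) := rfl

theorem eval_ite (σ : ℕ) (e : Exp) (P R : SP) (s : Store) :
    (ite e P R).eval σ s = if 0 < e.val s then P.eval σ s else R.eval σ s := rfl

/-- A loop counter. -/
def ctr (i : ℕ) : Exp := .get 2 (.lit i)

/-- Entry `5 t + i` of the input. -/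
def fld (σ : ℕ) (t : Exp) (i : ℤ) : Exp := .get σ (.add (.mul t (.lit 5)) (.lit i))

/-! ### Scaling of the weights to integers -/

/-- The product of the denominators of the weights. -/
def _root_.QuantAut.denProd {k n : ℕ} (ts : Trans k n) : ℕ := (ts.map fun t => t.2.2.1.den).prod

/-- The common multiple of the denominators by which weights are scaled. -/
def _root_.QuantAut.scale {k n : ℕ} (ts : Trans k n) : ℕ := denProd ts * n.factorial

theorem _root_.QuantAut.denProd_pos {k n : ℕ} (ts : Trans k n) : 0 < denProd ts :=
  List.prod_pos (by simp only [List.mem_map]; rintro _ ⟨t, -, rfl⟩; exact t.2.2.1.den_pos)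

theorem _root_.QuantAut.scale_pos {k n : ℕ} (ts : Trans k n) : 0 < scale ts :=
  Nat.mul_pos (denProd_pos ts) n.factorial_pos

theorem _root_.QuantAut.den_dvd_denProd {k n : ℕ} {ts : Trans k n} {t} (h : t ∈ ts) :
    t.2.2.1.den ∣ denProd ts :=
  List.dvd_prod (List.mem_map.2 ⟨t, h, rfl⟩)

/-- Compute the scaling factor. -/
def scaleP (σ : ℕ) : SP :=
  seq (set 5 (.lit 0) (.lit 1)) (seq
    (rep 0 3 (set 5 (.lit 0) (.mul (.get 5 (.lit 0)) (fld σ (ctr 0) 7))))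
    (rep 0 1 (set 5 (.lit 0) (.mul (.get 5 (.lit 0)) (.add (ctr 0) (.lit 1))))))

/-- Scale the weights. -/
def weightP (σ : ℕ) : SP :=
  rep 0 3 (set 6 (ctr 0)
    (.mul (.div (.get 5 (.lit 0)) (fld σ (ctr 0) 7)) (fld σ (ctr 0) 6)))

/-- Bring the scaled top values to lowest terms. -/
def reduceP : SP :=
  rep 0 1 (seq (set 4 (.lit 0) (.get 5 (.lit 0))) (seq
    (ite (.get 11 (ctr 0)) (set 4 (.lit 1) (.get 11 (ctr 0)))
      (set 4 (.lit 1) (.sub (.lit 0) (.get 11 (ctr 0))))) (seq gcd (seq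
    (set 12 (ctr 0) (.div (.get 11 (ctr 0)) (.get 4 (.lit 0))))
    (set 13 (ctr 0) (.div (.get 5 (.lit 0)) (.get 4 (.lit 0))))))))

/-- The place of a transition without its weight in the table of transitions. -/
def keyE (σ : ℕ) : Exp :=
  .add (.mul (.add (.mul (fld σ (ctr 0) 4) (.get σ (.lit 0))) (fld σ (ctr 0) 5))
    (.get σ (.lit 1))) (fld σ (ctr 0) 8)

/-- Entry `i` of the next transition of the output. -/
def nextE (i : ℤ) : Exp := .add (.mul (.get 15 (.lit 0)) (.lit 5)) (.lit i)

/-- Output the reweighted transitions without repetition. -/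
def outP (σ : ℕ) : SP :=
  rep 0 3 (ite (.get 14 (keyE σ)) skip (seq (set 14 (keyE σ) (.lit 1)) (seq
    (set 1 (nextE 4) (fld σ (ctr 0) 4)) (seq
    (set 1 (nextE 5) (fld σ (ctr 0) 5)) (seq
    (set 1 (nextE 6) (.get 12 (fld σ (ctr 0) 8))) (seq
    (set 1 (nextE 7) (.get 13 (fld σ (ctr 0) 8))) (seq
    (set 1 (nextE 8) (fld σ (ctr 0) 8))
    (set 15 (.lit 0) (.add (.get 15 (.lit 0)) (.lit 1))))))))))

/-- Output the header. -/
def headP (σ : ℕ) : SP :=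
  seq (set 1 (.lit 0) (.get σ (.lit 0))) (seq (set 1 (.lit 1) (.get σ (.lit 1))) (seq
    (set 1 (.lit 2) (.get σ (.lit 2))) (set 1 (.lit 3) (.get 15 (.lit 0)))))

section

variable {k n σ : ℕ} {s : Store} {q₀ : Fin n} {ts : Trans k n}

theorem wf_scaleP (hσ : σ = 0 ∨ σ = 3) : (scaleP σ).Wf σ := by
  rcases hσ with rfl | rfl <;> simp [scaleP, Wf, Exp.Ok, Exp.Small, fld, ctr, counters]

theorem wf_weightP (hσ : σ = 0 ∨ σ = 3) : (weightP σ).Wf σ := by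
  rcases hσ with rfl | rfl <;> simp [weightP, Wf, Exp.Ok, Exp.Small, fld, ctr, counters]

theorem wf_reduceP (hσ : σ = 0 ∨ σ = 3) : reduceP.Wf σ := by
  rcases hσ with rfl | rfl <;> simp [reduceP, Wf, Exp.Ok, ctr, counters]

theorem wf_outP (hσ : σ = 0 ∨ σ = 3) : (outP σ).Wf σ := by
  rcases hσ with rfl | rfl <;>
    simp [outP, keyE, nextE, Wf, Exp.Ok, Exp.Small, fld, ctr, counters]

theorem wf_headP (hσ : σ = 0 ∨ σ = 3) : (headP σ).Wf σ := by
  rcases hσ with rfl | rfl <;> simp [headP, Wf, Exp.Ok]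

theorem scaleP_spec (hσ : σ = 0 ∨ σ = 3) (h : Holds (s σ) q₀ ts) :
    (scaleP σ).eval σ s 5 0 = scale ts := by
  have hwf := wf_scaleP hσ
  have hσ2 : σ ≠ 2 := by omega
  have hσ5 : σ ≠ 5 := by omega
  set s1 := (set 5 (.lit 0) (.lit 1)).eval σ s with hs1
  have hs1σ : s1 σ = s σ := Store.write_of_ne _ hσ5 _ _
  have h1 := rep_induction (σ := σ) (c := 0) (j := 3) (s := s1) hwf.2.1.2.2
    (fun i s' => s' 5 0 = ((ts.take i).map fun t => (t.2.2.1.den : ℤ)).prod)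
    (by simp [hs1, eval, Store.write_apply, Exp.val])
    (fun i hi s' hf _ hc hI => by
      rw [hs1σ, Nat.cast_ofNat, h.len, Int.toNat_natCast] at hi
      have hin : s' σ = s σ := (hf σ hσ2 (by simpa [writes] using hσ5)).trans hs1σ
      have hd := h.den i hi
      simp only [Nat.cast_zero] at hc
      simp only [Store.write_of_ne _ (show 5 ≠ 2 by decide), eval, Store.write_same, Exp.val,
        fld, ctr, Nat.cast_zero, hI, hc, hin, hd]
      rw [List.take_succ_eq_append_getElem hi, List.map_append, List.prod_append]
      simp)
  set s2 := (rep 0 3 (set 5 (.lit 0) (.mul (.get 5 (.lit 0)) (fld σ (ctr 0) 7)))).eval σ s1 with hs2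
  have hs2σ : s2 σ = s σ :=
    (eval_frame σ _ (by simp only [writes, List.mem_cons]; simp [hσ2, hσ5]) _).trans hs1σ
  have h2 := rep_induction (σ := σ) (c := 0) (j := 1) (s := s2) hwf.2.2.2.2
    (fun i s' => s' 5 0 = denProd ts * i.factorial)
    (by
      rw [hs1σ, Nat.cast_ofNat, h.len, Int.toNat_natCast, List.take_length] at h1
      rw [Store.write_of_ne _ (show 5 ≠ 2 by decide), h1, denProd, Nat.cast_list_prod]
      simp [Function.comp_def])
    (fun i hi s' _ _ hc hI => by
      simp only [Nat.cast_zero] at hc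
      simp only [Store.write_of_ne _ (show 5 ≠ 2 by decide), eval, Store.write_same, Exp.val,
        ctr, Nat.cast_zero, hI, hc]
      rw [Nat.factorial_succ]; push_cast; ring)
  rw [hs2σ, Nat.cast_one, h.states, Int.toNat_natCast] at h2
  rw [scale, Nat.cast_mul]
  exact h2

theorem weightP_spec (hσ : σ = 0 ∨ σ = 3) (h : Holds (s σ) q₀ ts) (h5 : s 5 0 = scale ts)
    (t : ℕ) (ht : t < ts.length) :
    ((weightP σ).eval σ s 6 t : ℚ) = ts[t].2.2.1 * scale ts := by
  have hσ2 : σ ≠ 2 := by omega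
  have hσ6 : σ ≠ 6 := by omega
  have h1 := rep_induction (σ := σ) (c := 0) (j := 3) (s := s) (wf_weightP hσ).2.2
    (fun i s' => ∀ t (ht : t < ts.length), t < i → (s' 6 t : ℚ) = ts[t].2.2.1 * scale ts)
    (fun t _ ht => absurd ht (Nat.not_lt_zero _))
    (fun i hi s' hf _ hc hI t ht hti => by
      rw [Nat.cast_ofNat, h.len, Int.toNat_natCast] at hi
      have hin : s' σ = s σ := hf σ hσ2 (by simpa [writes] using hσ6)
      have h5' : s' 5 0 = scale ts := by rw [hf 5 (by decide) (by simp [writes]), h5]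
      simp only [Nat.cast_zero] at hc
      simp only [Store.write_of_ne _ (show 6 ≠ 2 by decide), eval, Exp.val,
        fld, ctr, Nat.cast_zero, hc, hin, h.den i hi, h.num i hi, h5', Store.write_self]
      by_cases hti' : t = i
      · subst hti'
        rw [if_pos rfl]
        -- The denominator divides the scaling factor, so the integer division is exact.
        obtain ⟨c, hc⟩ := (den_dvd_denProd (List.getElem_mem hi)).trans (Dvd.intro n.factorial rfl)
        have hd : (ts[t].2.2.1.den : ℤ) ≠ 0 := by exact_mod_cast ts[t].2.2.1.den_ne_zero
        rw [scale, hc, Nat.cast_mul, Int.mul_ediv_cancel_left _ hd]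
        push_cast
        have hd' : (ts[t].2.2.1.den : ℚ) ≠ 0 := by exact_mod_cast hd
        have hnum : ts[t].2.2.1 * (ts[t].2.2.1.den : ℚ) = ts[t].2.2.1.num := Rat.mul_den_eq_num _
        rw [← mul_assoc, hnum, mul_comm]
      · rw [if_neg (fun hh => hti' (by exact_mod_cast hh))]
        exact hI t ht (by omega))
  rw [Nat.cast_ofNat, h.len, Int.toNat_natCast] at h1
  exact h1 t ht ht

/-! ### Lowest terms, and output without repetition. -/

theorem num_div_natCast (a : ℤ) {b : ℕ} (hb : 0 < b) :
    ((a : ℚ) / b).num = a / (Int.gcd b a : ℕ) ∧ (((a : ℚ) / b).den : ℤ) = b / (Int.gcd b a : ℕ) := by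
  have e : (a : ℚ) / b = mkRat a b := (Rat.mkRat_eq_div a b).symm
  have g : Int.gcd b a = b.gcd a.natAbs := rfl
  rw [e, Rat.num_mkRat, Rat.den_mkRat, if_neg hb.ne', if_neg hb.ne', g]
  exact ⟨rfl, Int.natCast_div _ _⟩

/-- Euclid's loop runs only while its second argument is positive, so it is given the absolute value
of the numerator. If the numerator is `0`, the loop does nothing and the denominator `b` is already
the greatest common divisor. -/
theorem reduceP_spec (hσ : σ = 0 ∨ σ = 3) (h : Holds (s σ) q₀ ts) {b : ℕ} (hb : 0 < b)
    (h5 : s 5 0 = b) (q : ℕ) (hq : q < n) :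
    reduceP.eval σ s 12 q = ((s 11 q : ℚ) / b).num ∧
      reduceP.eval σ s 13 q = ((s 11 q : ℚ) / b).den := by
  have h1 := rep_induction (σ := σ) (c := 0) (j := 1) (s := s) (wf_reduceP hσ).2.2
    (fun i s' => ∀ q : ℕ, q < i → s' 12 q = ((s 11 q : ℚ) / b).num ∧
      s' 13 q = ((s 11 q : ℚ) / b).den)
    (fun q hq => absurd hq (Nat.not_lt_zero _))
    (fun i hi s' hf _ hc hI q hqi => by
      have h5' : s' 5 0 = b := by rw [hf 5 (by decide) (by simp [writes]), h5]
      have h11 : s' 11 = s 11 := hf 11 (by decide) (by simp [writes])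
      simp only [Nat.cast_zero] at hc
      obtain ⟨hn, hd⟩ := num_div_natCast (s 11 i) hb
      have hbZ : (0 : ℤ) < b := by exact_mod_cast hb
      have key : ∀ s'' : Store, s'' 4 0 = b → s'' 4 1 = |s 11 i| →
          SP.gcd.eval σ s'' 4 0 = (Int.gcd b (s 11 i) : ℕ) := by
        intro s'' h0 h1
        rw [eval, h0, h1]
        split_ifs with hpos
        · simp [Store.write_apply, Int.gcd, Int.natAbs_abs]
        · have : s 11 i = 0 := by simpa using hpos
          rw [h0, this]
          simp
      simp only [eval_seq]
      generalize hs3 : (ite (.get 11 (ctr 0)) (set 4 (.lit 1) (.get 11 (ctr 0)))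
        (set 4 (.lit 1) (.sub (.lit 0) (.get 11 (ctr 0))))).eval σ
          ((set 4 (.lit 0) (.get 5 (.lit 0))).eval σ s') = s3
      have hfr : ∀ a, a ≠ 4 → s3 a = s' a := fun a ha => by
        rw [← hs3, eval_frame σ _ (by simpa [writes] using ha),
          eval_frame σ _ (by simpa [writes] using ha)]
      have h30 : s3 4 0 = b := by
        rw [← hs3, eval_ite]
        split_ifs <;> simp [eval, Store.write_apply, Exp.val, h5']
      have h31 : s3 4 1 = |s 11 i| := by
        rw [← hs3, eval_ite]
        split_ifs with hp <;>
          simp [eval, Store.write_apply, Exp.val, ctr, hc, h11] at hp ⊢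
        · exact (abs_of_pos hp).symm
        · exact (abs_of_nonpos hp).symm
      have h4 := key s3 h30 h31
      have hfr4 : ∀ a, a ≠ 4 → SP.gcd.eval σ s3 a = s' a := fun a ha => by
        rw [eval_frame σ _ (by simpa [writes] using ha), hfr a ha]
      generalize SP.gcd.eval σ s3 = s4 at h4 hfr4
      have e12 := hfr4 12 (by decide)
      have e13 := hfr4 13 (by decide)
      simp only [eval, Exp.val, ctr, ne_eq, Store.write_of_ne, Store.write_self, hfr4, h4,
        Nat.cast_zero, hc, h11, h5', Nat.reduceEqDiff, not_false_eq_true]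
      rcases (Nat.lt_succ_iff.1 hqi).lt_or_eq with hlt | rfl
      · have hne : (q : ℤ) ≠ i := by exact_mod_cast hlt.ne
        rw [if_neg hne, if_neg hne]
        exact hI q hlt
      · rw [if_pos rfl, if_pos rfl, hn, hd]
        exact ⟨rfl, rfl⟩)
  rw [Nat.cast_one, h.states, Int.toNat_natCast] at h1
  exact h1 q hq

/-- These are digits in mixed radix: `q` is the digit below `n`, `a` the digit below `k`, and `p`
the leading part. -/
theorem keyE_injective {p p' q q' : Fin n} {a a' : Fin k}
    (h : (((p : ℕ) : ℤ) * k + (a : ℕ)) * n + (q : ℕ) = (((p' : ℕ) : ℤ) * k + (a' : ℕ)) * n + (q' : ℕ)) :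
    p = p' ∧ a = a' ∧ q = q' := by
  have h' : ((p : ℕ) * k + a) * n + q = ((p' : ℕ) * k + a') * n + q' := by exact_mod_cast h
  have hn := q.pos
  have hk := a.pos
  have e1 := congrArg (· / n) h'
  have e2 := congrArg (· % n) h'
  simp only [Nat.mul_add_mod_of_lt q.2, Nat.mul_add_mod_of_lt q'.2] at e2
  simp only [mul_comm _ n, Nat.mul_add_div hn, Nat.div_eq_of_lt q.2, Nat.div_eq_of_lt q'.2,
    add_zero] at e1
  have e3 := congrArg (· / k) e1
  have e4 := congrArg (· % k) e1
  simp only [mul_comm _ k, Nat.mul_add_div hk, Nat.div_eq_of_lt a.2, Nat.div_eq_of_lt a'.2,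
    add_zero] at e3
  simp only [Nat.mul_add_mod', Nat.mod_eq_of_lt a.2, Nat.mod_eq_of_lt a'.2] at e4
  refine ⟨Fin.ext e3, Fin.ext e4, Fin.ext ?_⟩
  simpa [Nat.mod_eq_of_lt q.2, Nat.mod_eq_of_lt q'.2] using e2

/-- The state of the output loop after some transitions `us` have been processed: `out` has been
written. -/
structure OutInv (θ : Fin n → ℚ) (us out : Trans k n) (s : Store) : Prop where
  nodup : out.Nodup
  mem : ∀ p a x q, (p, a, x, q) ∈ out ↔ x = θ q ∧ ∃ x', (p, a, x', q) ∈ us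
  len : s 15 0 = out.length
  key : ∀ (p : Fin n) (a : Fin k) (q : Fin n),
    0 < s 14 ((((p : ℕ) : ℤ) * k + (a : ℕ)) * n + (q : ℕ)) ↔ ∃ x', (p, a, x', q) ∈ us
  src : ∀ t (h : t < out.length), s 1 (t * 5 + 4) = (out[t].1 : ℕ)
  lab : ∀ t (h : t < out.length), s 1 (t * 5 + 5) = (out[t].2.1 : ℕ)
  num : ∀ t (h : t < out.length), s 1 (t * 5 + 6) = out[t].2.2.1.num
  den : ∀ t (h : t < out.length), s 1 (t * 5 + 7) = out[t].2.2.1.den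
  dst : ∀ t (h : t < out.length), s 1 (t * 5 + 8) = (out[t].2.2.2 : ℕ)

/-- Transitions that differ only in their weight coincide after reweighting, whereas a code lists
each transition once. Array `14` therefore marks the triples of source, letter and target that have
been written, and array `15` counts them. -/
theorem outP_spec (hσ : σ = 0 ∨ σ = 3) (h : Holds (s σ) q₀ ts) (h14 : ∀ i, s 14 i = 0)
    (h15 : s 15 0 = 0) {θ : Fin n → ℚ} (h12 : ∀ q : Fin n, s 12 (q : ℕ) = (θ q).num)
    (h13 : ∀ q : Fin n, s 13 (q : ℕ) = (θ q).den) :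
    ∃ out, OutInv θ ts out ((outP σ).eval σ s) := by
  have h1 := rep_induction (σ := σ) (c := 0) (j := 3) (s := s) (wf_outP hσ).2.2
    (fun i s' => ∃ out, OutInv θ (ts.take i) out s')
    ⟨[], List.nodup_nil, by simp, by simp [Store.write_of_ne, h15],
      by simp [Store.write_of_ne, h14], by simp, by simp, by simp, by simp, by simp⟩
    (fun i hi s' hf _ hc ⟨out, hI⟩ => by
      rw [Nat.cast_ofNat, h.len, Int.toNat_natCast] at hi
      have hin : s' σ = s σ := by
        rcases hσ with rfl | rfl <;> exact hf _ (by decide) (by simp [writes])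
      have h12' : s' 12 = s 12 := hf _ (by decide) (by simp [writes])
      have h13' : s' 13 = s 13 := hf _ (by decide) (by simp [writes])
      simp only [Nat.cast_zero] at hc
      have hsrc := h.src i hi
      have hlab := h.lab i hi
      have hdst := h.dst i hi
      rw [List.take_succ_eq_append_getElem hi]
      generalize ts[i] = τ at hsrc hlab hdst
      obtain ⟨p, a, x, q⟩ := τ
      simp only at hsrc hlab hdst
      set K : ℤ := (((p : ℕ) : ℤ) * k + (a : ℕ)) * n + (q : ℕ) with hK
      have hkey : ∀ s'' : Store, s'' 2 0 = i → s'' σ = s σ → (keyE σ).val s'' = K := by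
        intro s'' hc hin
        simp only [keyE, fld, ctr, Exp.val, Nat.cast_zero, hc, hin, hsrc, hlab, hdst, h.alph,
          h.states, hK]
      have hkey' := hkey s' hc hin
      have hKey : ∀ (p' : Fin n) (a' : Fin k) (q' : Fin n),
          (((p' : ℕ) : ℤ) * k + (a' : ℕ)) * n + (q' : ℕ) = K ↔ p' = p ∧ a' = a ∧ q' = q :=
        fun p' a' q' => ⟨keyE_injective, by rintro ⟨rfl, rfl, rfl⟩; rfl⟩
      rw [eval_ite, Exp.val, hkey']
      by_cases hpos : 0 < s' 14 K
      · rw [if_pos hpos, eval]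
        obtain ⟨x₀, hx₀⟩ := (hI.key p a q).1 hpos
        have hiff : ∀ (p' : Fin n) (a' : Fin k) (q' : Fin n),
            (∃ x', (p', a', x', q') ∈ ts.take i ++ [(p, a, x, q)]) ↔
              ∃ x', (p', a', x', q') ∈ ts.take i := by
          intro p' a' q'
          simp only [List.mem_append, List.mem_singleton, Prod.mk.injEq]
          constructor
          · rintro ⟨x', h | ⟨rfl, rfl, -, rfl⟩⟩
            · exact ⟨x', h⟩
            · exact ⟨x₀, hx₀⟩
          · rintro ⟨x', h⟩
            exact ⟨x', Or.inl h⟩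
        refine ⟨out, ⟨hI.nodup, ?_, ?_, ?_, ?_, ?_, ?_, ?_, ?_⟩⟩
        · intro p' a' x' q'; rw [hiff]; exact hI.mem p' a' x' q'
        · rw [Store.write_of_ne _ (by decide)]; exact hI.len
        · intro p' a' q'; rw [hiff, Store.write_of_ne _ (by decide)]; exact hI.key p' a' q'
        all_goals rw [Store.write_of_ne _ (by decide)]
        exacts [hI.src, hI.lab, hI.num, hI.den, hI.dst]
      · rw [if_neg hpos]
        have hlen := hI.len
        have e12 := h12 q
        have e13 := h13 q
        have hσ1 : σ ≠ 1 := by omega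
        have hσ14 : σ ≠ 14 := by omega
        generalize hs'' : SP.eval σ _ s' = s''
        have f15 : s'' 15 0 = out.length + 1 := by
          rw [← hs'']
          simp [eval, Exp.val, Store.write_of_ne, Store.write_self, hlen]
        have f14 : ∀ j, s'' 14 j = if j = K then 1 else s' 14 j := by
          intro j
          rw [← hs'']
          simp [eval, Exp.val, Store.write_of_ne, Store.write_self, hkey']
        have f1 : ∀ j, s'' 1 j = if j = out.length * 5 + 8 then ((q : ℕ) : ℤ) else
            if j = out.length * 5 + 7 then ((θ q).den : ℤ) else
            if j = out.length * 5 + 6 then (θ q).num else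
            if j = out.length * 5 + 5 then ((a : ℕ) : ℤ) else
            if j = out.length * 5 + 4 then ((p : ℕ) : ℤ) else s' 1 j := by
          intro j
          rw [← hs'']
          simp only [eval, Exp.val, nextE, fld, ctr, ne_eq, Store.write_of_ne, Store.write_self,
            Nat.reduceEqDiff, not_false_eq_true, OfNat.ofNat_ne_one, OfNat.one_ne_ofNat, hσ1, hσ14,
            hlen, hin, hc, Nat.cast_zero, hsrc, hlab, hdst, h12', h13', e12, e13]
        have hold : ∀ (t : ℕ) (z : ℤ), t < out.length → 4 ≤ z → z ≤ 8 →
            s'' 1 (t * 5 + z) = s' 1 (t * 5 + z) := by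
          intro t z ht h4 h8
          rw [f1, if_neg (by omega), if_neg (by omega), if_neg (by omega), if_neg (by omega),
            if_neg (by omega)]
        have hnot : ¬ ∃ x', (p, a, x', q) ∈ ts.take i := fun hh => hpos ((hI.key p a q).2 hh)
        have hget : ∀ (t : ℕ) (ht : t < (out ++ [(p, a, θ q, q)]).length),
            (∃ h : t < out.length, (out ++ [(p, a, θ q, q)])[t] = out[t]) ∨
              (t = out.length ∧ (out ++ [(p, a, θ q, q)])[t] = (p, a, θ q, q)) := by
          intro t ht
          rw [List.length_append, List.length_singleton] at ht
          rcases (Nat.lt_succ_iff.1 ht).lt_or_eq with h | rfl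
          · exact Or.inl ⟨h, List.getElem_append_left h⟩
          · exact Or.inr ⟨rfl, by simp⟩
        refine ⟨out ++ [(p, a, θ q, q)], ⟨?_, ?_, ?_, ?_, ?_, ?_, ?_, ?_, ?_⟩⟩
        · rw [List.nodup_append]
          refine ⟨hI.nodup, List.nodup_singleton _, ?_⟩
          rintro t ht t' ht' rfl
          obtain rfl := List.mem_singleton.1 ht'
          exact hnot ((hI.mem _ _ _ _).1 ht).2
        · intro p' a' x' q'
          simp only [List.mem_append, List.mem_singleton, Prod.mk.injEq, hI.mem]
          constructor
          · rintro (⟨h1, x₁, h2⟩ | ⟨rfl, rfl, rfl, rfl⟩)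
            · exact ⟨h1, x₁, Or.inl h2⟩
            · exact ⟨rfl, x, Or.inr ⟨rfl, rfl, rfl, rfl⟩⟩
          · rintro ⟨h1, x₁, h2 | ⟨rfl, rfl, -, rfl⟩⟩
            · exact Or.inl ⟨h1, x₁, h2⟩
            · exact Or.inr ⟨rfl, rfl, h1, rfl⟩
        · rw [Store.write_of_ne _ (by decide), f15, List.length_append]; simp
        · intro p' a' q'
          rw [Store.write_of_ne _ (by decide), f14]
          simp only [List.mem_append, List.mem_singleton, Prod.mk.injEq]
          split_ifs with hh
          · obtain ⟨rfl, rfl, rfl⟩ := (hKey _ _ _).1 hh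
            simp only [zero_lt_one, true_iff]
            exact ⟨x, Or.inr (by simp)⟩
          · rw [hI.key]
            constructor
            · rintro ⟨x', h⟩; exact ⟨x', Or.inl h⟩
            · rintro ⟨x', h | ⟨h1, h2, -, h3⟩⟩
              · exact ⟨x', h⟩
              · exact absurd ((hKey _ _ _).2 ⟨h1, h2, h3⟩) hh
        all_goals
          intro t ht
          rw [Store.write_of_ne _ (by decide)]
          rcases hget t ht with ⟨ht', he⟩ | ⟨rfl, he⟩
          · rw [he, hold t _ ht' (by norm_num) (by norm_num)]
            first
              | exact hI.src t ht' | exact hI.lab t ht' | exact hI.num t ht' | exact hI.den t ht'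
              | exact hI.dst t ht'
          · rw [he, f1]
            simp)
  rw [Nat.cast_ofNat, h.len, Int.toNat_natCast, List.take_length] at h1
  exact h1

/-- The header comes last, because the number of transitions is known only after the repetitions
have been removed. It occupies the entries `0` to `3`, below all records. -/
theorem headP_spec (hσ : σ = 0 ∨ σ = 3) (h : Holds (s σ) q₀ ts) {θ : Fin n → ℚ} {out : Trans k n}
    (ho : OutInv θ ts out s) : Holds ((headP σ).eval σ s 1) q₀ out := by
  have h1 : ∀ (z : ℤ) (i : ℕ), 4 ≤ z → (headP σ).eval σ s 1 ((i : ℤ) * 5 + z) = s 1 (i * 5 + z) := by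
    intro z i hz
    simp only [headP, eval, Store.write_self, Exp.val]
    rw [if_neg (by omega), if_neg (by omega), if_neg (by omega), if_neg (by omega)]
  have hσ1 : σ ≠ 1 := by omega
  have ha := h.alph
  have hs := h.states
  have hi := h.init
  refine ⟨?_, ?_, ?_, ?_, fun t ht => (h1 _ _ (by norm_num)).trans (ho.src t ht),
    fun t ht => (h1 _ _ (by norm_num)).trans (ho.lab t ht),
    fun t ht => (h1 _ _ (by norm_num)).trans (ho.num t ht),
    fun t ht => (h1 _ _ (by norm_num)).trans (ho.den t ht),
    fun t ht => (h1 _ _ (by norm_num)).trans (ho.dst t ht)⟩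
  all_goals simp [headP, eval, Store.write_self, Store.write_of_ne _ hσ1, Store.write_of_ne, Exp.val,
    ha, hs, hi, ho.len]

end

end SP

/-! ### Scaled maxima -/

/-- `o` is `⊥` or, scaled by `M`, an element of `T`, and it is an upper bound of `S`. -/
def Approx (M : ℚ) (o : WithBot ℤ) (S T : Set ℚ) : Prop :=
  (∀ z : ℤ, o = z → (z : ℚ) / M ∈ T) ∧ ∀ c ∈ S, ∃ z : ℤ, o = z ∧ c ≤ z / M

/-- `o` is the greatest element of `S`, scaled by `M`, or `⊥` if `S` is empty. -/
def IsTop (M : ℚ) (o : WithBot ℤ) (S : Set ℚ) : Prop := Approx M o S S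

theorem isTop_bot {M : ℚ} {S : Set ℚ} (h : ∀ c, c ∉ S) : IsTop M ⊥ S :=
  ⟨fun _ hz => absurd hz (WithBot.bot_ne_coe), fun c hc => absurd hc (h c)⟩

theorem Approx.union {M : ℚ} (hM : 0 < M) {o o' : WithBot ℤ} {S S' S'' T T' T'' : Set ℚ}
    (h : Approx M o S T) (h' : Approx M o' S' T') (hS : ∀ c, c ∈ S'' → c ∈ S ∨ c ∈ S')
    (hT : ∀ c, c ∈ T ∨ c ∈ T' → c ∈ T'') : Approx M (max o o') S'' T'' := by
  constructor
  · intro z hz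
    refine hT _ ?_
    rcases max_choice o o' with hh | hh <;> rw [hh] at hz
    · exact Or.inl (h.1 z hz)
    · exact Or.inr (h'.1 z hz)
  · intro c hc
    have key : ∀ z : ℤ, (z : WithBot ℤ) ≤ max o o' → c ≤ z / M →
        ∃ z : ℤ, max o o' = z ∧ c ≤ z / M := by
      intro z hz hcz
      obtain ⟨y, hy, hzy⟩ := (WithBot.coe_le_iff).1 hz
      refine ⟨y, hy, hcz.trans ?_⟩
      gcongr
    rcases hS c hc with hc | hc
    · obtain ⟨z, rfl, hz⟩ := h.2 c hc
      exact key z (le_max_left _ _) hz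
    · obtain ⟨z, rfl, hz⟩ := h'.2 c hc
      exact key z (le_max_right _ _) hz

theorem IsTop.union {M : ℚ} (hM : 0 < M) {o o' : WithBot ℤ} {S S' T : Set ℚ} (h : IsTop M o S)
    (h' : IsTop M o' S') (hT : ∀ c, c ∈ T ↔ c ∈ S ∨ c ∈ S') : IsTop M (max o o') T :=
  Approx.union hM h h' (fun c => (hT c).1) fun c => (hT c).2

theorem IsTop.map {M : ℚ} {z z' : ℤ} {S S' : Set ℚ} (h : IsTop M z S) {f : ℚ → ℚ} (hf : Monotone f)
    (hz : (z' : ℚ) / M = f (z / M)) (hS' : ∀ c, c ∈ S' ↔ ∃ d ∈ S, c = f d) : IsTop M z' S' := by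
  constructor
  · intro y hy
    obtain rfl := WithBot.coe_inj.1 hy
    exact (hS' _).2 ⟨_, h.1 z rfl, hz⟩
  · intro c hc
    obtain ⟨d, hd, rfl⟩ := (hS' c).1 hc
    obtain ⟨y, hy, hdy⟩ := h.2 d hd
    obtain rfl := WithBot.coe_inj.1 hy
    exact ⟨z', rfl, hz ▸ hf hdy⟩

theorem IsTop.congr {M : ℚ} {o : WithBot ℤ} {S S' : Set ℚ} (h : IsTop M o S)
    (hS : ∀ c, c ∈ S' ↔ c ∈ S) : IsTop M o S' :=
  ⟨fun z hz => (hS _).2 (h.1 z hz), fun c hc => h.2 c ((hS c).1 hc)⟩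

theorem IsTop.notMem {M : ℚ} {S : Set ℚ} (h : IsTop M ⊥ S) (c : ℚ) : c ∉ S := fun hc => by
  obtain ⟨z, hz, -⟩ := h.2 c hc
  exact WithBot.bot_ne_coe hz

/-- `ValFun.comb` on scaled weights. -/
def ValFun.combZ : ValFun → ℕ → ℤ → ℤ → ℤ
  | .limInf, k, d, w => if k = 0 then w else min d w
  | .limSup, k, d, w => if k = 0 then w else max d w
  | _, _, d, w => d + w

/-- `ValFun.cand` on scaled weights. -/
def ValFun.candZ : ValFun → ℕ → ℤ → ℤ
  | .limInf, _, d => d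
  | .limSup, _, d => d
  | _, k, d => d / k

theorem combZ_div {M : ℚ} (hM : 0 < M) (V : ValFun) (k : ℕ) (d w : ℤ) :
    ((V.combZ k d w : ℤ) : ℚ) / M = V.comb k (d / M) (w / M) := by
  cases V <;> simp only [ValFun.combZ, ValFun.comb]
  case limInf =>
    split_ifs
    · rfl
    · rw [Int.cast_min, min_div_div_right hM.le]
  case limSup =>
    split_ifs
    · rfl
    · rw [Int.cast_max, max_div_div_right hM.le]
  all_goals push_cast; ring

/-- The optimality principle: because of this monotonicity, only the best path to each intermediate
state has to be remembered. -/
theorem comb_mono (V : ValFun) (k : ℕ) (w : ℚ) : Monotone fun d => V.comb k d w := by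
  intro d d' h
  cases V <;> simp only [ValFun.comb]
  case limInf => split_ifs <;> [exact le_rfl; exact min_le_min_right _ h]
  case limSup => split_ifs <;> [exact le_rfl; exact max_le_max_right _ h]
  all_goals linarith

theorem cand_mono (V : ValFun) (k : ℕ) : Monotone (V.cand k) := by
  intro d d' h
  cases V <;> simp only [ValFun.cand]
  case limInf => exact h
  case limSup => exact h
  all_goals exact div_le_div_of_nonneg_right h (by positivity)

/-! ### Recurrences for the values of paths and cycles, and exactness of the scaling. -/

namespace Automaton

variable {S Q : Type}

/-- The values of the paths of length `k` from `u` to `v`. -/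
def walks (V : ValFun) (A : Automaton S Q) (k : ℕ) (u v : Q) : Set ℚ :=
  {c | ∃ xs, A.Path u xs v ∧ xs.length = k ∧ c = V.agg xs}

theorem mem_walks_zero {V : ValFun} {A : Automaton S Q} {u v : Q} {c : ℚ} :
    c ∈ A.walks V 0 u v ↔ u = v ∧ c = 0 := by
  constructor
  · rintro ⟨xs, h, hl, rfl⟩
    obtain rfl := List.length_eq_zero_iff.1 hl
    cases h
    exact ⟨rfl, rfl⟩
  · rintro ⟨rfl, rfl⟩
    exact ⟨[], .nil, rfl, rfl⟩

theorem mem_walks_succ {V : ValFun} {A : Automaton S Q} {k : ℕ} {u v : Q} {c : ℚ} :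
    c ∈ A.walks V (k + 1) u v ↔
      ∃ p x, A.Edge p x v ∧ ∃ d ∈ A.walks V k u p, c = V.comb k d x := by
  constructor
  · rintro ⟨xs, h, hl, rfl⟩
    cases h with
    | nil => simp at hl
    | @snoc xs p _ x h e =>
      rw [List.length_cons, Nat.add_right_cancel_iff] at hl
      exact ⟨p, x, e, _, ⟨xs, h, hl, rfl⟩, by rw [ValFun.agg, hl]⟩
  · rintro ⟨p, x, e, d, ⟨xs, h, hl, rfl⟩, rfl⟩
    exact ⟨x :: xs, h.snoc e, by rw [List.length_cons, hl], by rw [ValFun.agg, hl]⟩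

/-- The values of the cycles of length at most `k` through `u`. -/
def cyclesAt (V : ValFun) (A : Automaton S Q) (k : ℕ) (u : Q) : Set ℚ :=
  {c | ∃ j, 0 < j ∧ j ≤ k ∧ ∃ d ∈ A.walks V j u u, c = V.cand j d}

theorem mem_cyclesAt_succ {V : ValFun} {A : Automaton S Q} {k : ℕ} {u : Q} {c : ℚ} :
    c ∈ A.cyclesAt V (k + 1) u ↔
      c ∈ A.cyclesAt V k u ∨ ∃ d ∈ A.walks V (k + 1) u u, c = V.cand (k + 1) d := by
  constructor
  · rintro ⟨j, h0, hj, h⟩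
    rcases hj.lt_or_eq with hj | rfl
    · exact Or.inl ⟨j, h0, by omega, h⟩
    · exact Or.inr h
  · rintro (⟨j, h0, hj, h⟩ | h)
    · exact ⟨j, h0, by omega, h⟩
    · exact ⟨k + 1, by omega, le_rfl, h⟩

theorem mem_cycleValues [Fintype Q] {V : ValFun} {A : Automaton S Q} {q : Q} {c : ℚ} :
    c ∈ A.cycleValues V q ↔ ∃ u, A.Reach q u ∧ c ∈ A.cyclesAt V (Fintype.card Q) u := by
  constructor
  · rintro ⟨u, xs, hr, hp, hne, hl, rfl⟩
    exact ⟨u, hr, xs.length, List.length_pos_iff.2 hne, hl, _, ⟨xs, hp, rfl, rfl⟩, rfl⟩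
  · rintro ⟨u, hr, _, h0, hj, _, ⟨xs, hp, rfl, rfl⟩, rfl⟩
    exact ⟨u, xs, hr, hp, List.length_pos_iff.1 h0, hj, rfl⟩

/-- The values of the cycles through states that are reachable from `q` in at most `r` steps. -/
def cyclesWithin [Fintype Q] (V : ValFun) (A : Automaton S Q) (r : ℕ) (q : Q) : Set ℚ :=
  {c | ∃ u ys, A.Path q ys u ∧ ys.length ≤ r ∧ c ∈ A.cyclesAt V (Fintype.card Q) u}

theorem Path.exists_cons {A : Automaton S Q} {u v : Q} {xs : List ℚ} (h : A.Path u xs v)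
    (hne : xs ≠ []) : ∃ x p ys, A.Edge u x p ∧ A.Path p ys v ∧ xs.length = ys.length + 1 := by
  induction h with
  | nil => exact absurd rfl hne
  | @snoc xs p q x h e ih =>
    by_cases hxs : xs = []
    · subst hxs
      cases h
      exact ⟨x, q, [], e, .nil, rfl⟩
    · obtain ⟨x', p', ys, e', h', hl⟩ := ih hxs
      exact ⟨x', p', x :: ys, e', h'.snoc e, by simp [hl]⟩

theorem Edge.path {A : Automaton S Q} {p q : Q} {x : ℚ} (h : A.Edge p x q) : A.Path p [x] q :=
  Path.nil.snoc h

/-- The first transition of the path is split off, since propagation passes values from targets to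
sources. -/
theorem mem_cyclesWithin_succ [Fintype Q] {V : ValFun} {A : Automaton S Q} {r : ℕ} {q : Q} {c : ℚ}
    (h : c ∈ A.cyclesWithin V (r + 1) q) :
    c ∈ A.cyclesWithin V r q ∨ ∃ x p, A.Edge q x p ∧ c ∈ A.cyclesWithin V r p := by
  obtain ⟨u, ys, hp, hl, hc⟩ := h
  by_cases hys : ys = []
  · subst hys
    exact Or.inl ⟨u, [], hp, Nat.zero_le _, hc⟩
  · obtain ⟨x, p, zs, e, hz, hl'⟩ := hp.exists_cons hys
    exact Or.inr ⟨x, p, e, u, zs, hz, by omega, hc⟩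

theorem Edge.mem_cycleValues [Fintype Q] {V : ValFun} {A : Automaton S Q} {p q : Q} {x c : ℚ}
    (h : A.Edge p x q) (hc : c ∈ A.cycleValues V q) : c ∈ A.cycleValues V p := by
  rw [Automaton.mem_cycleValues] at *
  obtain ⟨u, hr, hc⟩ := hc
  exact ⟨u, Reach.trans ⟨_, h.path⟩ hr, hc⟩

theorem mem_cyclesWithin_card [Fintype Q] {V : ValFun} {A : Automaton S Q} {q : Q} {c : ℚ}
    (hc : c ∈ A.cycleValues V q) : c ∈ A.cyclesWithin V (Fintype.card Q) q := by
  rw [Automaton.mem_cycleValues] at hc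
  obtain ⟨u, hr, hc⟩ := hc
  obtain ⟨xs, hp, hl⟩ := hr.exists_short
  exact ⟨u, xs, hp, by omega, hc⟩

/-- The list `ts` consists of the transitions of `A`. -/
def Lists {m n : ℕ} (A : Automaton (Fin m) (Fin n)) (ts : Trans m n) : Prop :=
  ∀ p a x q, (p, a, x, q) ∈ ts ↔ (x, q) ∈ A.δ p a

theorem Lists.edge_iff {m n : ℕ} {A : Automaton (Fin m) (Fin n)} {ts : Trans m n} (h : A.Lists ts)
    {p q : Fin n} {x : ℚ} : A.Edge p x q ↔ ∃ a, (p, a, x, q) ∈ ts :=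
  exists_congr fun _ => (h _ _ _ _).symm

theorem Lists.exists_int {m n : ℕ} {A : Automaton (Fin m) (Fin n)} {ts : Trans m n}
    (h : A.Lists ts) {V : ValFun} (hV : V = .limInfAvg ∨ V = .limSupAvg) {u v : Fin n}
    {xs : List ℚ} (hp : A.Path u xs v) : ∃ y : ℤ, V.agg xs * denProd ts = y := by
  rw [agg_avg hV]
  induction hp with
  | nil => exact ⟨0, by simp⟩
  | @snoc xs p q x hp e ih =>
    obtain ⟨y, hy⟩ := ih
    obtain ⟨a, ha⟩ := h.edge_iff.1 e
    obtain ⟨c, hc⟩ := den_dvd_denProd ha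
    refine ⟨x.num * c + y, ?_⟩
    simp only at hc
    rw [List.sum_cons, add_mul, hy, hc]
    push_cast
    rw [← mul_assoc, Rat.mul_den_eq_num]

/-- For averages, `z` is an integer times `n!`: the sum of the weights becomes an integer when
multiplied by the product of the denominators. As `j ≤ n` divides `n!`, the integer division by the
cycle length is exact. -/
theorem Lists.candZ_div {m n : ℕ} {A : Automaton (Fin m) (Fin n)} {ts : Trans m n}
    (h : A.Lists ts) {V : ValFun} (hV : V.Tail) {u v : Fin n} {j : ℕ} (hj : 0 < j) (hjn : j ≤ n)
    {z : ℤ} (hz : (z : ℚ) / scale ts ∈ A.walks V j u v) :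
    ((V.candZ j z : ℤ) : ℚ) / scale ts = V.cand j (z / scale ts) := by
  have key : (V = .limInfAvg ∨ V = .limSupAvg) → ((z / (j : ℤ) : ℤ) : ℚ) = z / j := by
    intro hV'
    obtain ⟨xs, hp, -, hc⟩ := hz
    obtain ⟨y, hy⟩ := h.exists_int hV' hp
    obtain ⟨c, hc'⟩ := Nat.dvd_factorial hj hjn
    have hM : (scale ts : ℚ) ≠ 0 := by exact_mod_cast (scale_pos ts).ne'
    have hzy : z = (j : ℤ) * (c * y) := by
      have : (z : ℚ) = y * n.factorial := by
        rw [div_eq_iff hM, scale] at hc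
        rw [hc, ← hy]; push_cast; ring
      rw [hc'] at this
      have h2 : (z : ℚ) = ((j : ℤ) * (c * y) : ℤ) := by rw [this]; push_cast; ring
      exact_mod_cast h2
    have hj' : (j : ℤ) ≠ 0 := by exact_mod_cast hj.ne'
    have hjQ : (j : ℚ) ≠ 0 := by exact_mod_cast hj.ne'
    rw [hzy, Int.mul_ediv_cancel_left _ hj']
    push_cast
    field_simp
  rcases hV with rfl | rfl | rfl | rfl
  · rfl
  · rfl
  · simp only [ValFun.candZ, ValFun.cand]
    rw [key (Or.inl rfl)]; ring
  · simp only [ValFun.candZ, ValFun.cand]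
    rw [key (Or.inr rfl)]; ring

end Automaton

/-! ### Programs for the tables of best paths, best cycles and top values. -/

namespace SP

/-- Entry `i` of array `av`, or `⊥` if it is not flagged in array `af`. -/
def rd (s : Store) (af av : ℕ) (i : ℤ) : WithBot ℤ := if 0 < s af i then (s av i : WithBot ℤ) else ⊥

theorem rd_congr {s s' : Store} {af av : ℕ} (h : s' af = s af) (h' : s' av = s av) (i : ℤ) :
    rd s' af av i = rd s af av i := by
  rw [rd, rd, h, h']

theorem rd_eq_coe {s : Store} {af av : ℕ} {i z : ℤ} (h : rd s af av i = z) : s av i = z := by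
  rw [rd] at h
  split_ifs at h
  · exact WithBot.coe_inj.1 h
  · exact absurd h WithBot.bot_ne_coe

/-- Raise a flagged entry to the value of an expression. -/
def updP (af av : ℕ) (i e : Exp) : SP :=
  ite (.get af i) (ite (.sub e (.get av i)) (set av i e) skip)
    (seq (set av i e) (set af i (.lit 1)))

/-- The hypothesis `hi` is there because `updP` evaluates the index again, for the flag, after the
value has been written. -/
theorem rd_updP {σ af av : ℕ} (hne : af ≠ av) {i e : Exp} {s : Store} {ι z : ℤ} (hι : i.val s = ι)
    (hz : e.val s = z) (hi : i.val (s.write av ι z) = ι) (j : ℤ) :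
    rd ((updP af av i e).eval σ s) af av j =
      if j = ι then max (rd s af av j) z else rd s af av j := by
  by_cases hf : 0 < s af ι
  · have h1 : (updP af av i e).eval σ s = if s av ι < z then s.write av ι z else s := by
      simp only [updP, eval, Exp.val, hι, hz, hf, if_true, sub_pos]
    rw [h1]
    by_cases hlt : s av ι < z
    · rw [if_pos hlt, rd, Store.write_of_ne _ hne, Store.write_self]
      split_ifs with h2 h3 h3
      · subst h3
        rw [rd, if_pos h2, max_eq_right]
        exact_mod_cast hlt.le
      · rw [rd, if_pos h2]
      · subst h3; exact absurd hf h2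
      · rw [rd, if_neg h2]
    · rw [if_neg hlt]
      split_ifs with h3
      · subst h3
        rw [rd, if_pos hf, max_eq_left]
        exact_mod_cast not_lt.1 hlt
      · rfl
  · have h1 : (updP af av i e).eval σ s = (s.write av ι z).write af ι 1 := by
      simp only [updP, eval, Exp.val, hι, hz, hf, if_false, hi]
    rw [h1, rd, Store.write_self, Store.write_of_ne _ hne.symm, Store.write_self,
      Store.write_of_ne _ hne]
    by_cases hj : j = ι
    · subst hj
      rw [if_pos rfl, if_pos rfl, if_pos rfl, if_pos zero_lt_one, rd, if_neg hf]
      simp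
    · rw [if_neg hj, if_neg hj, if_neg hj, rd]

/-- The place of the value of the best path of length `k` from `u` to `v`. -/
def ixE (σ : ℕ) (u k v : Exp) : Exp :=
  .add (.mul (.add (.mul u (.add (.get σ (.lit 1)) (.lit 1))) k) (.get σ (.lit 1))) v

/-- The value of `ixE`. -/
def ix (n u k v : ℕ) : ℤ := ((u * (n + 1) + k) * n + v : ℕ)

/-- Mixed radix again, with `n + 1` possible lengths `0, …, n` and `n` possible end states. -/
theorem ix_inj {n u u' k k' v v' : ℕ} (hk : k ≤ n) (hk' : k' ≤ n) (hv : v < n) (hv' : v' < n)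
    (h : ix n u k v = ix n u' k' v') : u = u' ∧ k = k' ∧ v = v' := by
  have h' : (u * (n + 1) + k) * n + v = (u' * (n + 1) + k') * n + v' := by
    unfold ix at h; exact_mod_cast h
  have hn : 0 < n := by omega
  have e1 : u * (n + 1) + k = u' * (n + 1) + k' := by
    have := congrArg (· / n) h'
    simpa [mul_comm _ n, Nat.mul_add_div hn, Nat.div_eq_of_lt hv, Nat.div_eq_of_lt hv'] using this
  have e2 : v = v' := by rw [e1] at h'; omega
  have e3 : u = u' := by
    have := congrArg (· / (n + 1)) e1
    simpa [mul_comm _ (n + 1), Nat.mul_add_div (Nat.succ_pos n),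
      Nat.div_eq_of_lt (Nat.lt_succ_of_le hk), Nat.div_eq_of_lt (Nat.lt_succ_of_le hk')] using this
  subst e3
  exact ⟨rfl, by omega, e2⟩

/-- Compute `ValFun.combZ` for the length in counter `1`, the value `d` and the weight in array `6`
at counter `2`. -/
def combP (V : ValFun) (d : Exp) : SP :=
  match V with
  | .limInf => seq (set 9 (.lit 0) (.get 6 (ctr 2)))
      (ite (ctr 1) (ite (.sub (.get 6 (ctr 2)) d) (set 9 (.lit 0) d) skip) skip)
  | .limSup => seq (set 9 (.lit 0) (.get 6 (ctr 2)))
      (ite (ctr 1) (ite (.sub d (.get 6 (ctr 2))) (set 9 (.lit 0) d) skip) skip)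
  | _ => set 9 (.lit 0) (.add d (.get 6 (ctr 2)))

/-- The expression for `ValFun.candZ`. -/
def candE (V : ValFun) (k d : Exp) : Exp :=
  match V with
  | .limInf => d
  | .limSup => d
  | _ => .div d k

/-- Extend paths by a transition. -/
def edgeP (V : ValFun) (σ : ℕ) : SP :=
  ite (.get 7 (ixE σ (ctr 0) (ctr 1) (fld σ (ctr 2) 4)))
    (seq (combP V (.get 8 (ixE σ (ctr 0) (ctr 1) (fld σ (ctr 2) 4))))
      (updP 7 8 (ixE σ (ctr 0) (.add (ctr 1) (.lit 1)) (fld σ (ctr 2) 8)) (.get 9 (.lit 0)))) skip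

/-- Compute the values of paths that are longer by one, and evaluate cycles. -/
def levelP (V : ValFun) (σ : ℕ) : SP :=
  seq (rep 2 3 (edgeP V σ))
    (ite (.get 7 (ixE σ (ctr 0) (.add (ctr 1) (.lit 1)) (ctr 0)))
      (updP 10 11 (ctr 0) (candE V (.add (ctr 1) (.lit 1))
        (.get 8 (ixE σ (ctr 0) (.add (ctr 1) (.lit 1)) (ctr 0))))) skip)

/-- Evaluate the cycles through a state. -/
def sourceP (V : ValFun) (σ : ℕ) : SP :=
  seq (set 8 (ixE σ (ctr 0) (.lit 0) (ctr 0)) (.lit 0))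
    (seq (set 7 (ixE σ (ctr 0) (.lit 0) (ctr 0)) (.lit 1)) (rep 1 1 (levelP V σ)))

/-- Evaluate the cycles through all states. -/
def cyclesP (V : ValFun) (σ : ℕ) : SP := rep 0 1 (sourceP V σ)

/-- Propagate the values of cycles along the transitions. -/
def propP (σ : ℕ) : SP :=
  rep 0 1 (rep 1 3 (ite (.get 10 (fld σ (ctr 1) 8))
    (updP 10 11 (fld σ (ctr 1) 4) (.get 11 (fld σ (ctr 1) 8))) skip))

theorem wf_cyclesP {σ : ℕ} (hσ : σ = 0 ∨ σ = 3) (V : ValFun) : (cyclesP V σ).Wf σ := by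
  rcases hσ with rfl | rfl <;> cases V <;>
    simp [cyclesP, sourceP, levelP, edgeP, combP, updP, candE, ixE, Wf, Exp.Ok, Exp.Small, fld, ctr,
      counters]

theorem wf_propP {σ : ℕ} (hσ : σ = 0 ∨ σ = 3) : (propP σ).Wf σ := by
  rcases hσ with rfl | rfl <;> simp [propP, updP, Wf, Exp.Ok, Exp.Small, fld, ctr, counters]

theorem writes_combP (V : ValFun) (d : Exp) {a : ℕ} (h : a ≠ 9) : a ∉ (combP V d).writes := by
  cases V <;> simp [combP, writes, h]

theorem combP_spec (V : ValFun) (σ : ℕ) {d : Exp} {s : Store} {k : ℕ} {dz wz : ℤ}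
    (hk : s 2 1 = k) (hw : s 6 (s 2 2) = wz) (hd : d.val s = dz)
    (hd' : ∀ z, d.val (s.write 9 0 z) = dz) :
    (combP V d).eval σ s 9 0 = V.combZ k dz wz := by
  have e1 : (set 9 (.lit 0) (.get 6 (ctr 2))).eval σ s = s.write 9 0 wz := by
    simp [eval, Exp.val, ctr, hw]
  have e2 : (ctr 1).val (s.write 9 0 wz) = k := by
    simp [ctr, Exp.val, Store.write_of_ne, hk]
  have e3 : (Exp.get 6 (ctr 2)).val (s.write 9 0 wz) = wz := by
    simp [ctr, Exp.val, Store.write_of_ne, hw]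
  have e4 : (set 9 (.lit 0) d).eval σ (s.write 9 0 wz) 9 0 = dz := by
    simp [eval, Exp.val, Store.write_self, hd']
  have e5 : s.write 9 0 wz 9 0 = wz := Store.write_same _ _ _ _
  have e6 : (k : ℤ) > 0 ↔ k ≠ 0 := by rw [gt_iff_lt, Nat.cast_pos, Nat.pos_iff_ne_zero]
  cases V
  case limInf =>
    have e7 : (Exp.sub (.get 6 (ctr 2)) d).val (s.write 9 0 wz) = wz - dz := by
      rw [Exp.val, e3, hd']
    rw [combP, eval_seq, e1, eval_ite, eval_ite, e2, e7, ValFun.combZ]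
    by_cases h0 : k = 0
    · rw [if_pos h0, if_neg (by rw [h0]; simp)]; exact e5
    · rw [if_neg h0, if_pos (e6.2 h0)]
      split_ifs with h
      · rw [e4, min_eq_left (by omega)]
      · rw [min_eq_right (by omega)]; exact e5
  case limSup =>
    have e7 : (Exp.sub d (.get 6 (ctr 2))).val (s.write 9 0 wz) = dz - wz := by
      rw [Exp.val, e3, hd']
    rw [combP, eval_seq, e1, eval_ite, eval_ite, e2, e7, ValFun.combZ]
    by_cases h0 : k = 0
    · rw [if_pos h0, if_neg (by rw [h0]; simp)]; exact e5
    · rw [if_neg h0, if_pos (e6.2 h0)]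
      split_ifs with h
      · rw [e4, max_eq_left (by omega)]
      · rw [max_eq_right (by omega)]; exact e5
  all_goals
    simp [combP, eval, Exp.val, ctr, ValFun.combZ, hw, hd, Store.write_self]

theorem candE_val (V : ValFun) {k d : Exp} {s : Store} {j : ℕ} {z : ℤ} (hk : k.val s = j)
    (hd : d.val s = z) : (candE V k d).val s = V.candZ j z := by
  cases V <;> simp [candE, ValFun.candZ, Exp.val, hk, hd]

section

variable {m n σ : ℕ} {q₀ : Fin n} {ts : Trans m n} {A : Automaton (Fin m) (Fin n)}

theorem ixE_val {u k v : Exp} {s : Store} {u' k' v' : ℕ} (h : s σ 1 = n) (hu : u.val s = u')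
    (hk : k.val s = k') (hv : v.val s = v') : (ixE σ u k v).val s = ix n u' k' v' := by
  simp only [ixE, Exp.val, h, hu, hk, hv, ix]
  push_cast
  ring

/-- After some transitions have been processed, the entries at length `k + 1` are the best values of
paths whose last transition is among them. The entries at length `k` stay intact meanwhile, as they
lie at other places of the table. -/
theorem edgeP_spec {V : ValFun} (hσ : σ = 0 ∨ σ = 3) (hA : A.Lists ts) {M : ℚ} (hM : 0 < M)
    {s : Store} (h : Holds (s σ) q₀ ts)
    (hW : ∀ t (ht : t < ts.length), (s 6 t : ℚ) / M = ts[t].2.2.1) {u : Fin n} {k : ℕ} (hk : k < n)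
    (hu : s 2 0 = (u : ℕ)) (hk1 : s 2 1 = k)
    (hlev : ∀ v : Fin n, IsTop M (rd s 7 8 (ix n u k v)) (A.walks V k u v))
    (hbot : ∀ v : Fin n, rd s 7 8 (ix n u (k + 1) v) = ⊥) :
    (∀ v : Fin n, IsTop M (rd ((rep 2 3 (edgeP V σ)).eval σ s) 7 8 (ix n u (k + 1) v))
      (A.walks V (k + 1) u v)) ∧
    ∀ j, (∀ v : Fin n, j ≠ ix n u (k + 1) v) →
      rd ((rep 2 3 (edgeP V σ)).eval σ s) 7 8 j = rd s 7 8 j := by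
  have hwf := (wf_cyclesP hσ V).2.2.2.2.2.2.1.2.2
  have h1 := rep_induction (σ := σ) (c := 2) (j := 3) (s := s) (P := edgeP V σ) hwf
    (fun i s' => (∀ v : Fin n, IsTop M (rd s' 7 8 (ix n u (k + 1) v))
      {c | ∃ t ∈ ts.take i, t.2.2.2 = v ∧ ∃ d ∈ A.walks V k u t.1, c = V.comb k d t.2.2.1}) ∧
      ∀ j, (∀ v : Fin n, j ≠ ix n u (k + 1) v) → rd s' 7 8 j = rd s 7 8 j)
    ⟨fun v => by
      rw [rd_congr (s := s) (Store.write_of_ne _ (by decide) _ _)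
        (Store.write_of_ne _ (by decide) _ _), hbot]
      exact isTop_bot (by simp),
    fun j _ => rd_congr (Store.write_of_ne _ (by decide) _ _)
        (Store.write_of_ne _ (by decide) _ _) j⟩
    (fun i hi s' hf hfc hc ⟨hI1, hI2⟩ => by
      rw [Nat.cast_ofNat, h.len, Int.toNat_natCast] at hi
      have hwr : ∀ a, a ≠ 2 → a ≠ 7 → a ≠ 8 → a ≠ 9 → s' a = s a := fun a h2 h7 h8 h9 =>
        hf a h2 (by
          have := writes_combP V (.get 8 (ixE σ (ctr 0) (ctr 1) (fld σ (ctr 2) 4))) h9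
          simp [edgeP, writes, updP, this, h7, h8])
      have hin : s' σ = s σ := by
        rcases hσ with rfl | rfl <;> exact hwr _ (by decide) (by decide) (by decide) (by decide)
      have h6 : s' 6 = s 6 := hwr 6 (by decide) (by decide) (by decide) (by decide)
      have hcnt : ∀ d : ℕ, d ≠ 2 → s' 2 d = s 2 d := fun d hd => hfc d hd (by
        cases V <;> simp [edgeP, combP, updP, counters])
      have hu' : s' 2 0 = (u : ℕ) := (hcnt 0 (by decide)).trans hu
      have hk' : s' 2 1 = k := (hcnt 1 (by decide)).trans hk1
      simp only [Nat.cast_ofNat] at hc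
      have hsrc := h.src i hi
      have hdst := h.dst i hi
      have hWi := hW i hi
      rw [List.take_succ_eq_append_getElem hi]
      generalize ts[i] = τ at hsrc hdst hWi
      obtain ⟨p, a, x, q⟩ := τ
      simp only at hsrc hdst hWi
      simp only [rd_congr (Store.write_of_ne _ (show 7 ≠ 2 by decide) _ _)
        (Store.write_of_ne _ (show 8 ≠ 2 by decide) _ _)]
      have hst : s σ 1 = n := h.states
      have hix1 : ∀ s'' : Store, s'' 2 = s' 2 → s'' σ = s σ →
          (ixE σ (ctr 0) (ctr 1) (fld σ (ctr 2) 4)).val s'' = ix n u k p := by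
        intro s'' e2 eσ
        refine ixE_val (by rw [eσ, hst]) ?_ ?_ ?_
        · simp [ctr, Exp.val, e2, hu']
        · simp [ctr, Exp.val, e2, hk']
        · simp [ctr, fld, Exp.val, e2, eσ, hc, hsrc]
      have hix2 : ∀ s'' : Store, s'' 2 = s' 2 → s'' σ = s σ →
          (ixE σ (ctr 0) (.add (ctr 1) (.lit 1)) (fld σ (ctr 2) 8)).val s'' = ix n u (k + 1) q := by
        intro s'' e2 eσ
        refine ixE_val (by rw [eσ, hst]) ?_ ?_ ?_
        · simp [ctr, Exp.val, e2, hu']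
        · simp [ctr, Exp.val, e2, hk']
        · simp [ctr, fld, Exp.val, e2, eσ, hc, hdst]
      have hne : ∀ v : Fin n, ix n u k p ≠ ix n u (k + 1) v := fun v hv => by
        have := (ix_inj hk.le hk p.2 v.2 hv).2.1
        omega
      have hp : IsTop M (rd s' 7 8 (ix n u k p)) (A.walks V k u p) := by
        rw [hI2 _ hne]; exact hlev p
      rw [edgeP, eval_ite, Exp.val, hix1 s' rfl hin]
      by_cases hpos : 0 < s' 7 (ix n u k p)
      · rw [if_pos hpos, eval_seq]
        have hσ9 : σ ≠ 9 := by omega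
        have hσ8 : σ ≠ 8 := by omega
        rw [rd, if_pos hpos] at hp
        set dz := s' 8 (ix n u k p) with hdz
        have hcomb := combP_spec V σ (s := s') (k := k) (dz := dz) (wz := s 6 i)
          (d := .get 8 (ixE σ (ctr 0) (ctr 1) (fld σ (ctr 2) 4))) hk' (by rw [hc, h6])
          (by rw [Exp.val, hix1 s' rfl hin])
          (fun z => by
            rw [Exp.val, hix1 _ (Store.write_of_ne _ (by decide) _ _)
              ((Store.write_of_ne _ hσ9 _ _).trans hin), Store.write_of_ne _ (by decide)])
        have hfr := fun a (ha : a ≠ 9) => eval_frame σ (a := a) _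
          (writes_combP V (.get 8 (ixE σ (ctr 0) (ctr 1) (fld σ (ctr 2) 4))) ha) s'
        generalize SP.eval σ (combP V _) s' = s₁ at hcomb hfr
        have hs1σ : s₁ σ = s σ := (hfr σ hσ9).trans hin
        have hupd := rd_updP (σ := σ) (show 7 ≠ 8 by decide) (s := s₁) (e := .get 9 (.lit 0))
          (hix2 s₁ (hfr 2 (by decide)) hs1σ) hcomb
          (hix2 _ ((Store.write_of_ne _ (by decide) _ _).trans (hfr 2 (by decide)))
            ((Store.write_of_ne _ hσ8 _ _).trans hs1σ))
        simp only [rd_congr (hfr 7 (by decide)) (hfr 8 (by decide))] at hupd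
        constructor
        · intro v
          rw [hupd]
          have hval : ((V.combZ k dz (s 6 i) : ℤ) : ℚ) / M = V.comb k (dz / M) x := by
            rw [combZ_div hM, hWi]
          by_cases hqv : q = v
          · subst hqv
            rw [if_pos rfl]
            refine (hI1 q).union hM (hp.map (comb_mono V k x) hval (fun c => Iff.rfl)) fun c => ?_
            simp only [Set.mem_ofPred_eq, List.mem_append, List.mem_singleton]
            constructor
            · rintro ⟨t, ht | rfl, h1, h2⟩
              · exact Or.inl ⟨t, ht, h1, h2⟩
              · exact Or.inr h2
            · rintro (⟨t, ht, h1, h2⟩ | h2)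
              · exact ⟨t, Or.inl ht, h1, h2⟩
              · exact ⟨_, Or.inr rfl, rfl, h2⟩
          · rw [if_neg fun hh => hqv (Fin.ext (ix_inj hk hk v.2 q.2 hh).2.2.symm)]
            refine (hI1 v).congr fun c => ?_
            simp only [Set.mem_ofPred_eq, List.mem_append, List.mem_singleton]
            constructor
            · rintro ⟨t, ht | rfl, h1, h2⟩
              · exact ⟨t, ht, h1, h2⟩
              · exact absurd h1 hqv
            · rintro ⟨t, ht, h1, h2⟩
              exact ⟨t, Or.inl ht, h1, h2⟩
        · intro j hj
          rw [hupd, if_neg (hj q), hI2 j hj]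
      · rw [if_neg hpos, eval]
        rw [rd, if_neg hpos] at hp
        refine ⟨fun v => (hI1 v).congr fun c => ?_, hI2⟩
        simp only [Set.mem_ofPred_eq, List.mem_append, List.mem_singleton]
        constructor
        · rintro ⟨t, ht | rfl, h1, d, h2, h3⟩
          · exact ⟨t, ht, h1, d, h2, h3⟩
          · exact absurd h2 (hp.notMem d)
        · rintro ⟨t, ht, h1, h2⟩
          exact ⟨t, Or.inl ht, h1, h2⟩)
  rw [Nat.cast_ofNat, h.len, Int.toNat_natCast, List.take_length] at h1
  refine ⟨fun v => (h1.1 v).congr fun c => ?_, h1.2⟩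
  rw [Automaton.mem_walks_succ]
  constructor
  · rintro ⟨p, x, e, hd⟩
    obtain ⟨a, ha⟩ := hA.edge_iff.1 e
    exact ⟨_, ha, rfl, hd⟩
  · rintro ⟨⟨p, a, x, q⟩, ht, rfl, hd⟩
    exact ⟨p, x, hA.edge_iff.2 ⟨a, ht⟩, hd⟩

end

end SP

namespace SP

variable {m n σ : ℕ} {q₀ : Fin n} {ts : Trans m n} {A : Automaton (Fin m) (Fin n)}

/-- Places for longer paths or for paths from later states are empty. -/
def Fresh (n : ℕ) (s : Store) (u k : ℕ) : Prop :=
  ∀ u' k' (v : Fin n), k' ≤ n → (u < u' ∨ u' = u ∧ k < k') → rd s 7 8 (ix n u' k' v) = ⊥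

/-- The diagonal entry at length `k + 1` belongs to the best closed path of this length through `u`.
Since `cand` is monotone in the path value, this entry alone decides how the best cycle value
changes. -/
theorem levelP_spec {V : ValFun} (hV : V.Tail) (hσ : σ = 0 ∨ σ = 3) (hA : A.Lists ts)
    {s : Store} (h : Holds (s σ) q₀ ts)
    (hW : ∀ t (ht : t < ts.length), (s 6 t : ℚ) / scale ts = ts[t].2.2.1) {u : Fin n} {k : ℕ}
    (hk : k < n) (hu : s 2 0 = (u : ℕ)) (hk1 : s 2 1 = k)
    (hlev : ∀ v : Fin n, IsTop (scale ts) (rd s 7 8 (ix n u k v)) (A.walks V k u v))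
    (hfresh : Fresh n s u k)
    (hbest : IsTop (scale ts) (rd s 10 11 (u : ℕ)) (A.cyclesAt V k u)) :
    (∀ v : Fin n, IsTop (scale ts) (rd ((levelP V σ).eval σ s) 7 8 (ix n u (k + 1) v))
      (A.walks V (k + 1) u v)) ∧
    Fresh n ((levelP V σ).eval σ s) u (k + 1) ∧
    IsTop (scale ts) (rd ((levelP V σ).eval σ s) 10 11 (u : ℕ)) (A.cyclesAt V (k + 1) u) ∧
    ∀ j, j ≠ ((u : ℕ) : ℤ) → rd ((levelP V σ).eval σ s) 10 11 j = rd s 10 11 j := by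
  have hM : (0 : ℚ) < scale ts := by exact_mod_cast scale_pos ts
  have hwf := (wf_cyclesP hσ V).2.2.2.2.2.2.1
  obtain ⟨h1, h2⟩ := edgeP_spec hσ hA hM h hW hk hu hk1 hlev
    (fun v => hfresh u (k + 1) v hk (Or.inr ⟨rfl, Nat.lt_succ_self k⟩))
  rw [levelP, eval_seq]
  have hfr : ∀ a, a ≠ 2 → a ≠ 7 → a ≠ 8 → a ≠ 9 → (rep 2 3 (edgeP V σ)).eval σ s a = s a :=
    fun a h2 h7 h8 h9 => eval_frame σ _ (by
      have := writes_combP V (.get 8 (ixE σ (ctr 0) (ctr 1) (fld σ (ctr 2) 4))) h9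
      simp [edgeP, writes, updP, this, h7, h8, h2]) s
  have hcn : ∀ d : ℕ, d ≠ 2 → (rep 2 3 (edgeP V σ)).eval σ s 2 d = s 2 d :=
    fun d hd => eval_counter hwf (by cases V <;> simp [edgeP, combP, updP, counters, hd]) s
  generalize (rep 2 3 (edgeP V σ)).eval σ s = s₁ at *
  have hin : s₁ σ = s σ := by
    rcases hσ with rfl | rfl <;> exact hfr _ (by decide) (by decide) (by decide) (by decide)
  have h10 : ∀ j, rd s₁ 10 11 j = rd s 10 11 j :=
    rd_congr (hfr _ (by decide) (by decide) (by decide) (by decide))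
      (hfr _ (by decide) (by decide) (by decide) (by decide))
  have hu' : s₁ 2 0 = (u : ℕ) := (hcn 0 (by decide)).trans hu
  have hk' : s₁ 2 1 = k := (hcn 1 (by decide)).trans hk1
  have hix : (ixE σ (ctr 0) (.add (ctr 1) (.lit 1)) (ctr 0)).val s₁ = ix n u (k + 1) u :=
    ixE_val (by rw [hin, h.states]) (by simp [ctr, Exp.val, hu']) (by simp [ctr, Exp.val, hk'])
      (by simp [ctr, Exp.val, hu'])
  have hfresh1 : Fresh n s₁ u (k + 1) := by
    intro u' k' v hk'n hcase
    rw [h2 _ fun v' hv' => ?_]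
    · exact hfresh u' k' v hk'n (by omega)
    · have := ix_inj hk'n hk v.2 v'.2 hv'
      omega
  have hwu := h1 u
  rw [eval_ite, Exp.val, hix]
  by_cases hpos : 0 < s₁ 7 (ix n u (k + 1) u)
  · rw [if_pos hpos]
    rw [rd, if_pos hpos] at hwu
    have hu0 : ∀ s'' : Store, s'' 2 = s₁ 2 → (ctr 0).val s'' = (u : ℕ) := fun s'' e => by
      simp [ctr, Exp.val, e, hu']
    have hupd := rd_updP (σ := σ) (show 10 ≠ 11 by decide) (s := s₁)
      (e := candE V (.add (ctr 1) (.lit 1))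
        (.get 8 (ixE σ (ctr 0) (.add (ctr 1) (.lit 1)) (ctr 0))))
      (hu0 s₁ rfl) (candE_val V (j := k + 1) (by simp [ctr, Exp.val, hk']) (by rw [Exp.val, hix]))
      (hu0 _ (Store.write_of_ne _ (by decide) _ _))
    have hfr2 : ∀ a, a ≠ 10 → a ≠ 11 → (updP 10 11 (ctr 0) (candE V (.add (ctr 1) (.lit 1))
        (.get 8 (ixE σ (ctr 0) (.add (ctr 1) (.lit 1)) (ctr 0))))).eval σ s₁ a = s₁ a :=
      fun a h10 h11 => eval_frame σ _ (by simp [updP, writes, h10, h11]) s₁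
    generalize SP.eval σ _ s₁ = s₂ at hupd hfr2
    have h78 : ∀ j, rd s₂ 7 8 j = rd s₁ 7 8 j :=
      rd_congr (hfr2 _ (by decide) (by decide)) (hfr2 _ (by decide) (by decide))
    refine ⟨fun v => by rw [h78]; exact h1 v,
      fun u' k' v hk'n hc => by rw [h78]; exact hfresh1 u' k' v hk'n hc, ?_,
      fun j hj => by rw [hupd, if_neg hj, h10]⟩
    rw [hupd, if_pos rfl, h10]
    refine hbest.union hM (hwu.map (cand_mono V (k + 1)) ?_ fun c => Iff.rfl) fun c =>
      Automaton.mem_cyclesAt_succ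
    exact hA.candZ_div hV (Nat.succ_pos k) hk (hwu.1 _ rfl)
  · rw [if_neg hpos, eval]
    rw [rd, if_neg hpos] at hwu
    refine ⟨h1, hfresh1, ?_, fun j _ => h10 j⟩
    rw [h10]
    refine hbest.congr fun c => ?_
    rw [Automaton.mem_cyclesAt_succ]
    exact or_iff_left fun ⟨d, hd, _⟩ => hwu.notMem d hd

theorem writes_levelP (V : ValFun) {a : ℕ} (h2 : a ≠ 2) (h7 : a ≠ 7) (h8 : a ≠ 8)
    (h9 : a ≠ 9) (h10 : a ≠ 10) (h11 : a ≠ 11) : a ∉ (levelP V σ).writes := by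
  have := writes_combP V (.get 8 (ixE σ (ctr 0) (ctr 1) (fld σ (ctr 2) 4))) h9
  simp [levelP, edgeP, writes, updP, this, h7, h8, h2, h10, h11]

/-- At length `0` there is only the empty path from `u` to itself, of value `0`, so the table starts
with one flagged place for this source. All sources share the table, hence the claims about the
emptiness of the places of later ones. -/
theorem sourceP_spec {V : ValFun} (hV : V.Tail) (hσ : σ = 0 ∨ σ = 3) (hA : A.Lists ts)
    {s : Store} (h : Holds (s σ) q₀ ts)
    (hW : ∀ t (ht : t < ts.length), (s 6 t : ℚ) / scale ts = ts[t].2.2.1) {u : Fin n}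
    (hu : s 2 0 = (u : ℕ))
    (hfresh : ∀ u' k' (v : Fin n), k' ≤ n → (u : ℕ) ≤ u' → rd s 7 8 (ix n u' k' v) = ⊥)
    (hbest : rd s 10 11 (u : ℕ) = ⊥) :
    (∀ u' k' (v : Fin n), k' ≤ n → (u : ℕ) < u' →
      rd ((sourceP V σ).eval σ s) 7 8 (ix n u' k' v) = ⊥) ∧
    IsTop (scale ts) (rd ((sourceP V σ).eval σ s) 10 11 (u : ℕ)) (A.cyclesAt V n u) ∧
    ∀ j, j ≠ ((u : ℕ) : ℤ) → rd ((sourceP V σ).eval σ s) 10 11 j = rd s 10 11 j := by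
  have hwf := (wf_cyclesP hσ V).2.2.2.2
  have hσ7 : σ ≠ 7 := by omega
  have hσ8 : σ ≠ 8 := by omega
  rw [sourceP, eval_seq, eval_seq]
  have hix : ∀ s'' : Store, s'' 2 = s 2 → s'' σ = s σ →
      (ixE σ (ctr 0) (.lit 0) (ctr 0)).val s'' = ix n u 0 u := fun s'' e2 eσ =>
    ixE_val (by rw [eσ, h.states]) (by simp [ctr, Exp.val, e2, hu]) (by simp [Exp.val])
      (by simp [ctr, Exp.val, e2, hu])
  have e1 : (set 8 (ixE σ (ctr 0) (.lit 0) (ctr 0)) (.lit 0)).eval σ s =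
      s.write 8 (ix n u 0 u) 0 := by
    rw [eval, hix s rfl rfl, Exp.val]
  have e2 : (set 7 (ixE σ (ctr 0) (.lit 0) (ctr 0)) (.lit 1)).eval σ (s.write 8 (ix n u 0 u) 0) =
      (s.write 8 (ix n u 0 u) 0).write 7 (ix n u 0 u) 1 := by
    rw [eval, hix _ (Store.write_of_ne _ (by decide) _ _) (Store.write_of_ne _ hσ8 _ _), Exp.val]
  rw [e1, e2]
  set s₁ := (s.write 8 (ix n u 0 u) 0).write 7 (ix n u 0 u) 1 with hs₁
  have hfr : ∀ a, a ≠ 7 → a ≠ 8 → s₁ a = s a := fun a h7 h8 => by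
    rw [hs₁, Store.write_of_ne _ h7, Store.write_of_ne _ h8]
  have h1 : ∀ j, rd s₁ 7 8 j = if j = ix n u 0 u then ((0 : ℤ) : WithBot ℤ) else rd s 7 8 j := by
    intro j
    rw [rd, hs₁, Store.write_self, Store.write_of_ne _ (show 7 ≠ 8 by decide),
      Store.write_of_ne _ (show 8 ≠ 7 by decide), Store.write_self]
    by_cases hj : j = ix n u 0 u
    · rw [if_pos hj, if_pos hj, if_pos hj, if_pos zero_lt_one]
    · rw [if_neg hj, if_neg hj, if_neg hj, rd]
  have hσs₁ : s₁ σ = s σ := hfr σ hσ7 hσ8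
  have hind := rep_induction (σ := σ) (c := 1) (j := 1) (s := s₁) (P := levelP V σ) hwf.2.2
    (fun k s' => (∀ v : Fin n, IsTop (scale ts) (rd s' 7 8 (ix n u k v)) (A.walks V k u v)) ∧
      Fresh n s' u k ∧ IsTop (scale ts) (rd s' 10 11 (u : ℕ)) (A.cyclesAt V k u) ∧
      ∀ j, j ≠ ((u : ℕ) : ℤ) → rd s' 10 11 j = rd s 10 11 j)
    (by
      simp only [Fresh, rd_congr (Store.write_of_ne _ (show 7 ≠ 2 by decide) _ _)
        (Store.write_of_ne _ (show 8 ≠ 2 by decide) _ _),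
        rd_congr (Store.write_of_ne _ (show 10 ≠ 2 by decide) _ _)
        (Store.write_of_ne _ (show 11 ≠ 2 by decide) _ _),
        rd_congr (hfr 10 (by decide) (by decide)) (hfr 11 (by decide) (by decide))]
      refine ⟨fun v => ?_, fun u' k' v hk' hc => ?_, ?_, fun _ _ => trivial⟩
      · rw [h1]
        by_cases huv : u = v
        · subst huv
          rw [if_pos rfl]
          refine ⟨fun z hz => ?_, fun c hc => ?_⟩
          · rw [← WithBot.coe_inj.1 hz, Automaton.mem_walks_zero]; simp
          · rw [(Automaton.mem_walks_zero.1 hc).2]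
            exact ⟨0, rfl, by simp⟩
        · rw [if_neg fun hh => huv (Fin.ext (ix_inj (Nat.zero_le _) (Nat.zero_le _) v.2 u.2 hh).2.2.symm),
            hfresh u 0 v (Nat.zero_le _) le_rfl]
          exact isTop_bot fun c hc => huv (Automaton.mem_walks_zero.1 hc).1
      · rw [h1, if_neg fun hh => ?_]
        · exact hfresh u' k' v hk' (by omega)
        · have := ix_inj hk' (Nat.zero_le _) v.2 u.2 hh
          omega
      · rw [hbest]
        refine isTop_bot ?_
        rintro c ⟨j, h0, hj, -⟩
        omega)
    (fun i hi s' hf hfc hc ⟨hI1, hI2, hI3, hI4⟩ => by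
      rw [hσs₁, Nat.cast_one, h.states, Int.toNat_natCast] at hi
      have hin : s' σ = s σ := (by
        rcases hσ with rfl | rfl <;> exact hf _ (by decide) (writes_levelP V (by decide) (by decide)
          (by decide) (by decide) (by decide) (by decide)) : s' σ = s₁ σ).trans hσs₁
      have h6 : s' 6 = s 6 := (hf 6 (by decide) (writes_levelP V (by decide) (by decide)
          (by decide) (by decide) (by decide) (by decide))).trans (hfr 6 (by decide) (by decide))
      have hu' : s' 2 0 = (u : ℕ) := by
        have := hfc 0 (by decide) (by cases V <;> simp [levelP, edgeP, combP, updP, counters])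
        rw [Nat.cast_zero] at this
        rw [this, hfr 2 (by decide) (by decide), hu]
      simp only [Nat.cast_one] at hc
      have := levelP_spec hV hσ hA (s := s') (by rw [hin]; exact h) (by rw [h6]; exact hW) hi hu' hc
        hI1 hI2 hI3
      simp only [Fresh, rd_congr (Store.write_of_ne _ (show 7 ≠ 2 by decide) _ _)
        (Store.write_of_ne _ (show 8 ≠ 2 by decide) _ _),
        rd_congr (Store.write_of_ne _ (show 10 ≠ 2 by decide) _ _)
        (Store.write_of_ne _ (show 11 ≠ 2 by decide) _ _)]
      exact ⟨this.1, this.2.1, this.2.2.1, fun j hj => (this.2.2.2 j hj).trans (hI4 j hj)⟩)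
  rw [hσs₁, Nat.cast_one, h.states, Int.toNat_natCast] at hind
  exact ⟨fun u' k' v hk' hu' => hind.2.1 u' k' v hk' (Or.inl hu'), hind.2.2⟩

theorem cyclesP_spec {V : ValFun} (hV : V.Tail) (hσ : σ = 0 ∨ σ = 3) (hA : A.Lists ts)
    {s : Store} (h : Holds (s σ) q₀ ts)
    (hW : ∀ t (ht : t < ts.length), (s 6 t : ℚ) / scale ts = ts[t].2.2.1)
    (h7 : ∀ i, s 7 i = 0) (h10 : ∀ i, s 10 i = 0) (u : Fin n) :
    IsTop (scale ts) (rd ((cyclesP V σ).eval σ s) 10 11 (u : ℕ)) (A.cyclesAt V n u) := by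
  have hwf := wf_cyclesP hσ V
  have hind := rep_induction (σ := σ) (c := 0) (j := 1) (s := s) (P := sourceP V σ) hwf.2.2
    (fun i s' => (∀ u' k' (v : Fin n), k' ≤ n → i ≤ u' → rd s' 7 8 (ix n u' k' v) = ⊥) ∧
      (∀ u : Fin n, (u : ℕ) < i →
        IsTop (scale ts) (rd s' 10 11 (u : ℕ)) (A.cyclesAt V n u)) ∧
      ∀ u : Fin n, i ≤ u → rd s' 10 11 (u : ℕ) = ⊥)
    (by
      refine ⟨fun _ _ _ _ _ => ?_, fun _ hu => absurd hu (Nat.not_lt_zero _), fun _ _ => ?_⟩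
      · simp [rd, Store.write_of_ne, h7]
      · simp [rd, Store.write_of_ne, h10])
    (fun i hi s' hf hfc hc ⟨hI1, hI2, hI3⟩ => by
      rw [Nat.cast_one, h.states, Int.toNat_natCast] at hi
      have hwr : ∀ a, a ≠ 2 → a ≠ 7 → a ≠ 8 → a ≠ 9 → a ≠ 10 → a ≠ 11 → s' a = s a :=
        fun a h2 h7 h8 h9 h10 h11 => hf a h2 (by
          have := writes_levelP (σ := σ) V h2 h7 h8 h9 h10 h11
          simp [sourceP, writes, this, h7, h8, h2])
      have hin : s' σ = s σ := by
        rcases hσ with rfl | rfl <;> exact hwr _ (by decide) (by decide) (by decide) (by decide)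
          (by decide) (by decide)
      have h6 : s' 6 = s 6 := hwr _ (by decide) (by decide) (by decide) (by decide)
          (by decide) (by decide)
      simp only [Nat.cast_zero] at hc
      have := sourceP_spec hV hσ hA (s := s') (u := ⟨i, hi⟩) (by rw [hin]; exact h)
        (by rw [h6]; exact hW) hc hI1 (hI3 ⟨i, hi⟩ le_rfl)
      simp only [rd_congr (Store.write_of_ne _ (show 7 ≠ 2 by decide) _ _)
        (Store.write_of_ne _ (show 8 ≠ 2 by decide) _ _),
        rd_congr (Store.write_of_ne _ (show 10 ≠ 2 by decide) _ _)
        (Store.write_of_ne _ (show 11 ≠ 2 by decide) _ _)]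
      refine ⟨fun u' k' v hk' hu' => this.1 u' k' v hk' hu', fun u hu => ?_, fun u hu => ?_⟩
      · rcases (Nat.lt_succ_iff.1 hu).lt_or_eq with hlt | heq
        · rw [this.2.2 _ (by simpa using hlt.ne)]
          exact hI2 u hlt
        · obtain rfl : u = ⟨i, hi⟩ := Fin.ext heq
          exact this.2.1
      · rw [this.2.2 _ (by simp; omega)]
        exact hI3 u (by omega))
  rw [Nat.cast_one, h.states, Int.toNat_natCast] at hind
  exact hind.2.1 u u.2

/-- Values are updated in place, so one round may carry a value along several transitions and the
entries have no exact description. After `r` rounds they bound the cycles within `r` steps and are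
values of some reachable cycles. After `n` rounds the two sets agree, because reachable states are
reached by simple paths. -/
theorem propP_spec {V : ValFun} (hσ : σ = 0 ∨ σ = 3) (hA : A.Lists ts)
    {s : Store} (h : Holds (s σ) q₀ ts)
    (hs : ∀ u : Fin n, IsTop (scale ts) (rd s 10 11 (u : ℕ)) (A.cyclesAt V n u)) (q : Fin n) :
    IsTop (scale ts) (rd ((propP σ).eval σ s) 10 11 (q : ℕ)) (A.cycleValues V q) := by
  have hM : (0 : ℚ) < scale ts := by exact_mod_cast scale_pos ts
  have hwf := wf_propP (σ := σ) hσ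
  have hσ10 : σ ≠ 10 := by omega
  have hσ11 : σ ≠ 11 := by omega
  have hσ2 : σ ≠ 2 := by omega
  have hrd : ∀ (s : Store) (c : ℕ) (z : ℤ), rd (s.write 2 c z) 10 11 = rd s 10 11 := fun s c z =>
    funext (rd_congr (Store.write_of_ne _ (by decide) _ _) (Store.write_of_ne _ (by decide) _ _))
  have hind := rep_induction (σ := σ) (c := 0) (j := 1) (s := s) hwf.2.2
    (fun r s' => ∀ q : Fin n, Approx (scale ts) (rd s' 10 11 (q : ℕ)) (A.cyclesWithin V r q)
      (A.cycleValues V q))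
    (by
      intro q
      rw [hrd]
      refine ⟨fun z hz => ?_, fun c hc => ?_⟩
      · rw [Automaton.mem_cycleValues, Fintype.card_fin]
        exact ⟨q, ⟨[], .nil⟩, (hs q).1 z hz⟩
      · obtain ⟨u, ys, hp, hl, hc⟩ := hc
        obtain rfl := List.length_eq_zero_iff.1 (Nat.le_zero.1 hl)
        cases hp
        rw [Fintype.card_fin] at hc
        exact (hs q).2 c hc)
    (fun r hr s' hf _ _ hI => by
      have hin : s' σ = s σ := hf σ hσ2 (by simp [writes, updP, hσ2, hσ10, hσ11])
      rw [hrd]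
      have hind' := rep_induction (σ := σ) (c := 1) (j := 3) (s := s') hwf.2.2.2.2
        (fun i s'' => ∀ q : Fin n, Approx (scale ts) (rd s'' 10 11 (q : ℕ))
          {c | c ∈ A.cyclesWithin V r q ∨ ∃ t ∈ ts.take i, t.1 = q ∧ c ∈ A.cyclesWithin V r t.2.2.2}
          (A.cycleValues V q))
        (fun q => by rw [hrd]; simpa using hI q)
        (fun i hi s'' hf' _ hc hI' => by
          rw [hin, Nat.cast_ofNat, h.len, Int.toNat_natCast] at hi
          have hin' : s'' σ = s σ := (hf' σ hσ2 (by simp [writes, updP, hσ10, hσ11])).trans hin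
          have hsrc := h.src i hi
          have hdst := h.dst i hi
          have hmem := List.getElem_mem hi
          rw [List.take_succ_eq_append_getElem hi]
          generalize ts[i] = τ at hsrc hdst hmem
          obtain ⟨p, a, x, q⟩ := τ
          simp only at hsrc hdst
          simp only [Nat.cast_one] at hc
          have hedge : A.Edge p x q := hA.edge_iff.2 ⟨a, hmem⟩
          have hsv : ∀ s₃ : Store, s₃ 2 = s'' 2 → s₃ σ = s σ →
              (fld σ (ctr 1) 4).val s₃ = (p : ℕ) := fun s₃ e2 eσ => by
            simp [fld, ctr, Exp.val, e2, eσ, hc, hsrc]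
          have hdv : (fld σ (ctr 1) 8).val s'' = (q : ℕ) := by
            simp [fld, ctr, Exp.val, hin', hc, hdst]
          rw [hrd, eval_ite, Exp.val, hdv]
          simp only [List.mem_append, List.mem_singleton]
          have hq := hI' q
          by_cases hpos : 0 < s'' 10 (q : ℕ)
          · rw [if_pos hpos]
            rw [rd, if_pos hpos] at hq
            intro v
            rw [rd_updP (show 10 ≠ 11 by decide) (hsv s'' rfl hin') (by rw [Exp.val, hdv])
              (hsv _ (Store.write_of_ne _ (by decide) _ _)
                ((Store.write_of_ne _ hσ11 _ _).trans hin'))]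
            by_cases hpv : v = p
            · subst hpv
              rw [if_pos rfl]
              refine (hI' v).union hM hq ?_ (T'' := A.cycleValues V v) ?_
              · rintro c (hc | ⟨t, ht | rfl, h1, h2⟩)
                · exact Or.inl (Or.inl hc)
                · exact Or.inl (Or.inr ⟨t, ht, h1, h2⟩)
                · exact Or.inr (Or.inl h2)
              · rintro c (hc | hc)
                · exact hc
                · exact hedge.mem_cycleValues hc
            · rw [if_neg fun hh => hpv (Fin.ext (by exact_mod_cast hh))]
              refine ⟨(hI' v).1, ?_⟩
              rintro c (hc | ⟨t, ht | rfl, h1, h2⟩)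
              · exact (hI' v).2 c (Or.inl hc)
              · exact (hI' v).2 c (Or.inr ⟨t, ht, h1, h2⟩)
              · exact absurd h1.symm hpv
          · rw [if_neg hpos, eval]
            rw [rd, if_neg hpos] at hq
            intro v
            refine ⟨(hI' v).1, ?_⟩
            rintro c (hc | ⟨t, ht | rfl, h1, h2⟩)
            · exact (hI' v).2 c (Or.inl hc)
            · exact (hI' v).2 c (Or.inr ⟨t, ht, h1, h2⟩)
            · obtain ⟨z, hz, -⟩ := hq.2 c (Or.inl h2)
              exact absurd hz WithBot.bot_ne_coe)
      rw [hin, Nat.cast_ofNat, h.len, Int.toNat_natCast, List.take_length] at hind'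
      intro q
      refine ⟨(hind' q).1, fun c hc => (hind' q).2 c ?_⟩
      rcases Automaton.mem_cyclesWithin_succ hc with hc | ⟨x, p, e, hc⟩
      · exact Or.inl hc
      · obtain ⟨a, ha⟩ := hA.edge_iff.1 e
        exact Or.inr ⟨_, ha, rfl, hc⟩)
  rw [Nat.cast_one, h.states, Int.toNat_natCast] at hind
  refine ⟨(hind q).1, fun c hc => (hind q).2 c ?_⟩
  have := Automaton.mem_cyclesWithin_card hc
  rwa [Fintype.card_fin] at this

end SP

/-! ### The reweighting program -/

namespace Automaton

/-- The automaton `A` with each transition reweighted by `θ` at its target. -/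
def reweight {S Q : Type} [DecidableEq Q] (A : Automaton S Q) (θ : Q → ℚ) : Automaton S Q where
  init := A.init
  δ p a := (A.δ p a).image fun t => (θ t.2, t.2)
  total p a := (A.total p a).image _

theorem mem_reweight {S Q : Type} [DecidableEq Q] {A : Automaton S Q} {θ : Q → ℚ} {p q : Q} {a : S}
    {x : ℚ} : (x, q) ∈ (A.reweight θ).δ p a ↔ x = θ q ∧ ∃ x', (x', q) ∈ A.δ p a := by
  simp only [reweight, Finset.mem_image, Prod.mk.injEq, Prod.exists]
  constructor
  · rintro ⟨x', q', h, rfl, rfl⟩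
    exact ⟨rfl, x', h⟩
  · rintro ⟨rfl, x', h⟩
    exact ⟨x', q, h, rfl, rfl⟩

theorem Lists.isCode {m n : ℕ} {B : Automaton (Fin m) (Fin n)} {out : Trans m n} (h : B.Lists out)
    (hn : out.Nodup) : B.IsCode (codeOf B.init out) :=
  ⟨out, hn, h, rfl⟩

end Automaton

namespace SP

/-- Compute the reweighting of the automaton in array `σ` by its top values. -/
def mainP (V : ValFun) (σ : ℕ) : SP :=
  seq (scaleP σ) (seq (weightP σ) (seq (cyclesP V σ) (seq (propP σ) (seq reduceP
    (seq (outP σ) (headP σ))))))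

theorem wf_mainP {σ : ℕ} (hσ : σ = 0 ∨ σ = 3) (V : ValFun) : (mainP V σ).Wf σ :=
  ⟨wf_scaleP hσ, wf_weightP hσ, wf_cyclesP hσ V, wf_propP hσ, wf_reduceP hσ, wf_outP hσ,
    wf_headP hσ⟩

theorem writes_cyclesP (V : ValFun) {σ a : ℕ} (h2 : a ≠ 2) (h7 : a ≠ 7) (h8 : a ≠ 8)
    (h9 : a ≠ 9) (h10 : a ≠ 10) (h11 : a ≠ 11) : a ∉ (cyclesP V σ).writes := by
  have := writes_levelP (σ := σ) V h2 h7 h8 h9 h10 h11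
  simp [cyclesP, sourceP, writes, this, h2, h7, h8]

/-- Only the arrays from `5` on are assumed to be zero. This allows the program to start with its
input in array `3`, after another program has worked on the arrays `2` and `3`. -/
theorem mainP_spec {m n σ : ℕ} {V : ValFun} (hV : V.Tail) (hσ : σ = 0 ∨ σ = 3) {s : Store}
    {A : Automaton (Fin m) (Fin n)} {ts : Trans m n} (hA : A.Lists ts)
    (h : Holds (s σ) A.init ts) (hz : ∀ a, 5 ≤ a → ∀ i, s a i = 0) :
    ∃ (B : Automaton (Fin m) (Fin n)) (out : Trans m n), out.Nodup ∧ B.Lists out ∧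
      Holds ((mainP V σ).eval σ s 1) B.init out ∧ A.IsTopReweighting V B := by
  have hin : ∀ {P : SP}, P.Wf σ → ∀ s', P.eval σ s' σ = s' σ := fun hP s' =>
    eval_frame σ _ (hP.notMem_writes (by omega) (by omega)) s'
  simp only [mainP, eval_seq]
  obtain ⟨w1, w2, w3, w4, w5, w6, -⟩ := wf_mainP hσ V
  have f1 : ∀ a, a ≠ 2 → a ≠ 5 → (scaleP σ).eval σ s a = s a := fun a h2 h5 =>
    eval_frame σ _ (by simp [scaleP, writes, h2, h5]) s
  have g1 := hin w1 s
  have e1 := scaleP_spec hσ h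
  generalize (scaleP σ).eval σ s = s1 at *
  have f2 : ∀ a, a ≠ 2 → a ≠ 6 → (weightP σ).eval σ s1 a = s1 a := fun a h2 h6 =>
    eval_frame σ _ (by simp [weightP, writes, h2, h6]) s1
  have g2 := hin w2 s1
  have e2 := weightP_spec (s := s1) hσ (by rw [g1]; exact h) e1
  generalize (weightP σ).eval σ s1 = s2 at *
  have g2' : s2 σ = s σ := g2.trans g1
  have hM : (scale ts : ℚ) ≠ 0 := by exact_mod_cast (scale_pos ts).ne'
  have e3 := cyclesP_spec (s := s2) hV hσ hA (by rw [g2']; exact h)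
    (fun t ht => by rw [e2 t ht, mul_div_cancel_right₀ _ hM])
    (by rw [f2 7 (by decide) (by decide), f1 7 (by decide) (by decide)]; exact hz 7 (by decide))
    (by rw [f2 10 (by decide) (by decide), f1 10 (by decide) (by decide)]; exact hz 10 (by decide))
  have f3 : ∀ a, a = 5 ∨ 12 ≤ a → (cyclesP V σ).eval σ s2 a = s2 a := fun a ha =>
    eval_frame σ _ (writes_cyclesP V (by omega) (by omega) (by omega) (by omega) (by omega)
      (by omega)) s2
  have g3 := (hin w3 s2).trans g2'
  generalize (cyclesP V σ).eval σ s2 = s3 at *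
  have e4 := propP_spec (s := s3) hσ hA (by rw [g3]; exact h) e3
  have f4 : ∀ a, a = 5 ∨ 12 ≤ a → (propP σ).eval σ s3 a = s3 a := fun a ha =>
    eval_frame σ _ (by simp [propP, updP, writes]; omega) s3
  have g4 := (hin w4 s3).trans g3
  generalize (propP σ).eval σ s3 = s4 at *
  have h45 : s4 5 0 = scale ts := by
    rw [f4 5 (Or.inl rfl), f3 5 (Or.inl rfl), f2 5 (by decide) (by decide), e1]
  have e5 := reduceP_spec (s := s4) hσ (by rw [g4]; exact h) (scale_pos ts) h45
  have f5 : ∀ a, 14 ≤ a → reduceP.eval σ s4 a = s a := fun a ha => by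
    rw [eval_frame σ _ (by simp [reduceP, writes]; omega) s4, f4 a (by omega), f3 a (by omega),
      f2 a (by omega) (by omega), f1 a (by omega) (by omega)]
  have g5 := (hin w5 s4).trans g4
  generalize reduceP.eval σ s4 = s5 at *
  -- Unflagged entries also give some `θ q`, but below flags are seen to be set as soon as there is
  -- a transition.
  set θ : Fin n → ℚ := fun q => (s4 11 (q : ℕ) : ℚ) / scale ts with hθ
  obtain ⟨out, ho⟩ := outP_spec (s := s5) hσ (by rw [g5]; exact h)
    (by rw [f5 14 (by decide)]; exact hz 14 (by decide))
    (by rw [f5 15 (by decide)]; exact hz 15 (by decide) 0) (θ := θ)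
    (fun q => (e5 q q.2).1) (fun q => (e5 q q.2).2)
  have g6 := (hin w6 s5).trans g5
  refine ⟨A.reweight θ, out, ho.nodup, fun p a x q => ?_, headP_spec hσ (by rw [g6]; exact h) ho,
    θ, fun p a t _ => ?_, rfl, fun p a => rfl⟩
  · rw [ho.mem, Automaton.mem_reweight]
    simp only [hA _ _ _ _]
  · have : Nonempty (Fin m) := ⟨a⟩
    obtain ⟨c, hc⟩ := Automaton.cycleValues_nonempty V A t.2
    obtain ⟨z, hz, -⟩ := (e4 t.2).2 c hc
    refine (Automaton.topValue_eq hV ⟨?_, fun c' hc' => ?_⟩).symm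
    · rw [hθ]
      simp only [rd_eq_coe hz]
      exact (e4 t.2).1 z hz
    · obtain ⟨z', hz', hcz⟩ := (e4 t.2).2 c' hc'
      rw [hθ]
      simp only [rd_eq_coe hz']
      exact hcz

end SP

/-! ### The input -/

namespace Automaton

variable {k n : ℕ} {A : Automaton (Fin k) (Fin n)} {ts : Trans k n}

theorem Lists.sum_bits (h : A.Lists ts) (hn : ts.Nodup) :
    ∑ p, ∑ a, ∑ t ∈ A.δ p a, (bits t.1.num + bits t.1.den) =
      (ts.map fun t => bits t.2.2.1.num + bits t.2.2.1.den).sum := by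
  rw [← List.sum_toFinset _ hn, Finset.sum_finset_product _ Finset.univ
    (fun p => Finset.univ.biUnion fun a => (A.δ p a).image (Prod.mk a))]
  · refine Finset.sum_congr rfl fun p _ => ?_
    rw [Finset.sum_finset_product _ Finset.univ (fun a => A.δ p a)]
    rintro ⟨a, t⟩
    simp
  · rintro ⟨p, a, x, q⟩
    simp [h _ _ _ _]

theorem Lists.length_le_size (h : A.Lists ts) (hn : ts.Nodup) : ts.length ≤ A.size := by
  refine le_trans ?_ ((h.sum_bits hn).symm.le.trans ((le_max_right _ _).trans (le_max_right _ _)))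
  refine le_trans (by simp) (List.card_nsmul_le_sum (ts.map _) 1 ?_)
  simp only [List.mem_map]
  rintro _ ⟨t, -, rfl⟩
  simp only [bits]
  omega

theorem Lists.natAbs_lt (h : A.Lists ts) (hn : ts.Nodup) {z : ℤ} (hz : z ∈ codeOf A.init ts) :
    z.natAbs < 2 ^ A.size := by
  have hsmall : ∀ i : ℕ, i ≤ A.size → (i : ℤ).natAbs < 2 ^ A.size := fun i hi => by
    rw [Int.natAbs_natCast]
    exact hi.trans_lt Nat.lt_two_pow_self
  have hk : k ≤ A.size := le_max_left _ _
  have hn' : n ≤ A.size := (le_max_left _ _).trans (le_max_right _ _)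
  have hw : ∀ t ∈ ts, bits t.2.2.1.num + bits t.2.2.1.den ≤ A.size := fun t ht => by
    refine le_trans ?_ ((h.sum_bits hn).symm.le.trans ((le_max_right _ _).trans (le_max_right _ _)))
    exact List.le_sum_of_mem (List.mem_map.2 ⟨t, ht, rfl⟩)
  have hbits : ∀ z : ℤ, bits z ≤ A.size → z.natAbs < 2 ^ A.size := fun z hz =>
    Nat.size_le.1 ((Nat.le_succ _).trans hz)
  simp only [codeOf, encT, List.mem_append, List.mem_flatMap, List.mem_cons, List.not_mem_nil,
    or_false] at hz
  rcases hz with (rfl | rfl | rfl | rfl) | ⟨t, ht, rfl | rfl | rfl | rfl | rfl⟩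
  · exact hsmall _ hk
  · exact hsmall _ hn'
  · exact hsmall _ (A.init.2.le.trans hn')
  · exact hsmall _ (h.length_le_size hn)
  · exact hsmall _ (t.1.2.le.trans hn')
  · exact hsmall _ (t.2.1.2.le.trans hk)
  · exact hbits _ ((Nat.le_add_right _ _).trans (hw t ht))
  · exact hbits _ ((Nat.le_add_left _ _).trans (hw t ht))
  · exact hsmall _ (t.2.2.2.2.le.trans hn')

theorem holds_inputStore (q : Fin n) (ts : Trans k n) :
    Holds (inputStore (codeOf q ts) 0) q ts :=
  holds_of_getD fun j _ => by simp [inputStore]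

theorem Lists.bounded (h : A.Lists ts) (hn : ts.Nodup) :
    SP.Bounded 0 A.size A.size (inputStore (codeOf A.init ts)) := by
  have hall : ∀ a i, (inputStore (codeOf A.init ts) a i).natAbs < 2 ^ A.size := by
    intro a i
    rw [inputStore]
    split_ifs
    · rw [List.getD_eq_getElem?_getD]
      by_cases hi : i.toNat < (codeOf A.init ts).length
      · rw [List.getElem?_eq_getElem hi]
        exact h.natAbs_lt hn (List.getElem_mem hi)
      · rw [List.getElem?_eq_none (not_lt.1 hi)]
        simp
    · simp
  have hn' : n ≤ A.size := (le_max_left _ _).trans (le_max_right _ _)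
  have hh := holds_inputStore A.init ts
  refine ⟨A.init.pos.trans_le hn', le_rfl, hall, hall 0, hall 2, ?_, ?_⟩
  · rw [hh.states]; exact_mod_cast hn'
  · rw [hh.len]; exact_mod_cast h.length_le_size hn

end Automaton

theorem exists_prog_of_tail {V : ValFun} (hV : V.Tail) :
    ∃ (P : Prog) (T : Polynomial ℕ),
      ∀ (k n : ℕ) (A : Automaton (Fin k) (Fin n)) (l : List ℤ), A.IsCode l →
        ∃ (B : Automaton (Fin k) (Fin n)) (l' : List ℤ), B.IsCode l' ∧
          P.Computes l l' (T.eval A.size) ∧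
          (∀ w : ℕ → Fin k, B.value .inf w = safetyClosure (A.value V) w) ∧
          A.IsTopReweighting V B := by
  refine ⟨(SP.mainP V 0).compile 0,
    -- The bound of `SP.exec_compile` with both `y` and `B` equal to the size of the automaton.
    (SP.mainP V 0).poly 0 * (.X + (SP.mainP V 0).poly 0) ^ 2, ?_⟩
  rintro k n A l ⟨ts, hn, hA, rfl⟩
  have hA : A.Lists ts := hA
  obtain ⟨B, out, hno, hB, ho, hAB⟩ := SP.mainP_spec (σ := 0) hV (Or.inl rfl) hA
    (Automaton.holds_inputStore A.init ts) (fun a ha i => by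
      rw [inputStore, if_neg (by omega)])
  obtain ⟨-, t, ht, hE⟩ := SP.exec_compile (by decide) (by decide) _
    (SP.wf_mainP (Or.inl rfl) V) (hA.bounded hn)
  refine ⟨B, codeOf B.init out, hB.isCode hno, ⟨_, t, hE, ?_, ho.getD⟩, hAB.value_inf hV, hAB⟩
  simpa using ht

/-! ### From suprema to limits inferior -/

/-- Record `t` of the array `f` is the transition `τ`. -/
structure HoldsAt {k n : ℕ} (f : ℤ → ℤ) (t : ℕ) (τ : Fin n × Fin k × ℚ × Fin n) : Prop where
  src : f (t * 5 + 4) = (τ.1 : ℕ)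
  lab : f (t * 5 + 5) = (τ.2.1 : ℕ)
  num : f (t * 5 + 6) = τ.2.2.1.num
  den : f (t * 5 + 7) = τ.2.2.1.den
  dst : f (t * 5 + 8) = (τ.2.2.2 : ℕ)

namespace Automaton

variable {k n : ℕ}

/-- The state `q` with the commitment `j`. -/
def commit {T : ℕ} (j : Fin (T + 1)) (q : Fin n) : Fin ((T + 1) * n) := finProdFinEquiv (j, q)

theorem commit_inj {T : ℕ} {j j' : Fin (T + 1)} {q q' : Fin n} :
    commit j q = commit j' q' ↔ j = j' ∧ q = q' := by
  rw [commit, commit, finProdFinEquiv.apply_eq_iff_eq, Prod.mk.injEq]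

theorem exists_commit {T : ℕ} (s : Fin ((T + 1) * n)) :
    ∃ (j : Fin (T + 1)) (q : Fin n), s = commit j q :=
  ⟨_, _, (finProdFinEquiv.apply_symm_apply s).symm⟩

theorem val_commit {T : ℕ} (j : Fin (T + 1)) (q : Fin n) : (commit j q : ℕ) = q + n * j := rfl

variable (ts : Trans k n)

/-- The transition along `t` with the commitment `j`. -/
def committed (j t : Fin ts.length) :
    Fin ((ts.length + 1) * n) × Fin k × ℚ × Fin ((ts.length + 1) * n) :=
  (commit j.castSucc ts[t].1, ts[t].2.1, ts[j].2.2.1, commit j.castSucc ts[t].2.2.2)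

/-- The uncommitted transition along `j`, with the commitment to `j` if `b` is not zero. -/
def uncommitted (j : Fin ts.length) (b : Fin 2) :
    Fin ((ts.length + 1) * n) × Fin k × ℚ × Fin ((ts.length + 1) * n) :=
  (commit (.last _) ts[j].1, ts[j].2.1, ts[j].2.2.1,
    commit (if b = 0 then .last _ else j.castSucc) ts[j].2.2.2)

/-- The transitions of the automaton that commits itself to a weight. -/
def commitTrans : Trans k ((ts.length + 1) * n) :=
  List.ofFn (fun i : Fin (ts.length * ts.length) => committed ts i.divNat i.modNat) ++
    List.ofFn (fun i : Fin (ts.length * 2) => uncommitted ts i.divNat i.modNat)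

variable {ts}

theorem length_commitTrans : (commitTrans ts).length = ts.length * (ts.length + 2) := by
  rw [commitTrans, List.length_append, List.length_ofFn, List.length_ofFn, Nat.mul_add]

theorem mem_commitTrans {τ} : τ ∈ commitTrans ts ↔
    (∃ j t, committed ts j t = τ) ∨ ∃ j b, uncommitted ts j b = τ := by
  rw [commitTrans, List.mem_append, List.mem_ofFn, List.mem_ofFn]
  refine or_congr ⟨fun ⟨i, h⟩ => ⟨_, _, h⟩, fun ⟨j, t, h⟩ => ⟨finProdFinEquiv (j, t), ?_⟩⟩
    ⟨fun ⟨i, h⟩ => ⟨_, _, h⟩, fun ⟨j, t, h⟩ => ⟨finProdFinEquiv (j, t), ?_⟩⟩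
  · have := finProdFinEquiv.symm_apply_apply (j, t)
    rw [finProdFinEquiv_symm_apply, Prod.mk.injEq] at this
    rw [this.1, this.2, h]
  · have := finProdFinEquiv.symm_apply_apply (j, t)
    rw [finProdFinEquiv_symm_apply, Prod.mk.injEq] at this
    rw [this.1, this.2, h]

/-- The committed transitions form a square in row-major order and the uncommitted ones follow in
pairs, so quotient and remainder recover their indices. -/
theorem holdsAt_commitTrans {f : ℤ → ℤ}
    (h1 : ∀ j t : Fin ts.length, HoldsAt f (j * ts.length + t) (committed ts j t))
    (h2 : ∀ (j : Fin ts.length) (b : Fin 2),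
      HoldsAt f (ts.length * ts.length + (j * 2 + b)) (uncommitted ts j b))
    (i : ℕ) (hi : i < (commitTrans ts).length) : HoldsAt f i (commitTrans ts)[i] := by
  by_cases hlt : i < ts.length * ts.length
  · have e : (commitTrans ts)[i] = committed ts (Fin.divNat ⟨i, hlt⟩) (Fin.modNat ⟨i, hlt⟩) := by
      simp only [commitTrans]
      rw [List.getElem_append_left (by simpa using hlt), List.getElem_ofFn]
    have := h1 (Fin.divNat ⟨i, hlt⟩) (Fin.modNat ⟨i, hlt⟩)
    rw [e]
    rwa [Fin.coe_divNat, Fin.coe_modNat, Nat.div_add_mod'] at this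
  · rw [length_commitTrans, Nat.mul_add] at hi
    have hlt' : i - ts.length * ts.length < ts.length * 2 := by omega
    have e : (commitTrans ts)[i] = uncommitted ts (Fin.divNat ⟨_, hlt'⟩) (Fin.modNat ⟨_, hlt'⟩) := by
      simp only [commitTrans]
      rw [List.getElem_append_right (by simpa using hlt), List.getElem_ofFn]
      simp only [List.length_ofFn]
    have := h2 (Fin.divNat ⟨_, hlt'⟩) (Fin.modNat ⟨_, hlt'⟩)
    rw [e]
    rwa [Fin.coe_divNat, Fin.coe_modNat, Nat.div_add_mod', Nat.add_sub_cancel' (not_lt.1 hlt)] at this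

theorem Lists.exists_getElem {A : Automaton (Fin k) (Fin n)} (h : A.Lists ts) {p q : Fin n}
    {a : Fin k} {x : ℚ} (hx : (x, q) ∈ A.δ p a) : ∃ t : Fin ts.length, ts[t] = (p, a, x, q) := by
  obtain ⟨t, ht, e⟩ := List.getElem_of_mem ((h _ _ _ _).2 hx)
  exact ⟨⟨t, ht⟩, e⟩

/-- The automaton that commits itself to a weight. -/
def commitAut (A : Automaton (Fin k) (Fin n)) (h : A.Lists ts) :
    Automaton (Fin k) (Fin ((ts.length + 1) * n)) where
  init := commit (.last _) A.init
  δ s a := ((commitTrans ts).toFinset.filter fun τ => τ.1 = s ∧ τ.2.1 = a).image fun τ => τ.2.2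
  total s a := by
    rw [Finset.image_nonempty]
    obtain ⟨j, p, rfl⟩ := exists_commit s
    obtain ⟨⟨x, q⟩, hx⟩ := A.total p a
    obtain ⟨t, ht⟩ := h.exists_getElem hx
    refine Fin.lastCases ⟨uncommitted ts t 0, ?_⟩ (fun j => ⟨committed ts j t, ?_⟩) j
    · rw [Finset.mem_filter, List.mem_toFinset, mem_commitTrans]
      exact ⟨Or.inr ⟨_, _, rfl⟩, by simp [uncommitted, ht], by simp [uncommitted, ht]⟩
    · rw [Finset.mem_filter, List.mem_toFinset, mem_commitTrans]
      exact ⟨Or.inl ⟨_, _, rfl⟩, by simp [committed, ht], by simp [committed, ht]⟩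

theorem lists_commitAut (A : Automaton (Fin k) (Fin n)) (h : A.Lists ts) :
    (A.commitAut h).Lists (commitTrans ts) := by
  intro p a x q
  simp only [commitAut, Finset.mem_image, Finset.mem_filter, List.mem_toFinset]
  constructor
  · intro hh
    exact ⟨_, ⟨hh, rfl, rfl⟩, rfl⟩
  · rintro ⟨⟨p', a', y⟩, ⟨hh, rfl, rfl⟩, rfl⟩
    exact hh

/-- The first component of a state is its commitment, with the last value standing for none. The
default of `getD`, for which the letter `a₀` is needed, is never used, because only indices below
the length occur as commitments. -/
theorem commits_commitAut (A : Automaton (Fin k) (Fin n)) (h : A.Lists ts) (a₀ : Fin k) :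
    A.Commits (A.commitAut h) ts.length (fun j => ts.getD j (A.init, a₀, 0, A.init))
      (fun s => (finProdFinEquiv.symm s).1) (fun s => (finProdFinEquiv.symm s).2) where
  tr_mem p a x q hx := by
    obtain ⟨t, ht⟩ := h.exists_getElem hx
    refine ⟨t, t.2, ?_⟩
    rw [List.getD_eq_getElem _ _ t.2]
    exact ht
  surj j hj q := ⟨commit ⟨j, Nat.lt_succ_of_le hj⟩ q, by simp [commit], by simp [commit]⟩
  le s := Nat.le_of_lt_succ (Fin.is_lt _)
  J_init := by simp [commitAut, commit]
  π_init := by simp [commitAut, commit]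
  δ_iff s a x t := by
    obtain ⟨j, p, rfl⟩ := exists_commit s
    obtain ⟨i, q, rfl⟩ := exists_commit t
    rw [← lists_commitAut A h, mem_commitTrans]
    simp only [commit, Equiv.symm_apply_apply]
    simp only [← commit.eq_def]
    constructor
    · rintro (⟨c, t, hh⟩ | ⟨c, b, hh⟩)
      · simp only [committed, Prod.mk.injEq, commit_inj] at hh
        obtain ⟨⟨rfl, rfl⟩, rfl, rfl, rfl, rfl⟩ := hh
        refine ⟨ts[t].2.2.1, (h _ _ _ _).1 (List.getElem_mem t.2), Or.inl ⟨c.2, rfl, ?_⟩⟩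
        rw [Fin.val_castSucc, List.getD_eq_getElem _ _ c.2]
        rfl
      · simp only [uncommitted, Prod.mk.injEq, commit_inj] at hh
        obtain ⟨⟨rfl, rfl⟩, rfl, rfl, rfl, rfl⟩ := hh
        refine ⟨ts[c].2.2.1, (h _ _ _ _).1 (List.getElem_mem c.2), Or.inr ⟨rfl, rfl, ?_⟩⟩
        split_ifs
        · exact Or.inl rfl
        · refine Or.inr ⟨c.2, ?_⟩
          rw [Fin.val_castSucc, List.getD_eq_getElem _ _ c.2]
          rfl
    · rintro ⟨x', hx, ⟨hj, hij, rfl⟩ | ⟨hj, rfl, hi | ⟨hi, htr⟩⟩⟩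
      · obtain ⟨t, ht⟩ := h.exists_getElem hx
        refine Or.inl ⟨⟨j, hj⟩, t, ?_⟩
        obtain rfl : i = j := Fin.ext hij
        rw [List.getD_eq_getElem _ _ hj]
        simp only [committed, ht]
        rfl
      · obtain ⟨t, ht⟩ := h.exists_getElem hx
        refine Or.inr ⟨t, 0, ?_⟩
        obtain rfl : i = .last _ := Fin.ext hi
        obtain rfl : j = .last _ := Fin.ext hj
        simp only [uncommitted, ht, if_true]
      · refine Or.inr ⟨⟨i, hi⟩, 1, ?_⟩
        obtain rfl : j = .last _ := Fin.ext hj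
        rw [List.getD_eq_getElem _ _ hi] at htr
        have htr' : ts[(⟨i, hi⟩ : Fin ts.length)] = (p, a, x, q) := htr
        simp only [uncommitted, htr']
        rfl

theorem value_commitAut (A : Automaton (Fin k) (Fin n)) (h : A.Lists ts) (w : ℕ → Fin k) :
    (A.commitAut h).value .limInf w = A.value .sup w :=
  (commits_commitAut A h (w 0)).value_eq w

end Automaton

/-! ### The program that writes the code of the committing automaton. -/

namespace SP

/-- Write a transition to array `3`. -/
def emitP (e e₁ e₂ e₃ e₄ e₅ : Exp) : SP :=
  seq (set 3 (.add (.mul e (.lit 5)) (.lit 4)) e₁) (seq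
    (set 3 (.add (.mul e (.lit 5)) (.lit 5)) e₂) (seq
    (set 3 (.add (.mul e (.lit 5)) (.lit 6)) e₃) (seq
    (set 3 (.add (.mul e (.lit 5)) (.lit 7)) e₄)
    (set 3 (.add (.mul e (.lit 5)) (.lit 8)) e₅))))

/-- The expressions are evaluated between writes to array `3`. Their values are therefore required
in every store that agrees with `s` on the input and on the counters. -/
theorem emitP_spec {k n : ℕ} {s : Store} {e e₁ e₂ e₃ e₄ e₅ : Exp} {t : ℕ}
    {τ : Fin n × Fin k × ℚ × Fin n}
    (h : ∀ s' : Store, s' 0 = s 0 → s' 2 = s 2 → e.val s' = t ∧ e₁.val s' = (τ.1 : ℕ) ∧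
      e₂.val s' = (τ.2.1 : ℕ) ∧ e₃.val s' = τ.2.2.1.num ∧ e₄.val s' = τ.2.2.1.den ∧
      e₅.val s' = (τ.2.2.2 : ℕ)) :
    HoldsAt ((emitP e e₁ e₂ e₃ e₄ e₅).eval 0 s 3) t τ ∧
    ∀ (t' : ℕ) (τ' : Fin n × Fin k × ℚ × Fin n), t' ≠ t → HoldsAt (s 3) t' τ' →
      HoldsAt ((emitP e e₁ e₂ e₃ e₄ e₅).eval 0 s 3) t' τ' := by
  have hw : ∀ (s' : Store) (i z : ℤ), (s' 0 = s 0 ∧ s' 2 = s 2) →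
      (s'.write 3 i z) 0 = s 0 ∧ (s'.write 3 i z) 2 = s 2 := fun s' i z hs' =>
    ⟨(Store.write_of_ne _ (by decide) _ _).trans hs'.1,
      (Store.write_of_ne _ (by decide) _ _).trans hs'.2⟩
  have key : ∀ j, (emitP e e₁ e₂ e₃ e₄ e₅).eval 0 s 3 j =
      if j = t * 5 + 8 then ((τ.2.2.2 : ℕ) : ℤ) else if j = t * 5 + 7 then (τ.2.2.1.den : ℤ) else
      if j = t * 5 + 6 then τ.2.2.1.num else if j = t * 5 + 5 then ((τ.2.1 : ℕ) : ℤ) else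
      if j = t * 5 + 4 then ((τ.1 : ℕ) : ℤ) else s 3 j := by
    intro j
    simp only [emitP, eval, Exp.val]
    obtain ⟨a0, b1, -⟩ := h s rfl rfl
    rw [a0, b1]
    have c1 := hw s (t * 5 + 4) (τ.1 : ℕ) ⟨rfl, rfl⟩
    obtain ⟨a1, -, b2, -⟩ := h _ c1.1 c1.2
    rw [a1, b2]
    have c2 := hw _ (t * 5 + 5) (τ.2.1 : ℕ) c1
    obtain ⟨a2, -, -, b3, -⟩ := h _ c2.1 c2.2
    rw [a2, b3]
    have c3 := hw _ (t * 5 + 6) τ.2.2.1.num c2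
    obtain ⟨a3, -, -, -, b4, -⟩ := h _ c3.1 c3.2
    rw [a3, b4]
    have c4 := hw _ (t * 5 + 7) τ.2.2.1.den c3
    obtain ⟨a4, -, -, -, -, b5⟩ := h _ c4.1 c4.2
    rw [a4, b5]
    simp only [Store.write_self]
  refine ⟨⟨?_, ?_, ?_, ?_, ?_⟩, fun t' τ' hne h' => ⟨?_, ?_, ?_, ?_, ?_⟩⟩
  all_goals rw [key]
  · simp
  · simp
  · simp
  · simp
  · simp
  all_goals
    rw [if_neg (by omega), if_neg (by omega), if_neg (by omega), if_neg (by omega),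
      if_neg (by omega)]
  exacts [h'.src, h'.lab, h'.num, h'.den, h'.dst]

/-- The expression for `Automaton.commit`. -/
def commitE (j q : Exp) : Exp := .add q (.mul (.get 0 (.lit 1)) j)

/-- Write the transitions with a commitment to array `3`. -/
def committedP : SP :=
  rep 0 3 (rep 1 3 (emitP (.add (.mul (ctr 0) (.get 0 (.lit 3))) (ctr 1))
    (commitE (ctr 0) (fld 0 (ctr 1) 4)) (fld 0 (ctr 1) 5) (fld 0 (ctr 0) 6) (fld 0 (ctr 0) 7)
    (commitE (ctr 0) (fld 0 (ctr 1) 8))))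

/-- The place of the transition `Automaton.uncommitted`. -/
def placeE (b : ℤ) : Exp :=
  .add (.mul (.get 0 (.lit 3)) (.get 0 (.lit 3))) (.add (.mul (ctr 0) (.lit 2)) (.lit b))

/-- Write the transitions without a commitment to array `3`. -/
def uncommittedP : SP :=
  rep 0 3 (seq
    (emitP (placeE 0) (commitE (.get 0 (.lit 3)) (fld 0 (ctr 0) 4)) (fld 0 (ctr 0) 5)
      (fld 0 (ctr 0) 6) (fld 0 (ctr 0) 7) (commitE (.get 0 (.lit 3)) (fld 0 (ctr 0) 8)))
    (emitP (placeE 1) (commitE (.get 0 (.lit 3)) (fld 0 (ctr 0) 4)) (fld 0 (ctr 0) 5)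
      (fld 0 (ctr 0) 6) (fld 0 (ctr 0) 7) (commitE (ctr 0) (fld 0 (ctr 0) 8))))

/-- Write a header to array `3`. -/
def commitHeadP : SP :=
  seq (set 3 (.lit 0) (.get 0 (.lit 0))) (seq
    (set 3 (.lit 1) (.mul (.add (.get 0 (.lit 3)) (.lit 1)) (.get 0 (.lit 1)))) (seq
    (set 3 (.lit 2) (commitE (.get 0 (.lit 3)) (.get 0 (.lit 2))))
    (set 3 (.lit 3) (.mul (.add (.get 0 (.lit 3)) (.lit 2)) (.get 0 (.lit 3))))))

/-- Write the code of `Automaton.commitAut` to array `3`. -/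
def commitP : SP := seq committedP (seq uncommittedP commitHeadP)

theorem wf_commitP : commitP.Wf 0 := by
  simp [commitP, committedP, uncommittedP, commitHeadP, placeE, commitE, emitP, Wf, Exp.Ok,
    Exp.Small, fld, ctr, counters]

variable {k n : ℕ} {s : Store} {q₀ : Fin n} {ts : Trans k n}

theorem committedP_spec (h : Holds (s 0) q₀ ts) (j t : Fin ts.length) :
    HoldsAt (committedP.eval 0 s 3) (j * ts.length + t) (Automaton.committed ts j t) := by
  have hwf := wf_commitP.1
  have hind := rep_induction (σ := 0) (c := 0) (j := 3) (s := s) hwf.2.2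
    (fun i s' => ∀ j t : Fin ts.length, (j : ℕ) < i →
      HoldsAt (s' 3) (j * ts.length + t) (Automaton.committed ts j t))
    (fun j t hj => absurd hj (Nat.not_lt_zero _))
    (fun i hi s' hf _ hc hI => by
      rw [Nat.cast_ofNat, h.len, Int.toNat_natCast] at hi
      have hin : s' 0 = s 0 := hf 0 (by decide) (by simp [writes, emitP])
      simp only [Nat.cast_zero] at hc
      have hind' := rep_induction (σ := 0) (c := 1) (j := 3) (s := s') hwf.2.2.2.2
        (fun i' s'' => ∀ j t : Fin ts.length, (j : ℕ) < i ∨ (j : ℕ) = i ∧ (t : ℕ) < i' →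
          HoldsAt (s'' 3) (j * ts.length + t) (Automaton.committed ts j t))
        (fun j t hj => by
          rw [Store.write_of_ne _ (by decide)]
          exact hI j t (by omega))
        (fun i' hi' s'' hf' hfc' hc' hI' => by
          rw [hin, Nat.cast_ofNat, h.len, Int.toNat_natCast] at hi'
          have hin' : s'' 0 = s 0 := (hf' 0 (by decide) (by simp [writes, emitP])).trans hin
          have hc0 : s'' 2 0 = i := by
            have := hfc' 0 (by decide) (by simp [emitP, counters])
            simpa [hc] using this
          simp only [Nat.cast_one] at hc'
          have hem := emitP_spec (s := s'') (t := i * ts.length + i')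
            (τ := Automaton.committed ts ⟨i, hi⟩ ⟨i', hi'⟩)
            (e := .add (.mul (ctr 0) (.get 0 (.lit 3))) (ctr 1))
            (e₁ := commitE (ctr 0) (fld 0 (ctr 1) 4)) (e₂ := fld 0 (ctr 1) 5)
            (e₃ := fld 0 (ctr 0) 6) (e₄ := fld 0 (ctr 0) 7)
            (e₅ := commitE (ctr 0) (fld 0 (ctr 1) 8))
            (fun s₃ h0 h2 => by
              have e3 := h.len
              have e1 := h.states
              have hsrc := h.src i' hi'
              have hlab := h.lab i' hi'
              have hdst := h.dst i' hi'
              have hnum := h.num i hi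
              have hden := h.den i hi
              simp only [commitE, ctr, fld, Exp.val, h0, h2, hin', hc0, hc', e3, e1, Nat.cast_zero,
                Nat.cast_one, hsrc, hlab, hdst, hnum, hden, Automaton.committed,
                Automaton.val_commit]
              push_cast
              exact ⟨rfl, rfl, rfl, rfl, rfl, rfl⟩)
          intro j t hj
          rw [Store.write_of_ne _ (by decide)]
          by_cases heq : (j : ℕ) = i ∧ (t : ℕ) = i'
          · obtain ⟨rfl, rfl⟩ := heq
            exact hem.1
          -- Equal places in row-major order have equal row and column, so the new record overwrites
          -- no other.
          · refine hem.2 _ _ (fun hh => heq ?_) (hI' j t (by omega))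
            have ht0 : 0 < ts.length := by omega
            have e1 := congrArg (· / ts.length) hh
            have e2 := congrArg (· % ts.length) hh
            simp only [Nat.mul_add_mod_of_lt t.2, Nat.mul_add_mod_of_lt hi'] at e2
            simp only [mul_comm _ ts.length, Nat.mul_add_div ht0, Nat.div_eq_of_lt t.2,
              Nat.div_eq_of_lt hi', add_zero] at e1
            exact ⟨e1, e2⟩)
      rw [hin, Nat.cast_ofNat, h.len, Int.toNat_natCast] at hind'
      intro j t hj
      rw [Store.write_of_ne _ (by decide)]
      exact hind' j t (by omega))
  rw [Nat.cast_ofNat, h.len, Int.toNat_natCast] at hind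
  exact hind j t j.2

theorem uncommittedP_spec (h : Holds (s 0) q₀ ts) :
    (∀ (j : Fin ts.length) (b : Fin 2), HoldsAt (uncommittedP.eval 0 s 3)
      (ts.length * ts.length + (j * 2 + b)) (Automaton.uncommitted ts j b)) ∧
    ∀ t τ, t < ts.length * ts.length →
      HoldsAt (k := k) (n := (ts.length + 1) * n) (s 3) t τ →
      HoldsAt (uncommittedP.eval 0 s 3) t τ := by
  have hwf := wf_commitP.2.1
  have hind := rep_induction (σ := 0) (c := 0) (j := 3) (s := s) hwf.2.2
    (fun i s' => (∀ (j : Fin ts.length) (b : Fin 2), (j : ℕ) < i → HoldsAt (s' 3)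
      (ts.length * ts.length + (j * 2 + b)) (Automaton.uncommitted ts j b)) ∧
      ∀ t τ, t < ts.length * ts.length →
        HoldsAt (k := k) (n := (ts.length + 1) * n) (s 3) t τ → HoldsAt (s' 3) t τ)
    ⟨fun j t hj => absurd hj (Nat.not_lt_zero _), fun t τ _ hh => by
      rwa [Store.write_of_ne _ (by decide)]⟩
    (fun i hi s' hf _ hc ⟨hI1, hI2⟩ => by
      rw [Nat.cast_ofNat, h.len, Int.toNat_natCast] at hi
      have hin : s' 0 = s 0 := hf 0 (by decide) (by simp [writes, emitP])
      simp only [Nat.cast_zero] at hc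
      have e3 := h.len
      have e1 := h.states
      have hsrc := h.src i hi
      have hlab := h.lab i hi
      have hdst := h.dst i hi
      have hnum := h.num i hi
      have hden := h.den i hi
      rw [eval_seq]
      have hem := emitP_spec (s := s') (t := ts.length * ts.length + (i * 2 + 0))
        (τ := Automaton.uncommitted ts ⟨i, hi⟩ 0)
        (e := placeE 0) (e₁ := commitE (.get 0 (.lit 3)) (fld 0 (ctr 0) 4)) (e₂ := fld 0 (ctr 0) 5)
        (e₃ := fld 0 (ctr 0) 6) (e₄ := fld 0 (ctr 0) 7)
        (e₅ := commitE (.get 0 (.lit 3)) (fld 0 (ctr 0) 8))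
        (fun s₃ h0 h2 => by
          simp only [placeE, commitE, ctr, fld, Exp.val, h0, h2, hin, hc, e3, e1, Nat.cast_zero,
            hsrc, hlab, hdst, hnum, hden, Automaton.uncommitted, Automaton.val_commit, if_true,
            Fin.val_last]
          push_cast
          exact ⟨rfl, rfl, rfl, rfl, rfl, rfl⟩)
      have hfr : ∀ a, a ≠ 3 → (emitP (placeE 0) (commitE (.get 0 (.lit 3)) (fld 0 (ctr 0) 4))
          (fld 0 (ctr 0) 5) (fld 0 (ctr 0) 6) (fld 0 (ctr 0) 7)
          (commitE (.get 0 (.lit 3)) (fld 0 (ctr 0) 8))).eval 0 s' a = s' a := fun a ha =>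
        eval_frame 0 _ (by simp [emitP, writes, ha]) s'
      generalize SP.eval 0 _ s' = s₁ at hem hfr
      have hin1 : s₁ 0 = s 0 := (hfr 0 (by decide)).trans hin
      have hc1 : s₁ 2 0 = i := by rw [hfr 2 (by decide), hc]
      have hem' := emitP_spec (s := s₁) (t := ts.length * ts.length + (i * 2 + 1))
        (τ := Automaton.uncommitted ts ⟨i, hi⟩ 1)
        (e := placeE 1) (e₁ := commitE (.get 0 (.lit 3)) (fld 0 (ctr 0) 4)) (e₂ := fld 0 (ctr 0) 5)
        (e₃ := fld 0 (ctr 0) 6) (e₄ := fld 0 (ctr 0) 7)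
        (e₅ := commitE (ctr 0) (fld 0 (ctr 0) 8))
        (fun s₃ h0 h2 => by
          simp only [placeE, commitE, ctr, fld, Exp.val, h0, h2, hin1, hc1, e3, e1, Nat.cast_zero,
            hsrc, hlab, hdst, hnum, hden, Automaton.uncommitted, Automaton.val_commit,
            one_ne_zero, if_false, Fin.val_last, Fin.val_castSucc]
          push_cast
          exact ⟨rfl, rfl, rfl, rfl, rfl, rfl⟩)
      rw [Store.write_of_ne _ (by decide)]
      refine ⟨fun j b hj => ?_, fun t τ ht hh =>
        hem'.2 _ _ (by omega) (hem.2 _ _ (by omega) (hI2 t τ ht hh))⟩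
      rcases (Nat.lt_succ_iff.1 hj).lt_or_eq with hlt | rfl
      · exact hem'.2 _ _ (by omega) (hem.2 _ _ (by omega) (hI1 j b hlt))
      · fin_cases b
        · exact hem'.2 _ _ (by simp) hem.1
        · exact hem'.1)
  rw [Nat.cast_ofNat, h.len, Int.toNat_natCast] at hind
  exact ⟨fun j b => hind.1 j b j.2, hind.2⟩

theorem commitP_spec {A : Automaton (Fin k) (Fin n)} (hA : A.Lists ts)
    (h : Holds (s 0) A.init ts) :
    Holds (commitP.eval 0 s 3) (A.commitAut hA).init (Automaton.commitTrans ts) := by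
  rw [commitP, eval_seq, eval_seq]
  have h1 := committedP_spec h
  have g1 : committedP.eval 0 s 0 = s 0 :=
    eval_frame 0 _ (wf_commitP.1.notMem_writes (by decide) (by decide)) s
  generalize committedP.eval 0 s = s₁ at h1 g1
  obtain ⟨h2, h2'⟩ := uncommittedP_spec (s := s₁) (by rw [g1]; exact h)
  have g2 : uncommittedP.eval 0 s₁ 0 = s 0 :=
    (eval_frame 0 _ (wf_commitP.2.1.notMem_writes (by decide) (by decide)) s₁).trans g1
  generalize uncommittedP.eval 0 s₁ = s₂ at h2 h2' g2
  have hall := Automaton.holdsAt_commitTrans (f := s₂ 3)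
    (fun j t => h2' _ _ (by nlinarith [j.2, t.2, Nat.mul_le_mul_right ts.length j.2]) (h1 j t)) h2
  have hh : ∀ (i : ℕ) (z : ℤ), 4 ≤ z → commitHeadP.eval 0 s₂ 3 ((i : ℤ) * 5 + z) =
      s₂ 3 (i * 5 + z) := by
    intro i z hz
    simp only [commitHeadP, eval, Store.write_self, Exp.val]
    rw [if_neg (by omega), if_neg (by omega), if_neg (by omega), if_neg (by omega)]
  have e0 := h.alph
  have e1 := h.states
  have e2 := h.init
  have e3 := h.len
  refine ⟨?_, ?_, ?_, ?_, fun t ht => (hh _ _ (by norm_num)).trans (hall t ht).src,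
    fun t ht => (hh _ _ (by norm_num)).trans (hall t ht).lab,
    fun t ht => (hh _ _ (by norm_num)).trans (hall t ht).num,
    fun t ht => (hh _ _ (by norm_num)).trans (hall t ht).den,
    fun t ht => (hh _ _ (by norm_num)).trans (hall t ht).dst⟩
  all_goals
    simp [commitHeadP, commitE, eval, Store.write_self, Store.write_of_ne, Exp.val, g2, e0, e1, e2,
      e3, Automaton.length_commitTrans, Automaton.commitAut, Automaton.val_commit]
  ring

end SP

/-- The two programs run one after the other, with array `3` as output of the first and input of the
second. The number `m` of states is that of the committing automaton. -/
theorem exists_prog_of_sup : ∃ (P : Prog) (T : Polynomial ℕ),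
    ∀ (k n : ℕ) (A : Automaton (Fin k) (Fin n)) (l : List ℤ), A.IsCode l →
      ∃ (m : ℕ) (B : Automaton (Fin k) (Fin m)) (l' : List ℤ), B.IsCode l' ∧
        P.Computes l l' (T.eval A.size) ∧
        (∀ w : ℕ → Fin k, B.value .inf w = safetyClosure (A.value .sup) w) ∧
        ∃ C : Automaton (Fin k) (Fin m),
          (∀ w : ℕ → Fin k, C.value .limInf w = A.value .sup w) ∧
          C.IsTopReweighting .limInf B := by
  set p := SP.commitP.poly 0 with hp
  set r := (SP.mainP .limInf 3).poly 3 with hr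
  refine ⟨.seq (SP.commitP.compile 0) ((SP.mainP .limInf 3).compile 3),
    p * (Polynomial.X + p) ^ 2 + (r * (Polynomial.X + r) ^ 2).comp
      (Polynomial.X + p + (Polynomial.X + 1) * Polynomial.X + (Polynomial.X + 2) * Polynomial.X), ?_⟩
  rintro k n A l ⟨ts, hn, hA, rfl⟩
  have hA : A.Lists ts := hA
  have hV : ValFun.limInf.Tail := Or.inl rfl
  have hin := Automaton.holds_inputStore A.init ts
  have hC := SP.commitP_spec hA hin
  have hb := hA.bounded hn
  obtain ⟨hb', t, ht, hE⟩ := SP.exec_compile (by decide) (by decide) _ SP.wf_commitP hb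
  rw [← hp] at hb' ht
  have hfr : ∀ a, 5 ≤ a → SP.commitP.eval 0 (inputStore (codeOf A.init ts)) a =
      inputStore (codeOf A.init ts) a := fun a ha => SP.eval_frame 0 _ (by
    simp [SP.commitP, SP.committedP, SP.uncommittedP, SP.commitHeadP, SP.emitP, SP.writes]; omega) _
  have hs1 := hb.one
  have hs3 := hb.three
  rw [hin.states] at hs1
  rw [hin.len] at hs3
  change Holds (SP.commitP.eval 0 (inputStore (codeOf A.init ts)) 3) _ _ at hC
  change Exec _ (inputStore (codeOf A.init ts)) _ _ at hE
  generalize SP.commitP.eval 0 (inputStore (codeOf A.init ts)) = s at *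
  obtain ⟨B, out, hno, hB, ho, hCB⟩ := SP.mainP_spec (σ := 3) hV (Or.inr rfl)
    (A.lists_commitAut hA) hC (fun a ha i => by
      rw [hfr a ha, inputStore, if_neg (by omega)])
  have hval : (A.commitAut hA).value .limInf = A.value .sup := funext (A.value_commitAut hA)
  -- For the second program the lengths reached by the first one count as input lengths. The last
  -- two summands dominate the numbers of states and of transitions of the committing automaton,
  -- which bound the loops. This sum is what the second polynomial is composed with.
  have hbs : SP.Bounded 3
      (A.size + p.eval A.size + (A.size + 1) * A.size + (A.size + 2) * A.size)
      (A.size + p.eval A.size + (A.size + 1) * A.size + (A.size + 2) * A.size) s := by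
    have hall : ∀ a i, (s a i).natAbs <
        2 ^ (A.size + p.eval A.size + (A.size + 1) * A.size + (A.size + 2) * A.size) :=
      fun a i => (hb'.all a i).trans_le (Nat.pow_le_pow_right (by norm_num)
        ((Nat.le_add_right _ _).trans (Nat.le_add_right _ _)))
    have hs1' : n ≤ A.size := by exact_mod_cast hs1
    have hs3' : ts.length ≤ A.size := by exact_mod_cast hs3
    refine ⟨?_, le_rfl, hall, hall 3, hall 2, ?_, ?_⟩
    · have := hb.pos; omega
    · rw [hC.states]
      have : (ts.length + 1) * n ≤ (A.size + 1) * A.size :=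
        Nat.mul_le_mul (Nat.succ_le_succ hs3') hs1'
      exact_mod_cast (by omega : (ts.length + 1) * n ≤
        A.size + p.eval A.size + (A.size + 1) * A.size + (A.size + 2) * A.size)
    · rw [hC.len, Automaton.length_commitTrans, mul_comm]
      have : (ts.length + 2) * ts.length ≤ (A.size + 2) * A.size :=
        Nat.mul_le_mul (Nat.add_le_add_right hs3' 2) hs3'
      exact_mod_cast (by omega : (ts.length + 2) * ts.length ≤
        A.size + p.eval A.size + (A.size + 1) * A.size + (A.size + 2) * A.size)
  obtain ⟨-, t', ht', hE'⟩ := SP.exec_compile (by decide) (by decide) _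
    (SP.wf_mainP (Or.inr rfl) .limInf) hbs
  rw [← hr] at ht'
  refine ⟨_, B, codeOf B.init out, hB.isCode hno, ⟨_, t + t', .seq hE hE', ?_, ho.getD⟩, ?_,
    A.commitAut hA, A.value_commitAut hA, hCB⟩
  · simp only [Polynomial.eval_add, Polynomial.eval_mul, Polynomial.eval_pow, Polynomial.eval_X,
      Polynomial.eval_comp, Polynomial.eval_one, Polynomial.eval_ofNat]
    exact Nat.add_le_add ht ht'
  · intro w
    rw [hCB.value_inf hV, hval]

end QuantAut

/-! ### The theorem, from its two cases. -/

theorem mainTheorem3 :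
    (∀ V : QuantAut.ValFun,
      (V = .limInf ∨ V = .limSup ∨ V = .limInfAvg ∨ V = .limSupAvg) →
      ∃ (P : QuantAut.Prog) (T : Polynomial ℕ),
        ∀ (k n : ℕ) (A : QuantAut.Automaton (Fin k) (Fin n)) (l : List ℤ), A.IsCode l →
          ∃ (B : QuantAut.Automaton (Fin k) (Fin n)) (l' : List ℤ), B.IsCode l' ∧
            P.Computes l l' (T.eval A.size) ∧
            (∀ w : ℕ → Fin k, B.value .inf w = QuantAut.safetyClosure (A.value V) w) ∧
            A.IsTopReweighting V B) ∧
    (∃ (P : QuantAut.Prog) (T : Polynomial ℕ),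
      ∀ (k n : ℕ) (A : QuantAut.Automaton (Fin k) (Fin n)) (l : List ℤ), A.IsCode l →
        ∃ (m : ℕ) (B : QuantAut.Automaton (Fin k) (Fin m)) (l' : List ℤ), B.IsCode l' ∧
          P.Computes l l' (T.eval A.size) ∧
          (∀ w : ℕ → Fin k, B.value .inf w = QuantAut.safetyClosure (A.value .sup) w) ∧
          ∃ C : QuantAut.Automaton (Fin k) (Fin m),
            (∀ w : ℕ → Fin k, C.value .limInf w = A.value .sup w) ∧
            C.IsTopReweighting .limInf B) :=
  ⟨fun _ hV => QuantAut.exists_prog_of_tail hV, QuantAut.exists_prog_of_sup⟩
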